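/- Let $G=(V,E)$ be a finite simple graph. $G$ is a *DE graph* if there are a finite directed tree $T$ (an undirected tree each of whose edges is oriented in exactly one direction) and directed paths $(P_v)_{v\in V}$ in $T$ such that two distinct vertices $u,v$ are adjacent in $G$ if and only if $P_u$ and $P_v$ have an arc in common. A *super-orientation* of $G$ is a digraph $D$ on $V$ obtained by orienting each edge of $G$ in one direction or in both directions; it is *clique-acyclic* if no clique of $G$ contains a directed cycle all of whose arcs are oriented in only one direction. A *kernel* of $D$ is a set $K\subseteq V$ containing no two adjacent vertices and such that for every $u\in V\setminus K$ there is $v\in K$ with $(u,v)$ an arc of $D$. **Theorem.** A kernel of a clique-acyclic super-orientation of a DE graph can be computed in polynomial time. That is, there are one random access machine program (unit cost; addition, truncated subtraction, indirect addressing, tests; no multiplication) and one polynomial $f$ such that for every $n$ and every digraph $D$ on the vertex set $\{0,\dots,n-1\}$ that is a clique-acyclic super-orientation of some DE graph, the program, given only $n$ and the adjacency matrix of $D$, halts after at most $f(n)$ steps and outputs (the indicator vector of) a kernel of $D$. -/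

import Mathlib

/-! ### Digraphs, super-orientations, kernels -/

namespace KernelDE

section Graphs

variable {V : Type*}

/-- `D` is a super-orientation of `G`: every edge of `G` is oriented in one direction or in both,
and `D` has no other arcs (in particular no loops). -/
def IsSuperOrientation (D : Digraph V) (G : SimpleGraph V) : Prop :=
  ∀ u v, G.Adj u v ↔ D.Adj u v ∨ D.Adj v u

/-- The arcs of `D` that are oriented in only one direction. -/
def OneWay (D : Digraph V) (u v : V) : Prop :=
  D.Adj u v ∧ ¬ D.Adj v u

/-- No clique of `G` contains a directed cycle of `D` consisting of one-way arcs. (The transitive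
closure relates `x` to itself exactly when `x` lies on a closed directed walk of one-way arcs
inside `C`; such a closed walk exists if and only if such a directed cycle exists.) -/
def CliqueAcyclic (D : Digraph V) (G : SimpleGraph V) : Prop :=
  ∀ C : Set V, G.IsClique C →
    ∀ x, ¬ Relation.TransGen (fun u v => u ∈ C ∧ v ∈ C ∧ OneWay D u v) x x

/-- No two vertices of `S` are adjacent in `D`. -/
def IsStable (D : Digraph V) (S : Set V) : Prop :=
  ∀ u ∈ S, ∀ v ∈ S, ¬ D.Adj u v

/-- Every vertex outside `S` has an arc towards a vertex of `S`. -/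
def IsAbsorbing (D : Digraph V) (S : Set V) : Prop :=
  ∀ u, u ∉ S → ∃ v ∈ S, D.Adj u v

/-- A kernel is a stable and absorbing set of vertices. -/
def IsKernel (D : Digraph V) (S : Set V) : Prop :=
  IsStable D S ∧ IsAbsorbing D S

/-- A directed tree: every edge of an undirected tree is given exactly one direction. -/
def IsDirectedTree (T : Digraph V) : Prop :=
  (∀ x y, T.Adj x y → ¬ T.Adj y x) ∧ T.toSimpleGraphInclusive.IsTree

/-- A directed path of `T`, given as the list of its successive (pairwise distinct) vertices. -/
def IsDirectedPath (T : Digraph V) (p : List V) : Prop :=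
  p ≠ [] ∧ p.Nodup ∧ p.IsChain T.Adj

/-- The set of arcs of a path: the pairs of consecutive vertices. -/
def pathArcs (p : List V) : Set (V × V) :=
  {a | a ∈ p.zip p.tail}

/-- `G` is a DE (directed edge) graph: the intersection graph of a family of directed paths, seen
as sets of arcs, in a finite directed tree. -/
def IsDEGraph (G : SimpleGraph V) : Prop :=
  ∃ (W : Type) (_ : Finite W) (T : Digraph W) (P : V → List W),
    IsDirectedTree T ∧ (∀ v, IsDirectedPath T (P v)) ∧
      ∀ u v, G.Adj u v ↔ u ≠ v ∧ (pathArcs (P u) ∩ pathArcs (P v)).Nonempty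

end Graphs

/-! ### Random access machine programs with a step count -/

/-- Memory: registers numbered by `ℕ`, each holding a natural number. -/
abbrev Mem : Type := ℕ → ℕ

/-- Expressions: constants, contents of the register with a computed address, sum, truncated
difference. There is no multiplication, so that the bit length of the numbers in memory grows by
at most a constant per elementary step, and counting each step as one unit of time is
polynomially equivalent to Turing machine time. -/
inductive Expr : Type
  | const (k : ℕ)
  | reg (addr : Expr)
  | add (a b : Expr)
  | sub (a b : Expr)

/-- The value of an expression. -/
def Expr.eval (m : Mem) : Expr → ℕ
  | .const k => k
  | .reg a => m (a.eval m)
  | .add a b => a.eval m + b.eval m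
  | .sub a b => a.eval m - b.eval m

/-- The number of elementary steps for evaluating an expression. -/
def Expr.cost : Expr → ℕ
  | .const _ => 1
  | .reg a => a.cost + 1
  | .add a b => a.cost + b.cost + 1
  | .sub a b => a.cost + b.cost + 1

/-- Programs: `store a e` writes the value of `e` into the register with address `a`; a test
succeeds when the value of the tested expression is nonzero. -/
inductive Prog : Type
  | skip
  | store (a e : Expr)
  | seq (p q : Prog)
  | ite (e : Expr) (p q : Prog)
  | loop (e : Expr) (p : Prog)

/-- `Runs p m m' t`: started on memory `m`, the program `p` halts after exactly `t` steps with
memory `m'`. -/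
inductive Runs : Prog → Mem → Mem → ℕ → Prop
  | skip (m : Mem) : Runs .skip m m 1
  | store (a e : Expr) (m : Mem) :
      Runs (.store a e) m (Function.update m (a.eval m) (e.eval m)) (a.cost + e.cost + 1)
  | seq {p q : Prog} {m₀ m₁ m₂ : Mem} {s t : ℕ} :
      Runs p m₀ m₁ s → Runs q m₁ m₂ t → Runs (.seq p q) m₀ m₂ (s + t + 1)
  | ite_true {e : Expr} {p q : Prog} {m m' : Mem} {t : ℕ} :
      e.eval m ≠ 0 → Runs p m m' t → Runs (.ite e p q) m m' (e.cost + t + 1)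
  | ite_false {e : Expr} {p q : Prog} {m m' : Mem} {t : ℕ} :
      e.eval m = 0 → Runs q m m' t → Runs (.ite e p q) m m' (e.cost + t + 1)
  | loop_stop {e : Expr} {p : Prog} {m : Mem} :
      e.eval m = 0 → Runs (.loop e p) m m (e.cost + 1)
  | loop_step {e : Expr} {p : Prog} {m₀ m₁ m₂ : Mem} {s t : ℕ} :
      e.eval m₀ ≠ 0 → Runs p m₀ m₁ s → Runs (.loop e p) m₁ m₂ t →
        Runs (.loop e p) m₀ m₂ (e.cost + s + t + 1)

/-- Programs are deterministic: the final memory and the number of steps are determined by the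
program and the initial memory. -/
theorem Runs.deterministic {p : Prog} {m m₁ m₂ : Mem} {t₁ t₂ : ℕ}
    (h₁ : Runs p m m₁ t₁) (h₂ : Runs p m m₂ t₂) : m₁ = m₂ ∧ t₁ = t₂ := by
  induction h₁ generalizing m₂ t₂ with
  | skip m => cases h₂; exact ⟨rfl, rfl⟩
  | store a e m => cases h₂; exact ⟨rfl, rfl⟩
  | seq _ _ ih₁ ih₂ =>
    cases h₂ with
    | seq k₁ k₂ =>
      obtain ⟨rfl, rfl⟩ := ih₁ k₁
      obtain ⟨rfl, rfl⟩ := ih₂ k₂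
      exact ⟨rfl, rfl⟩
  | ite_true he _ ih =>
    cases h₂ with
    | ite_true _ k => obtain ⟨rfl, rfl⟩ := ih k; exact ⟨rfl, rfl⟩
    | ite_false k _ => exact absurd k he
  | ite_false he _ ih =>
    cases h₂ with
    | ite_true k _ => exact absurd he k
    | ite_false _ k => obtain ⟨rfl, rfl⟩ := ih k; exact ⟨rfl, rfl⟩
  | loop_stop he =>
    cases h₂ with
    | loop_stop _ => exact ⟨rfl, rfl⟩
    | loop_step k _ _ => exact absurd he k
  | loop_step he _ _ ih₁ ih₂ =>
    cases h₂ with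
    | loop_stop k => exact absurd k he
    | loop_step _ k₁ k₂ =>
      obtain ⟨rfl, rfl⟩ := ih₁ k₁
      obtain ⟨rfl, rfl⟩ := ih₂ k₂
      exact ⟨rfl, rfl⟩

/-! ### Polynomial-time kernel computation -/

open Classical in
/-- The input memory for a digraph with vertices `0, …, n - 1`: register `0` holds `n`, register
`1 + i * n + j` holds `1` if `(i, j)` is an arc and `0` otherwise (the adjacency matrix, row by
row), and all other registers hold `0`. -/
noncomputable def inputMem {n : ℕ} (D : Digraph (Fin n)) : Mem := fun a =>
  if a = 0 then n
  else if ∃ i j : Fin n, a = 1 + (i : ℕ) * n + (j : ℕ) ∧ D.Adj i j then 1 else 0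

/-- The set of vertices that the final memory `m` represents: vertex `v` belongs to it when
register `v` holds `1`. -/
def outputSet (n : ℕ) (m : Mem) : Set (Fin n) :=
  {v | m (v : ℕ) = 1}

/-- Kernel computation is polynomial in the class `𝒟` of digraphs: there are one program and one
polynomial such that, for every digraph of the class, the program, given the digraph only, halts
with a kernel of it after a number of steps bounded by the polynomial in the number of vertices. -/
def PolyTimeKernel (𝒟 : (n : ℕ) → Digraph (Fin n) → Prop) : Prop :=
  ∃ (p : Prog) (f : Polynomial ℕ), ∀ (n : ℕ) (D : Digraph (Fin n)), 𝒟 n D →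
    ∃ (m : Mem) (t : ℕ),
      Runs p (inputMem D) m t ∧ t ≤ f.eval n ∧ IsKernel D (outputSet n m)

end KernelDE

/-! Kernels of bicolored digraphs. Suppose that adjacency is the union of two equivalence relations,
as in the line graph of a bipartite graph. Clique-acyclicity gives each clique a vertex to which all
others point and one that points to all others (`CliqueAcyclic.cliqueExtremes`), so every class has
a best and a worst remaining member, although preferences need not be transitive. Deferred
acceptance then works: each class of the first color without a proposal proposes its best remaining
member, and each class of the second color with two proposals discards its worst remaining member. A
discarded vertex points to all survivors of its class, one of which is a proposal, so the proposals
form a kernel once nothing changes any more (`Deferred.kernelOn`).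

Leaves. In a directed tree carrying the paths, descend into ever smaller branches until the root `w`
of the branch lies on every path of the family inside it. Let `A` be the paths inside and `C` those
that leave the branch. All of them pass through `w`, and two directed paths through `w` with a
common arc have a common arc at `w`. Hence `A ∪ C` is bicolored by the arc entering and the arc
leaving `w`, and `C`, whose members all use the single edge leaving the branch, is a clique
separating `A` from the rest (`exists_branch`, `exists_star`).

Gluing. Compute a kernel of `A ∪ C`. If it meets the clique `C`, it does so in one vertex `c`:
record its trace on `A` under the name `c`, delete `c`, and repeat until the kernel avoids `C`.
Delete what is left of `A ∪ C` and solve the remaining digraph. A kernel of it that contains a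
recorded `c` is completed by the trace of `c`, any other one by the last kernel (`Solved.extend`).

Recognition. The tree is not part of the input. Inside `A ∪ C` there is always a part cut off by the
common neighborhood of two vertices (`Star.exists_separation`), and its two colors can be propagated
from a single pair (`IsColoring.correct`). So trying all quadruples of vertices finds a leaf. Each
find is checked, so its soundness does not depend on the tree.

Complexity. The algorithm consists of first-order updates of finitely many binary relations and
loops over the vertices. Every program of this kind compiles to a polynomial-time machine program,
by structural induction (`St.comp_correct`); what remains is that `n` passes of each loop suffice.
-/

namespace KernelDE

/-! ### Total correctness with a time bound -/

/-- Started on `m`, the program `p` halts within `T` steps in a memory satisfying `Q`. -/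
def Does (p : Prog) (m : Mem) (T : ℕ) (Q : Mem → Prop) : Prop :=
  ∃ m' t, Runs p m m' t ∧ t ≤ T ∧ Q m'

theorem Does.mono {p : Prog} {m : Mem} {T T' : ℕ} {Q Q' : Mem → Prop}
    (h : Does p m T Q) (hT : T ≤ T') (hQ : ∀ m', Q m' → Q' m') : Does p m T' Q' := by
  obtain ⟨m', t, hr, ht, hq⟩ := h
  exact ⟨m', t, hr, ht.trans hT, hQ _ hq⟩

theorem Does.skip {m : Mem} {Q : Mem → Prop} (h : Q m) : Does .skip m 1 Q :=
  ⟨m, 1, .skip m, le_rfl, h⟩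

theorem Does.store {a e : Expr} {m : Mem} {Q : Mem → Prop}
    (h : Q (Function.update m (a.eval m) (e.eval m))) :
    Does (.store a e) m (a.cost + e.cost + 1) Q :=
  ⟨_, _, .store a e m, le_rfl, h⟩

theorem Does.seq {p q : Prog} {m : Mem} {T₁ T₂ : ℕ} {Q : Mem → Prop}
    (h : Does p m T₁ fun m₁ => Does q m₁ T₂ Q) : Does (.seq p q) m (T₁ + T₂ + 1) Q := by
  obtain ⟨m₁, s, h₁, hs, m₂, t, h₂, ht, hq⟩ := h
  exact ⟨m₂, s + t + 1, .seq h₁ h₂, by omega, hq⟩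

theorem Does.ite {e : Expr} {p q : Prog} {m : Mem} {T₁ T₂ : ℕ} {Q : Mem → Prop}
    (h₁ : e.eval m ≠ 0 → Does p m T₁ Q) (h₂ : e.eval m = 0 → Does q m T₂ Q) :
    Does (.ite e p q) m (e.cost + (T₁ + T₂) + 1) Q := by
  by_cases h : e.eval m = 0
  · obtain ⟨m', t, hr, ht, hq⟩ := h₂ h
    exact ⟨m', _, .ite_false h hr, by omega, hq⟩
  · obtain ⟨m', t, hr, ht, hq⟩ := h₁ h
    exact ⟨m', _, .ite_true h hr, by omega, hq⟩

/-- The value of the loop test is itself the variant, so its initial value bounds the number of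
passes. All loops of the compiled programs have this form. -/
theorem Does.loop {e : Expr} {p : Prog} {B : ℕ} (I : Mem → Prop)
    (hI : ∀ m, I m → e.eval m ≠ 0 → Does p m B fun m' => I m' ∧ e.eval m' < e.eval m)
    {m : Mem} {N : ℕ} (hm : I m) (hN : e.eval m ≤ N) :
    Does (.loop e p) m (N * (e.cost + B + 1) + e.cost + 1)
      fun m' => I m' ∧ e.eval m' = 0 := by
  induction N generalizing m with
  | zero => exact ⟨m, _, Runs.loop_stop (by omega), by omega, hm, by omega⟩
  | succ N ih =>
    by_cases h : e.eval m = 0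
    · exact ⟨m, _, Runs.loop_stop h, by nlinarith, hm, h⟩
    · obtain ⟨m₁, s, h₁, hs, hI₁, hlt⟩ := hI m hm h
      obtain ⟨m₂, t, h₂, ht, hq⟩ := ih hI₁ (by omega)
      exact ⟨m₂, _, .loop_step h h₁ h₂, by nlinarith, hq⟩

/-! ### A language of first-order updates and bounded loops -/

/-- First-order formulas over binary relations, with variables numbered by binding level. -/
inductive Fm : Type
  | rel (k x y : ℕ)
  | eq (x y : ℕ)
  | lt (x y : ℕ)
  | neg (φ : Fm)
  | and (φ ψ : Fm)
  | ex (φ : Fm)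

/-- A family of binary relations on the vertex set. -/
abbrev State (n : ℕ) : Type := ℕ → Fin n → Fin n → Prop

/-- The truth value of a formula at binding level `d`. -/
def Fm.eval {n : ℕ} (σ : State n) : Fm → ℕ → (ℕ → Fin n) → Prop
  | .rel k x y, _, ρ => σ k (ρ x) (ρ y)
  | .eq x y, _, ρ => ρ x = ρ y
  | .lt x y, _, ρ => ρ x < ρ y
  | .neg φ, d, ρ => ¬ φ.eval σ d ρ
  | .and φ ψ, d, ρ => φ.eval σ d ρ ∧ ψ.eval σ d ρ
  | .ex φ, d, ρ => ∃ i, φ.eval σ (d + 1) (Function.update ρ d i)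

/-- All variables are bound, relation numbers and binding levels are in the admitted range, and
relation `k₀` does not occur. -/
def Fm.wf (k₀ : ℕ) : Fm → ℕ → Bool
  | .rel k x y, d => k < 32 && k != k₀ && x < d && y < d
  | .eq x y, d => x < d && y < d
  | .lt x y, d => x < d && y < d
  | .neg φ, d => φ.wf k₀ d
  | .and φ ψ, d => φ.wf k₀ d && ψ.wf k₀ d
  | .ex φ, d => d < 15 && φ.wf k₀ (d + 1)

/-- Needed for `k₀ = 0`, the scratch relation, whose contents must not influence any formula of a
statement. -/
theorem Fm.eval_congr {n k₀ : ℕ} {σ σ' : State n} (h : ∀ k, k ≠ k₀ → σ k = σ' k) (φ : Fm) :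
    ∀ d ρ, φ.wf k₀ d = true → (φ.eval σ d ρ ↔ φ.eval σ' d ρ) := by
  induction φ with
  | rel k x y => intro d ρ hw; simp [Fm.wf] at hw; simp [Fm.eval, h k hw.1.1.2]
  | eq x y => intros; rfl
  | lt x y => intros; rfl
  | neg φ ih => intro d ρ hw; simp [Fm.eval, ih d ρ hw]
  | and φ ψ ih₁ ih₂ =>
    intro d ρ hw; simp [Fm.wf] at hw; simp [Fm.eval, ih₁ d ρ hw.1, ih₂ d ρ hw.2]
  | ex φ ih =>
    intro d ρ hw; simp [Fm.wf] at hw; simp only [Fm.eval]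
    exact exists_congr fun i => ih _ _ hw.2

/-- Statements: simultaneous first-order update of one relation, composition, conditional, and
loops over the vertices in ascending and descending order. -/
inductive St : Type
  | skip
  | upd (k : ℕ) (φ : Fm)
  | seq (p q : St)
  | ite (φ : Fm) (p q : St)
  | up (p : St)
  | down (p : St)

/-- `iterUp F k` applies `F 0`, …, `F (k - 1)` in this order. -/
def iterUp {α : Type*} (F : ℕ → α → α) : ℕ → α → α
  | 0, a => a
  | k + 1, a => F k (iterUp F k a)

/-- `iterDown F k` applies `F (k - 1)`, …, `F 0` in this order. -/
def iterDown {α : Type*} (F : ℕ → α → α) : ℕ → α → α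
  | 0, a => a
  | k + 1, a => iterDown F k (F k a)

open Classical in
/-- The effect of a statement at binding level `d`. -/
noncomputable def St.exec {n : ℕ} : St → ℕ → (ℕ → Fin n) → State n → State n
  | .skip, _, _, σ => σ
  | .upd k φ, d, ρ, σ => Function.update σ k fun i j =>
      φ.eval σ (d + 2) (Function.update (Function.update ρ d i) (d + 1) j)
  | .seq p q, d, ρ, σ => q.exec d ρ (p.exec d ρ σ)
  | .ite φ p q, d, ρ, σ => if φ.eval σ d ρ then p.exec d ρ σ else q.exec d ρ σ
  | .up p, d, ρ, σ => iterUp (fun i σ =>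
      if h : i < n then p.exec (d + 1) (Function.update ρ d ⟨i, h⟩) σ else σ) n σ
  | .down p, d, ρ, σ => iterDown (fun i σ =>
      if h : i < n then p.exec (d + 1) (Function.update ρ d ⟨i, h⟩) σ else σ) n σ

/-- Well-formed statements: relation `0` is reserved for internal use. -/
def St.wf : St → ℕ → Bool
  | .skip, _ => true
  | .upd k φ, d => k < 32 && k != 0 && d < 14 && φ.wf 0 (d + 2)
  | .seq p q, d => p.wf d && q.wf d
  | .ite φ p q, d => φ.wf 0 d && p.wf d && q.wf d
  | .up p, d => d < 15 && p.wf (d + 1)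
  | .down p, d => d < 15 && p.wf (d + 1)

/-- The relations that a statement may change. -/
def St.writes (k : ℕ) : St → Bool
  | .skip => false
  | .upd k' _ => k == k'
  | .seq p q => p.writes k || q.writes k
  | .ite _ p q => p.writes k || q.writes k
  | .up p => p.writes k
  | .down p => p.writes k

theorem iterUp_induct {α : Type*} {F : ℕ → α → α} (I : ℕ → α → Prop) {N : ℕ} {a : α} (h0 : I 0 a)
    (hs : ∀ k < N, ∀ a, I k a → I (k + 1) (F k a)) : I N (iterUp F N a) := by
  induction N with
  | zero => exact h0
  | succ N ih => exact hs N (by omega) _ (ih fun k hk => hs k (by omega))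

theorem iterDown_induct {α : Type*} {F : ℕ → α → α} (I : ℕ → α → Prop) {N : ℕ} {a : α} (h0 : I N a)
    (hs : ∀ k < N, ∀ a, I (k + 1) a → I k (F k a)) : I 0 (iterDown F N a) := by
  induction N generalizing a with
  | zero => exact h0
  | succ N ih => exact ih (hs N (by omega) _ h0) fun k hk => hs k (by omega)

theorem St.exec_frame {n k : ℕ} (p : St) : ∀ (d : ℕ) (ρ : ℕ → Fin n) (σ : State n),
    p.writes k = false → p.exec d ρ σ k = σ k := by
  induction p with
  | skip => intros; rfl
  | upd k' φ =>
    intro d ρ σ h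
    simp [St.writes] at h
    simp [St.exec, Function.update_of_ne h]
  | seq p q ih₁ ih₂ =>
    intro d ρ σ h
    simp [St.writes] at h
    simp [St.exec, ih₁ _ _ _ h.1, ih₂ _ _ _ h.2]
  | ite φ p q ih₁ ih₂ =>
    intro d ρ σ h
    simp [St.writes] at h
    simp only [St.exec]
    split_ifs
    · exact ih₁ _ _ _ h.1
    · exact ih₂ _ _ _ h.2
  | up p ih =>
    intro d ρ σ h
    refine iterUp_induct (fun _ (σ' : State n) => σ' k = σ k) rfl fun i hi a ha => ?_
    simp only [hi, dite_true]
    rw [ih _ _ _ h, ha]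
  | down p ih =>
    intro d ρ σ h
    refine iterDown_induct (fun _ (σ' : State n) => σ' k = σ k) rfl fun i hi a ha => ?_
    simp only [hi, dite_true]
    rw [ih _ _ _ h, ha]

/-! ### Memory layout -/

/-- The address of the entry `(i, j)` of relation `k`. -/
def relAddr (n β k i j : ℕ) : ℕ := β + 16 + n + (k + 32 * (i * n + j))

theorem index_inj {n i j i' j' : ℕ} (hj : j < n) (hj' : j' < n) (h : i * n + j = i' * n + j') :
    i = i' ∧ j = j' := by
  have h1 : (i * n + j) / n = i := by
    rw [Nat.add_comm, Nat.add_mul_div_right _ _ (by omega), Nat.div_eq_of_lt hj, Nat.zero_add]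
  have h2 : (i' * n + j') / n = i' := by
    rw [Nat.add_comm, Nat.add_mul_div_right _ _ (by omega), Nat.div_eq_of_lt hj', Nat.zero_add]
  have : i = i' := by rw [← h1, ← h2, h]
  subst this
  exact ⟨rfl, by omega⟩

theorem relAddr_inj {n β k i j k' i' j' : ℕ} (hk : k < 32) (hk' : k' < 32) (hj : j < n)
    (hj' : j' < n) (h : relAddr n β k i j = relAddr n β k' i' j') : k = k' ∧ i = i' ∧ j = j' := by
  unfold relAddr at h
  have h1 : k = k' := by omega
  exact ⟨h1, index_inj hj hj' (by omega)⟩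

open Classical in
/-- The memory `m` represents the relations `τ` and the values `ρ` of the first `d` variables; below
the address `β` it agrees with `lo`. -/
structure Rep {n : ℕ} (β : ℕ) (lo : Mem) (τ : State n) (ρ : ℕ → Fin n) (d : ℕ) (m : Mem) :
    Prop where
  two : 2 ≤ β
  size : lo 0 = n
  base : lo 1 = β
  low : ∀ a < β, m a = lo a
  cell : ∀ v < d, m (β + 1 + v) = ρ v
  -- The machine cannot multiply, so matrix addresses are found with a table of the multiples of
  -- `n`. The 16 registers before it hold the last test result and 15 variables.
  mul : ∀ i < n, m (β + 16 + i) = i * n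
  rel : ∀ k < 32, ∀ i j : Fin n, m (relAddr n β k i j) = if τ k i j then 1 else 0

/-- The expression for the size. -/
def sizeE : Expr := .reg (.const 0)
/-- The expression for the base address. -/
def baseE : Expr := .reg (.const 1)
/-- The result of the last test. -/
def resE : Expr := .reg baseE
/-- The address of variable `v`. -/
def cellA (v : ℕ) : Expr := .add baseE (.const (1 + v))
/-- The value of variable `v`. -/
def cellE (v : ℕ) : Expr := .reg (cellA v)
/-- A constant multiple. -/
def timesE : ℕ → Expr → Expr
  | 0, _ => .const 0
  | k + 1, e => .add (timesE k e) e
/-- The address of the entry of relation `k` at the variables `x` and `y`. -/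
def relE (k x y : ℕ) : Expr :=
  .add (.add (.add baseE (.const 16)) sizeE) (.add (.const k)
    (timesE 32 (.add (.reg (.add (.add baseE (.const 16)) (cellE x))) (cellE y))))

theorem eval_timesE (m : Mem) (k : ℕ) (e : Expr) : (timesE k e).eval m = k * e.eval m := by
  induction k with
  | zero => simp [timesE, Expr.eval]
  | succ k ih => simp [timesE, Expr.eval, ih]; ring

section Rep

variable {n β : ℕ} {lo : Mem} {τ : State n} {ρ : ℕ → Fin n} {d : ℕ} {m : Mem}

theorem Rep.eval_sizeE (h : Rep β lo τ ρ d m) : sizeE.eval m = n := by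
  simp [sizeE, Expr.eval, h.low 0 (by have := h.two; omega), h.size]

theorem Rep.eval_baseE (h : Rep β lo τ ρ d m) : baseE.eval m = β := by
  simp [baseE, Expr.eval, h.low 1 (by have := h.two; omega), h.base]

theorem Rep.eval_resE (h : Rep β lo τ ρ d m) : resE.eval m = m β := by
  simp [resE, Expr.eval, h.eval_baseE]

theorem Rep.eval_cellA (h : Rep β lo τ ρ d m) (v : ℕ) : (cellA v).eval m = β + 1 + v := by
  simp [cellA, Expr.eval, h.eval_baseE]; omega

theorem Rep.eval_cellE' (h : Rep β lo τ ρ d m) (v : ℕ) :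
    (cellE v).eval m = m (β + 1 + v) := by
  simp [cellE, Expr.eval, h.eval_cellA]

theorem Rep.eval_cellE (h : Rep β lo τ ρ d m) {v : ℕ} (hv : v < d) : (cellE v).eval m = ρ v := by
  rw [h.eval_cellE', h.cell v hv]

theorem Rep.eval_relE (h : Rep β lo τ ρ d m) (k : ℕ) {x y : ℕ} (hx : x < d) (hy : y < d) :
    (relE k x y).eval m = relAddr n β k (ρ x) (ρ y) := by
  simp only [relE, Expr.eval, eval_timesE, h.eval_baseE, h.eval_sizeE, h.eval_cellE hx,
    h.eval_cellE hy, h.mul _ (ρ x).2, relAddr]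

theorem Rep.of_le (h : Rep β lo τ ρ d m) {d' : ℕ} (hd : d' ≤ d) : Rep β lo τ ρ d' m :=
  { h with cell := fun v hv => h.cell v (by omega) }

theorem Rep.congr_var (h : Rep β lo τ ρ d m) {ρ' : ℕ → Fin n} (hρ : ∀ v < d, ρ v = ρ' v) :
    Rep β lo τ ρ' d m :=
  { h with cell := fun v hv => by rw [h.cell v hv, hρ v hv] }

open Classical in
theorem Rep.congr_rel (h : Rep β lo τ ρ d m) {τ' : State n}
    (hτ : ∀ k < 32, ∀ i j, τ k i j ↔ τ' k i j) : Rep β lo τ' ρ d m :=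
  { h with rel := fun k hk i j => by rw [h.rel k hk i j]; exact if_congr (hτ k hk i j) rfl rfl }

/-- The result register and the cells of unbound variables are scratch space. -/
theorem Rep.update_free (h : Rep β lo τ ρ d m) {v : ℕ} (hv : v = 0 ∨ d < v) (hv' : v < 16)
    (x : ℕ) : Rep β lo τ ρ d (Function.update m (β + v) x) where
  two := h.two
  size := h.size
  base := h.base
  low a ha := by rw [Function.update_of_ne (by omega), h.low a ha]
  cell u hu := by rw [Function.update_of_ne (by omega), h.cell u hu]
  mul i hi := by rw [Function.update_of_ne (by omega), h.mul i hi]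
  rel k hk i j := by
    rw [Function.update_of_ne (by unfold relAddr; omega), h.rel k hk i j]

theorem Rep.update_res (h : Rep β lo τ ρ d m) (x : ℕ) :
    Rep β lo τ ρ d (Function.update m β x) := h.update_free (v := 0) (.inl rfl) (by omega) x

theorem Rep.update_cell (h : Rep β lo τ ρ d m) (hd : d < 15) (x : ℕ) :
    Rep β lo τ ρ d (Function.update m (β + 1 + d) x) := by
  rw [add_assoc]
  exact h.update_free (v := 1 + d) (.inr (by omega)) (by omega) x

/-- When the first free cell holds a vertex, it can be taken for a variable. -/
theorem Rep.push (h : Rep β lo τ ρ d m) (i : Fin n) (hi : m (β + 1 + d) = i) :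
    Rep β lo τ (Function.update ρ d i) (d + 1) m :=
  { h with
    cell := fun v hv => by
      rcases Nat.lt_succ_iff_lt_or_eq.1 hv with hv | rfl
      · rw [h.cell v hv, Function.update_of_ne (by omega)]
      · rw [hi, Function.update_self] }

theorem Rep.pop {i : Fin n} (h : Rep β lo τ (Function.update ρ d i) (d + 1) m) :
    Rep β lo τ ρ d m ∧ m (β + 1 + d) = i := by
  refine ⟨(h.of_le (Nat.le_succ d)).congr_var fun v hv => Function.update_of_ne (by omega) _ _, ?_⟩
  rw [h.cell d (by omega), Function.update_self]

open Classical in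
theorem Rep.update_rel (h : Rep β lo τ ρ d m) (hd : d < 16) {k : ℕ} (hk : k < 32) (i j : Fin n)
    (P : Prop) :
    Rep β lo (Function.update τ k fun i' j' => if i' = i ∧ j' = j then P else τ k i' j') ρ d
      (Function.update m (relAddr n β k i j) (if P then 1 else 0)) where
  two := h.two
  size := h.size
  base := h.base
  low a ha := by rw [Function.update_of_ne (by unfold relAddr; omega), h.low a ha]
  cell u hu := by rw [Function.update_of_ne (by unfold relAddr; omega), h.cell u hu]
  mul a ha := by rw [Function.update_of_ne (by unfold relAddr; omega), h.mul a ha]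
  rel k' hk' i' j' := by
    by_cases hA : relAddr n β k' i' j' = relAddr n β k i j
    · obtain ⟨rfl, hi, hj⟩ := relAddr_inj hk' hk j'.2 j.2 hA
      obtain rfl := Fin.ext hi
      obtain rfl := Fin.ext hj
      simp
    · rw [Function.update_of_ne hA, h.rel k' hk']
      by_cases hkk : k' = k
      · subst hkk
        have : ¬ (i' = i ∧ j' = j) := by rintro ⟨rfl, rfl⟩; exact hA rfl
        simp [this]
      · rw [Function.update_of_ne hkk]

end Rep

end KernelDE

namespace KernelDE

/-! ### Compilation -/

/-- Evaluation of a formula; the truth value is stored at the base address. -/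
def Fm.comp : Fm → ℕ → Prog
  | .rel k x y, _ => .store baseE (.reg (relE k x y))
  | .eq x y, _ => .store baseE
      (.sub (.const 1) (.add (.sub (cellE x) (cellE y)) (.sub (cellE y) (cellE x))))
  | .lt x y, _ => .store baseE
      (.sub (.const 1) (.sub (.const 1) (.sub (cellE y) (cellE x))))
  | .neg φ, d => .seq (φ.comp d) (.store baseE (.sub (.const 1) resE))
  | .and φ ψ, d => .seq (φ.comp d) (.ite resE (ψ.comp d) .skip)
  -- The cell of the bound variable is also the counter of a descending search; a witness resets it
  -- to `0`, which ends the loop and leaves the result `1` in place.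
  | .ex φ, d => .seq (.store (cellA d) sizeE) (.seq (.store baseE (.const 0))
      (.loop (cellE d) (.seq (.store (cellA d) (.sub (cellE d) (.const 1)))
        (.seq (φ.comp (d + 1)) (.ite resE (.store (cellA d) (.const 0)) .skip)))))

open Classical in
/-- The program `p` decides the property `P` of the relations and the first `d` variables. -/
def Decides (p : Prog) (d : ℕ) (f : ℕ → ℕ)
    (P : ∀ {n : ℕ}, State n → (ℕ → Fin n) → Prop) : Prop :=
  ∀ {n β : ℕ} {lo : Mem} {τ : State n} {ρ : ℕ → Fin n} {m : Mem}, Rep β lo τ ρ d m →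
    Does p m (f n) fun m' => Rep β lo τ ρ d m' ∧ m' β = if P τ ρ then 1 else 0

theorem decides_store {e : Expr} {d : ℕ} {P : ∀ {n : ℕ}, State n → (ℕ → Fin n) → Prop}
    (h : ∀ {n β : ℕ} {lo : Mem} {τ : State n} {ρ : ℕ → Fin n} {m : Mem}, Rep β lo τ ρ d m →
      (P τ ρ → e.eval m = 1) ∧ (¬ P τ ρ → e.eval m = 0)) :
    ∃ f : Polynomial ℕ, Decides (.store baseE e) d (fun n => f.eval n) P := by
  refine ⟨Polynomial.C (baseE.cost + e.cost + 1), fun {n β lo τ ρ m} hr => ?_⟩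
  refine (Does.store (Q := _) ?_).mono (by simp) fun _ h => h
  rw [hr.eval_baseE]
  refine ⟨hr.update_res _, ?_⟩
  rw [Function.update_self]
  split_ifs with hP
  · exact (h hr).1 hP
  · exact (h hr).2 hP

theorem decides_ex {p : Prog} {d : ℕ} (hd : d < 15) {f : Polynomial ℕ}
    {P : ∀ {n : ℕ}, State n → (ℕ → Fin n) → Prop}
    (hp : Decides p (d + 1) (fun n => f.eval n) P) :
    ∃ f : Polynomial ℕ, Decides (.seq (.store (cellA d) sizeE) (.seq (.store baseE (.const 0))
      (.loop (cellE d) (.seq (.store (cellA d) (.sub (cellE d) (.const 1)))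
        (.seq p (.ite resE (.store (cellA d) (.const 0)) .skip)))))) d (fun n => f.eval n)
      fun τ ρ => ∃ i, P τ (Function.update ρ d i) := by
  -- Either all values from the counter upwards have been refuted, or a witness was found and the
  -- counter is `0`.
  let I : ∀ {n : ℕ} (_ : ℕ) (_ : Mem) (_ : State n) (_ : ℕ → Fin n) (_ : Mem), Prop :=
    fun {n} β lo τ ρ m => Rep β lo τ ρ d m ∧
      ((m β = 0 ∧ m (β + 1 + d) ≤ n ∧
          ∀ i : Fin n, m (β + 1 + d) ≤ i → ¬ P τ (Function.update ρ d i)) ∨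
        (m β = 1 ∧ m (β + 1 + d) = 0 ∧ ∃ i, P τ (Function.update ρ d i)))
  let c : ℕ := (cellA d).cost + (Expr.sub (cellE d) (.const 1)).cost + resE.cost +
    (Expr.const 0).cost + (cellA d).cost + 10
  have body : ∀ {n β : ℕ} {lo : Mem} {τ : State n} {ρ : ℕ → Fin n} (m : Mem), I β lo τ ρ m →
      (cellE d).eval m ≠ 0 →
      Does (.seq (.store (cellA d) (.sub (cellE d) (.const 1)))
        (.seq p (.ite resE (.store (cellA d) (.const 0)) .skip))) m (f.eval n + c)
        fun m' => I β lo τ ρ m' ∧ (cellE d).eval m' < (cellE d).eval m := by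
    intro n β lo τ ρ m ⟨hr, hI⟩ h0
    rw [hr.eval_cellE'] at h0
    rcases hI with ⟨h1, h2, h3⟩ | ⟨h1, h2, h3⟩
    swap
    · exact absurd h2 h0
    have hlt : m (β + 1 + d) - 1 < n := by omega
    refine (Does.seq (Does.store (Q := _) ?_)).mono
      (T := _ + (f.eval n + (resE.cost + (((cellA d).cost + (Expr.const 0).cost + 1) + 1) + 1)
        + 1) + 1) ?_ fun _ h => h
    rotate_left
    · simp only [c]; omega
    have e1 : (Expr.sub (cellE d) (.const 1)).eval m = m (β + 1 + d) - 1 := by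
      simp [Expr.eval, hr.eval_cellE']
    rw [hr.eval_cellA, e1, hr.eval_cellE']
    set m₁ := Function.update m (β + 1 + d) (m (β + 1 + d) - 1)
    have hr₁ : Rep β lo τ (Function.update ρ d ⟨_, hlt⟩) (d + 1) m₁ :=
      (hr.update_cell hd _).push _ (by simp)
    refine Does.seq ((hp hr₁).mono le_rfl ?_)
    rintro m₂ ⟨hr₂, hres⟩
    obtain ⟨hr₃, hc⟩ := hr₂.pop
    refine Does.ite (fun hne => ?_) (fun heq => ?_)
    · rw [hr₃.eval_resE, hres] at hne
      have hP : P τ (Function.update ρ d ⟨m (β + 1 + d) - 1, hlt⟩) := by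
        by_contra hP; simp [hP] at hne
      refine Does.store ?_
      rw [hr₃.eval_cellA]
      have hr₄ := hr₃.update_cell hd ((Expr.const 0).eval m₂)
      refine ⟨⟨hr₄, .inr ⟨?_, ?_, ⟨_, hP⟩⟩⟩, ?_⟩
      · rw [Function.update_of_ne (by omega), hres]; simp [hP]
      · simp [Expr.eval]
      · rw [hr₄.eval_cellE']; simp [Expr.eval]; omega
    · rw [hr₃.eval_resE, hres] at heq
      have hP : ¬ P τ (Function.update ρ d ⟨m (β + 1 + d) - 1, hlt⟩) := by
        intro hP; simp [hP] at heq
      refine Does.skip ⟨⟨hr₃, .inl ⟨by simpa [hP] using hres, by rw [hc]; simp; omega, ?_⟩⟩, ?_⟩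
      · intro i hi
        rw [hc] at hi
        by_cases hi' : m (β + 1 + d) ≤ i
        · exact h3 i hi'
        · have : i = ⟨m (β + 1 + d) - 1, hlt⟩ := Fin.ext (by simp at hi ⊢; omega)
          rwa [this]
      · rw [hr₃.eval_cellE', hc]; simp; omega
  refine ⟨Polynomial.X * (f + Polynomial.C (c + (cellE d).cost + 1)) +
    Polynomial.C ((cellA d).cost + sizeE.cost + baseE.cost + (cellE d).cost + 10),
    fun {n β lo τ ρ m} hr => ?_⟩
  refine (Does.seq (T₂ := (baseE.cost + (Expr.const 0).cost + 1) +
    (n * ((cellE d).cost + (f.eval n + c) + 1) + (cellE d).cost + 1) + 1)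
    (Does.store (Q := _) ?_)).mono ?_ fun _ h => h
  rotate_left
  · simp [Expr.cost]
    nlinarith
  rw [hr.eval_cellA, hr.eval_sizeE]
  have hr₁ := hr.update_cell hd n
  refine Does.seq (Does.store ?_)
  rw [hr₁.eval_baseE]
  have hr₂ := hr₁.update_res ((Expr.const 0).eval (Function.update m (β + 1 + d) n))
  refine (Does.loop (I β lo τ ρ) body ⟨hr₂, .inl ⟨?_, ?_, ?_⟩⟩ ?_).mono le_rfl ?_
  · simp [Expr.eval]
  · rw [Function.update_of_ne (by omega)]; simp
  · intro i hi
    rw [Function.update_of_ne (by omega), Function.update_self] at hi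
    omega
  · rw [hr₂.eval_cellE', Function.update_of_ne (by omega), Function.update_self]
  · rintro m' ⟨⟨hr', hI⟩, h0⟩
    rw [hr'.eval_cellE'] at h0
    refine ⟨hr', ?_⟩
    rcases hI with ⟨h1, h2, h3⟩ | ⟨h1, h2, h3⟩
    · rw [h1, if_neg]
      rintro ⟨i, hi⟩
      exact h3 i (by omega) hi
    · rw [h1, if_pos h3]

theorem Fm.comp_decides {k₀ : ℕ} (φ : Fm) : ∀ d, φ.wf k₀ d = true → ∃ f : Polynomial ℕ,
    Decides (φ.comp d) d (fun n => f.eval n) fun τ ρ => φ.eval τ d ρ := by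
  induction φ with
  | rel k x y =>
    intro d hw
    simp [Fm.wf] at hw
    refine decides_store fun {n β lo τ ρ m} hr => ?_
    simp only [Expr.eval, hr.eval_relE k hw.1.2 hw.2, hr.rel k hw.1.1.1, Fm.eval]
    constructor <;> intro h <;> simp [h]
  | eq x y =>
    intro d hw
    simp [Fm.wf] at hw
    refine decides_store fun {n β lo τ ρ m} hr => ?_
    simp only [Expr.eval, hr.eval_cellE hw.1, hr.eval_cellE hw.2, Fm.eval, Fin.ext_iff]
    constructor <;> intro h <;> omega
  | lt x y =>
    intro d hw
    simp [Fm.wf] at hw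
    refine decides_store fun {n β lo τ ρ m} hr => ?_
    simp only [Expr.eval, hr.eval_cellE hw.1, hr.eval_cellE hw.2, Fm.eval, Fin.lt_def]
    constructor <;> intro h <;> omega
  | neg φ ih =>
    intro d hw
    obtain ⟨f, hf⟩ := ih d hw
    refine ⟨f + Polynomial.C (baseE.cost + (Expr.sub (.const 1) resE).cost + 2),
      fun {n β lo τ ρ m} hr => ?_⟩
    refine (Does.seq ((hf hr).mono le_rfl ?_)).mono
      (T := _ + (baseE.cost + (Expr.sub (.const 1) resE).cost + 1) + 1)
      (by simp) fun _ h => h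
    rintro m' ⟨hr', hres⟩
    refine Does.store ?_
    rw [hr'.eval_baseE]
    refine ⟨hr'.update_res _, ?_⟩
    simp only [Expr.eval, hr'.eval_resE, hres, Fm.eval, Function.update_self]
    split_ifs <;> simp_all
  | and φ ψ ih₁ ih₂ =>
    intro d hw
    simp [Fm.wf] at hw
    obtain ⟨f, hf⟩ := ih₁ d hw.1
    obtain ⟨g, hg⟩ := ih₂ d hw.2
    refine ⟨f + g + Polynomial.C (resE.cost + 10), fun {n β lo τ ρ m} hr => ?_⟩
    refine (Does.seq ((hf hr).mono le_rfl ?_)).mono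
      (T := _ + (resE.cost + (g.eval n + 1) + 1) + 1) (by simp; omega) fun _ h => h
    rintro m' ⟨hr', hres⟩
    refine Does.ite (fun hne => ?_) (fun heq => ?_)
    · refine (hg hr').mono le_rfl ?_
      rintro m'' ⟨hr'', hres'⟩
      rw [hr'.eval_resE, hres] at hne
      have : φ.eval τ d ρ := by by_contra h; simp [h] at hne
      exact ⟨hr'', by
        rw [hres']; by_cases h : ψ.eval τ d ρ <;> simp [Fm.eval, this, h]⟩
    · rw [hr'.eval_resE] at heq
      refine Does.skip ⟨hr', ?_⟩
      have : ¬ φ.eval τ d ρ := by intro h; rw [hres] at heq; simp [h] at heq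
      rw [heq]; simp [Fm.eval, this]
  | ex φ ih =>
    intro d hw
    simp [Fm.wf] at hw
    obtain ⟨f, hf⟩ := ih (d + 1) hw.2
    exact decides_ex hw.1 hf

end KernelDE

namespace KernelDE

open Classical in
theorem Decides.apply {p : Prog} {d : ℕ} {f : ℕ → ℕ}
    {P : ∀ {n : ℕ}, State n → (ℕ → Fin n) → Prop} (h : Decides p d f P) {n β : ℕ} {lo : Mem}
    {τ : State n} {ρ : ℕ → Fin n} {m : Mem} (hr : Rep β lo τ ρ d m) {Q : Prop}
    (hQ : P τ ρ ↔ Q) :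
    Does p m (f n) fun m' => Rep β lo τ ρ d m' ∧ m' β = if Q then 1 else 0 := by
  refine (h hr).mono le_rfl ?_
  rintro m' ⟨h₁, h₂⟩
  exact ⟨h₁, h₂.trans (if_congr hQ rfl rfl)⟩

/-- The loop over all values of variable `d` in descending order. -/
def loopDown (d : ℕ) (p : Prog) : Prog :=
  .seq (.store (cellA d) sizeE)
    (.loop (cellE d) (.seq (.store (cellA d) (.sub (cellE d) (.const 1))) p))

/-- The loop over all values of variable `d` in ascending order. -/
def loopUp (d : ℕ) (p : Prog) : Prog :=
  .seq (.store (cellA d) (.const 0))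
    (.loop (.sub sizeE (cellE d)) (.seq p (.store (cellA d) (.add (cellE d) (.const 1)))))

/-- A bound for the overhead of a loop. -/
def loopCost (d : ℕ) : ℕ :=
  2 * (cellA d).cost + 2 * (cellE d).cost + 2 * sizeE.cost + 10

section Loops

variable {n β : ℕ} {lo : Mem} {τ : State n} {ρ : ℕ → Fin n} {d : ℕ} {m : Mem}

theorem does_loopDown {p : Prog} {T : ℕ} (hd : d < 15) (Inv : ℕ → State n → Prop)
    (hp : ∀ i (hi : i < n) τ m, Inv (i + 1) τ → Rep β lo τ (Function.update ρ d ⟨i, hi⟩) (d + 1) m →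
      Does p m T fun m' => ∃ τ', Inv i τ' ∧ Rep β lo τ' (Function.update ρ d ⟨i, hi⟩) (d + 1) m')
    (h : Rep β lo τ ρ d m) (h0 : Inv n τ) :
    Does (loopDown d p) m (n * (T + loopCost d) + loopCost d)
      fun m' => ∃ τ', Inv 0 τ' ∧ Rep β lo τ' ρ d m' := by
  let I : Mem → Prop := fun m => m (β + 1 + d) ≤ n ∧ ∃ τ, Inv (m (β + 1 + d)) τ ∧ Rep β lo τ ρ d m
  have body : ∀ m, I m → (cellE d).eval m ≠ 0 →
      Does (.seq (.store (cellA d) (.sub (cellE d) (.const 1))) p) m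
        ((cellA d).cost + (Expr.sub (cellE d) (.const 1)).cost + 1 + T + 1)
        fun m' => I m' ∧ (cellE d).eval m' < (cellE d).eval m := by
    rintro m ⟨hn, τ, hI, hr⟩ h0
    rw [hr.eval_cellE'] at h0
    have hlt : m (β + 1 + d) - 1 < n := by omega
    refine Does.seq (Does.store ?_)
    have e1 : (Expr.sub (cellE d) (.const 1)).eval m = m (β + 1 + d) - 1 := by
      simp [Expr.eval, hr.eval_cellE']
    rw [hr.eval_cellA, e1, hr.eval_cellE']
    have hr₁ := (hr.update_cell hd (m (β + 1 + d) - 1)).push ⟨_, hlt⟩ (by simp)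
    refine (hp _ hlt τ _ (by rwa [Nat.sub_add_cancel (by omega)]) hr₁).mono le_rfl ?_
    rintro m' ⟨τ', hI', hr'⟩
    obtain ⟨hr₂, hc⟩ := hr'.pop
    refine ⟨⟨by rw [hc]; simp; omega, τ', by rwa [hc], hr₂⟩, ?_⟩
    rw [hr₂.eval_cellE', hc]
    simp; omega
  refine (Does.seq (T₂ := n * ((cellE d).cost + ((cellA d).cost +
    (Expr.sub (cellE d) (.const 1)).cost + 1 + T + 1) + 1) + (cellE d).cost + 1)
    (Does.store (Q := _) ?_)).mono ?_ fun _ h => h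
  rotate_left
  · simp only [loopCost, Expr.cost]
    nlinarith
  rw [h.eval_cellA, h.eval_sizeE]
  have hr₁ := h.update_cell hd n
  refine (Does.loop I body (N := n) ⟨by simp, τ, by simpa using h0, hr₁⟩ ?_).mono le_rfl ?_
  · rw [hr₁.eval_cellE', Function.update_self]
  · rintro m' ⟨⟨_, τ', hI', hr'⟩, hz⟩
    rw [hr'.eval_cellE'] at hz
    exact ⟨τ', by rwa [hz] at hI', hr'⟩

theorem does_loopUp {p : Prog} {T : ℕ} (hd : d < 15) (Inv : ℕ → State n → Prop)
    (hp : ∀ i (hi : i < n) τ m, Inv i τ → Rep β lo τ (Function.update ρ d ⟨i, hi⟩) (d + 1) m →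
      Does p m T fun m' => ∃ τ', Inv (i + 1) τ' ∧
        Rep β lo τ' (Function.update ρ d ⟨i, hi⟩) (d + 1) m')
    (h : Rep β lo τ ρ d m) (h0 : Inv 0 τ) :
    Does (loopUp d p) m (n * (T + loopCost d) + loopCost d)
      fun m' => ∃ τ', Inv n τ' ∧ Rep β lo τ' ρ d m' := by
  let I : Mem → Prop := fun m => m (β + 1 + d) ≤ n ∧ ∃ τ, Inv (m (β + 1 + d)) τ ∧ Rep β lo τ ρ d m
  have body : ∀ m, I m → (Expr.sub sizeE (cellE d)).eval m ≠ 0 →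
      Does (.seq p (.store (cellA d) (.add (cellE d) (.const 1)))) m
        (T + ((cellA d).cost + (Expr.add (cellE d) (.const 1)).cost + 1) + 1)
        fun m' => I m' ∧ (Expr.sub sizeE (cellE d)).eval m' <
          (Expr.sub sizeE (cellE d)).eval m := by
    rintro m ⟨hn, τ, hI, hr⟩ h0
    simp only [Expr.eval, hr.eval_cellE', hr.eval_sizeE] at h0 ⊢
    have hlt : m (β + 1 + d) < n := by omega
    refine Does.seq ((hp _ hlt τ m hI (hr.push _ rfl)).mono le_rfl ?_)
    rintro m' ⟨τ', hI', hr'⟩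
    obtain ⟨hr₂, hc⟩ := hr'.pop
    refine Does.store ?_
    have e1 : (Expr.add (cellE d) (.const 1)).eval m' = m (β + 1 + d) + 1 := by
      simp [Expr.eval, hr₂.eval_cellE', hc]
    rw [hr₂.eval_cellA, e1]
    have hr₃ := hr₂.update_cell hd (m (β + 1 + d) + 1)
    refine ⟨⟨by simp; omega, τ', by simpa using hI', hr₃⟩, ?_⟩
    rw [hr₃.eval_cellE', hr₃.eval_sizeE]
    simp; omega
  refine (Does.seq (T₂ := n * ((Expr.sub sizeE (cellE d)).cost + (T + ((cellA d).cost +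
    (Expr.add (cellE d) (.const 1)).cost + 1) + 1) + 1) + (Expr.sub sizeE (cellE d)).cost + 1)
    (Does.store (Q := _) ?_)).mono ?_ fun _ h => h
  rotate_left
  · simp only [loopCost, Expr.cost]
    nlinarith
  rw [h.eval_cellA, show (Expr.const 0).eval m = 0 from rfl]
  have hr₁ := h.update_cell hd 0
  refine (Does.loop I body (N := n) ⟨by simp, τ, by simpa using h0, hr₁⟩ ?_).mono le_rfl ?_
  · change sizeE.eval _ - _ ≤ n
    rw [hr₁.eval_sizeE]
    exact Nat.sub_le _ _
  · rintro m' ⟨⟨hle, τ', hI', hr'⟩, hz⟩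
    simp only [Expr.eval, hr'.eval_cellE', hr'.eval_sizeE] at hz
    have : m' (β + 1 + d) = n := by omega
    exact ⟨τ', by rwa [this] at hI', hr'⟩

/-- The program that fills relation `k` with the results of the tests `p`. -/
def fill (k d : ℕ) (p : Prog) : Prog :=
  loopDown d (loopDown (d + 1) (.seq p (.store (relE k d (d + 1)) resE)))

/-- A bound for the time of `fill`. -/
def fillCost (k d T n : ℕ) : ℕ :=
  n * (n * (T + ((relE k d (d + 1)).cost + resE.cost + 2) + loopCost (d + 1)) +
    loopCost (d + 1) + loopCost d) + loopCost d

open Classical in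
-- While the matrix is being filled, relation `k` is partly overwritten. This is why the test must
-- give the same answer in every state that differs from `τ` in relation `k` only.
theorem does_fill {k : ℕ} {p : Prog} {T : ℕ} (hd : d < 14) (hk : k < 32)
    (P : Fin n → Fin n → Prop)
    (hp : ∀ τ' i j m, (∀ k', k' ≠ k → τ' k' = τ k') →
      Rep β lo τ' (Function.update (Function.update ρ d i) (d + 1) j) (d + 2) m →
      Does p m T fun m' => Rep β lo τ' (Function.update (Function.update ρ d i) (d + 1) j)
        (d + 2) m' ∧ m' β = if P i j then 1 else 0)
    (h : Rep β lo τ ρ d m) :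
    Does (fill k d p) m (fillCost k d T n)
      fun m' => Rep β lo (Function.update τ k P) ρ d m' := by
  refine (does_loopDown (by omega) (fun c τ' => τ' = Function.update τ k fun i j =>
    if c ≤ (i : ℕ) then P i j else τ k i j) (fun i hi τ' m' hτ' hr => ?_) h ?_).mono
      (le_of_eq rfl) ?_
  · refine (does_loopDown (by omega) (fun c τ' => τ' = Function.update τ k fun i' j' =>
      if i < (i' : ℕ) ∨ (i' : ℕ) = i ∧ c ≤ (j' : ℕ) then P i' j' else τ k i' j')
      (T := T + ((relE k d (d + 1)).cost + resE.cost + 1) + 1)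
      (fun j hj τ' m' hτ' hr => ?_) hr ?_).mono (le_of_eq rfl) ?_
    · refine Does.seq ((hp τ' ⟨i, hi⟩ ⟨j, hj⟩ m' (fun k' hk' => ?_) hr).mono le_rfl ?_)
      · rw [hτ', Function.update_of_ne hk']
      · rintro m'' ⟨hr', hres⟩
        refine Does.store ?_
        have hx : Function.update (Function.update ρ d ⟨i, hi⟩) (d + 1) ⟨j, hj⟩ d = ⟨i, hi⟩ := by
          rw [Function.update_of_ne (by omega), Function.update_self]
        have hy : Function.update (Function.update ρ d ⟨i, hi⟩) (d + 1) (⟨j, hj⟩ : Fin n) (d + 1) =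
          ⟨j, hj⟩ := Function.update_self ..
        rw [hr'.eval_relE k (by omega) (by omega), hr'.eval_resE, hres, hx, hy]
        refine ⟨_, ?_, hr'.update_rel (by omega) hk _ _ _⟩
        rw [hτ', Function.update_idem]
        congr 1
        funext i' j'
        simp only [Function.update_self, eq_iff_iff, Fin.ext_iff]
        by_cases h1 : (i' : ℕ) = i
        · by_cases h2 : (j' : ℕ) = j
          · have e1 : i' = ⟨i, hi⟩ := Fin.ext h1
            have e2 : j' = ⟨j, hj⟩ := Fin.ext h2
            subst e1 e2
            simp
          · have : j + 1 ≤ (j' : ℕ) ↔ j ≤ (j' : ℕ) := by omega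
            simp only [h1, h2, this, and_false, if_false]
        · simp only [h1, false_and, if_false]
    · rw [hτ']
      congr 1
      funext i' j'
      have : i + 1 ≤ (i' : ℕ) ↔ i < (i' : ℕ) ∨ (i' : ℕ) = i ∧ n ≤ (j' : ℕ) := by omega
      simp only [this]
    · rintro m'' ⟨τ'', hτ'', hr''⟩
      refine ⟨τ'', ?_, hr''⟩
      rw [hτ'']
      congr 1
      funext i' j'
      have : i ≤ (i' : ℕ) ↔ i < (i' : ℕ) ∨ (i' : ℕ) = i ∧ 0 ≤ (j' : ℕ) := by omega
      simp only [this]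
  · have : (fun (i j : Fin n) => if n ≤ (i : ℕ) then P i j else τ k i j) = τ k := by
      funext i j
      rw [if_neg (by omega)]
    rw [this, Function.update_eq_self]
  · rintro m' ⟨τ', hτ', hr⟩
    simpa [hτ'] using hr

end Loops

/-- Compilation of statements. -/
def St.comp : St → ℕ → Prog
  | .skip, _ => .skip
  -- The update is simultaneous and `φ` may mention `k`, so the new values are collected in the
  -- scratch relation and copied afterwards.
  | .upd k φ, d => .seq (fill 0 d (φ.comp (d + 2)))
      (fill k d (.store baseE (.reg (relE 0 d (d + 1)))))
  | .seq p q, d => .seq (p.comp d) (q.comp d)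
  | .ite φ p q, d => .seq (φ.comp d) (.ite resE (p.comp d) (q.comp d))
  | .up p, d => loopUp d (p.comp (d + 1))
  | .down p, d => loopDown d (p.comp (d + 1))

theorem exists_fillCost (k d : ℕ) (f : Polynomial ℕ) :
    ∃ g : Polynomial ℕ, ∀ n, fillCost k d (f.eval n) n = g.eval n := by
  refine ⟨Polynomial.X * (Polynomial.X * (f + Polynomial.C ((relE k d (d + 1)).cost + resE.cost + 2
    + loopCost (d + 1))) + Polynomial.C (loopCost (d + 1) + loopCost d)) +
    Polynomial.C (loopCost d), fun n => ?_⟩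
  simp only [fillCost, Polynomial.eval_add, Polynomial.eval_mul, Polynomial.eval_X,
    Polynomial.eval_C]
  ring

theorem agree_update {n : ℕ} {τ σ : State n} (h : ∀ k, k ≠ 0 → τ k = σ k) (k₀ : ℕ)
    (P : Fin n → Fin n → Prop) :
    ∀ k, k ≠ 0 → Function.update τ k₀ P k = Function.update σ k₀ P k := by
  intro k hk
  by_cases hkk : k = k₀
  · subst hkk; simp
  · simp [Function.update_of_ne hkk, h k hk]

/-- The semantics `St.exec` ignores the scratch relation, so memory follows it only up to relation
`0`. Polynomials compose because each loop multiplies the bound of its body by `n` and adds an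
overhead linear in `n`. -/
theorem St.comp_correct (p : St) : ∀ d, p.wf d = true → ∃ f : Polynomial ℕ,
    ∀ {n β : ℕ} {lo : Mem} {τ σ : State n} {ρ : ℕ → Fin n} {m : Mem},
      (∀ k, k ≠ 0 → τ k = σ k) → Rep β lo τ ρ d m →
      Does (p.comp d) m (f.eval n) fun m' =>
        ∃ τ' : State n, (∀ k, k ≠ 0 → τ' k = p.exec d ρ σ k) ∧ Rep β lo τ' ρ d m' := by
  induction p with
  | skip => exact fun d _ => ⟨1, fun {n β lo τ σ ρ m} hσ hr => by
    simpa using! Does.skip ⟨τ, hσ, hr⟩⟩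
  | upd k φ =>
    intro d hw
    simp [St.wf] at hw
    obtain ⟨⟨⟨hk, hk0⟩, hd⟩, hφ⟩ := hw
    obtain ⟨f, hf⟩ := φ.comp_decides (d + 2) hφ
    obtain ⟨g, hg⟩ : ∃ g : Polynomial ℕ, Decides (.store baseE (.reg (relE 0 d (d + 1)))) (d + 2)
        (fun n => g.eval n) fun τ ρ => τ 0 (ρ d) (ρ (d + 1)) := by
      refine decides_store fun {n β lo τ ρ m} hr => ?_
      simp only [Expr.eval, hr.eval_relE 0 (Nat.lt_add_of_pos_right (by omega))
        (Nat.lt_succ_self (d + 1)), hr.rel 0 (by omega)]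
      constructor <;> intro h <;> simp [h]
    obtain ⟨f', hf'⟩ := exists_fillCost 0 d f
    obtain ⟨g', hg'⟩ := exists_fillCost k d g
    refine ⟨f' + g' + 1, fun {n β lo τ σ ρ m} hσ hr => ?_⟩
    refine (Does.seq (T₂ := g'.eval n) ((does_fill (by omega) (by omega) (fun i j => φ.eval σ (d + 2)
      (Function.update (Function.update ρ d i) (d + 1) j)) (T := f.eval n)
      (fun τ' i j m' hτ' hr' => ?_) hr).mono (hf' n).le fun m' hr' => ?_)).mono (by simp) fun _ h => h
    · exact hf.apply hr' (φ.eval_congr (fun k hk => (hτ' k hk).trans (hσ k hk)) _ _ hφ)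
    · refine (does_fill hd hk (fun i j => φ.eval σ (d + 2)
        (Function.update (Function.update ρ d i) (d + 1) j)) (T := g.eval n)
        (fun τ' i j m' hτ' hr' => ?_) hr').mono (hg' n).le fun m'' hr'' => ?_
      · refine hg.apply hr' ?_
        rw [hτ' 0 (Ne.symm hk0), Function.update_self, Function.update_self,
          Function.update_of_ne (show d ≠ d + 1 by omega), Function.update_self]
      · refine ⟨_, ?_, hr''⟩
        intro k' hk'
        simp only [St.exec]
        refine agree_update (fun k hk => ?_) k _ k' hk'
        rw [Function.update_of_ne hk, hσ k hk]
  | seq p q ih₁ ih₂ =>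
    intro d hw
    simp [St.wf] at hw
    obtain ⟨f, hf⟩ := ih₁ d hw.1
    obtain ⟨g, hg⟩ := ih₂ d hw.2
    refine ⟨f + g + 1, fun {n β lo τ σ ρ m} hσ hr => ?_⟩
    refine (Does.seq (T₂ := g.eval n) ((hf hσ hr).mono le_rfl ?_)).mono (by simp) fun _ h => h
    rintro m' ⟨τ', hτ', hr'⟩
    exact hg hτ' hr'
  | ite φ p q ih₁ ih₂ =>
    intro d hw
    simp [St.wf] at hw
    obtain ⟨⟨hφ, hw₁⟩, hw₂⟩ := hw
    obtain ⟨e, he⟩ := φ.comp_decides d hφ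
    obtain ⟨f, hf⟩ := ih₁ d hw₁
    obtain ⟨g, hg⟩ := ih₂ d hw₂
    refine ⟨e + f + g + Polynomial.C (resE.cost + 2), fun {n β lo τ σ ρ m} hσ hr => ?_⟩
    refine (Does.seq (T₂ := resE.cost + (f.eval n + g.eval n) + 1)
      ((he.apply hr (φ.eval_congr hσ _ ρ hφ)).mono le_rfl ?_)).mono (by simp; omega) fun _ h => h
    rintro m' ⟨hr', hres⟩
    simp only [St.exec]
    refine Does.ite (fun h => ?_) fun h => ?_
    · rw [hr'.eval_resE, hres] at h
      have hφ' : φ.eval σ d ρ := by by_contra hn; simp [hn] at h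
      simp only [if_pos hφ']
      exact hf hσ hr'
    · rw [hr'.eval_resE, hres] at h
      have hφ' : ¬ φ.eval σ d ρ := by intro hn; simp [hn] at h
      simp only [if_neg hφ']
      exact hg hσ hr'
  | up p ih =>
    intro d hw
    simp [St.wf] at hw
    obtain ⟨f, hf⟩ := ih (d + 1) hw.2
    refine ⟨Polynomial.X * (f + Polynomial.C (loopCost d)) + Polynomial.C (loopCost d),
      fun {n β lo τ σ ρ m} hσ hr => ?_⟩
    refine (does_loopUp hw.1 (fun i τ => ∀ k, k ≠ 0 → τ k = iterUp (fun i σ =>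
      if h : i < n then p.exec (d + 1) (Function.update ρ d ⟨i, h⟩) σ else σ) i σ k)
      (fun i hi τ m hI hr => ?_) hr hσ).mono (T := n * (f.eval n + loopCost d) + loopCost d)
      (by simp) fun m' h => h
    refine (hf hI hr).mono le_rfl ?_
    rintro m' ⟨τ', hτ', hr'⟩
    exact ⟨τ', by simpa [iterUp, hi] using hτ', hr'⟩
  | down p ih =>
    intro d hw
    simp [St.wf] at hw
    obtain ⟨f, hf⟩ := ih (d + 1) hw.2
    refine ⟨Polynomial.X * (f + Polynomial.C (loopCost d)) + Polynomial.C (loopCost d),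
      fun {n β lo τ σ ρ m} hσ hr => ?_⟩
    let F := fun i (σ : State n) =>
      if h : i < n then p.exec (d + 1) (Function.update ρ d ⟨i, h⟩) σ else σ
    -- `iterDown` applies its highest index first, so the invariant speaks of the future: what is
    -- still to be run from the present state gives the result of the whole loop.
    refine (does_loopDown hw.1 (fun i τ => ∃ σ', (∀ k, k ≠ 0 → τ k = σ' k) ∧
      iterDown F i σ' = iterDown F n σ)
      (fun i hi τ m hI hr => ?_) hr ⟨σ, hσ, rfl⟩).mono
      (T := n * (f.eval n + loopCost d) + loopCost d) (by simp) ?_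
    · obtain ⟨σ', hσ', hF⟩ := hI
      refine (hf hσ' hr).mono le_rfl ?_
      rintro m' ⟨τ', hτ', hr'⟩
      exact ⟨τ', ⟨_, hτ', by simpa [iterDown, F, hi] using hF⟩, hr'⟩
    · rintro m' ⟨τ', ⟨σ', hσ', hF⟩, hr'⟩
      refine ⟨τ', fun k hk => ?_, hr'⟩
      rw [hσ' k hk]
      exact congrFun hF k

end KernelDE

namespace KernelDE

/-! ### From the input to the output -/

/-- The initial relations: relation `1` is the set of arcs. -/
def initState {n : ℕ} (D : Digraph (Fin n)) : State n := fun k i j => k = 1 ∧ D.Adj i j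

/-- The base address of the work area. -/
def baseAddr (n : ℕ) : ℕ := n + 3 + (n + 2) * (n + 1)

/-- Computation of the base address, with the help of two diagonal entries of the matrix. -/
def setBase : Prog :=
  .seq (.store (.const 1) (.add sizeE (.const 3)))
    (.seq (.store (.add sizeE (.const 2)) (.add sizeE (.const 2)))
      (.loop (.reg (.add sizeE (.const 2)))
        (.seq (.store (.const 1) (.add baseE (.add sizeE (.const 1))))
          (.store (.add sizeE (.const 2)) (.sub (.reg (.add sizeE (.const 2))) (.const 1))))))

section Setup

variable {n : ℕ} {D : Digraph (Fin n)}

theorem inputMem_zero : inputMem D 0 = n := by simp [inputMem]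

theorem inputMem_large {a : ℕ} (ha : n * n < a) : inputMem D a = 0 := by
  unfold inputMem
  rw [if_neg (by omega), if_neg]
  rintro ⟨i, j, h, _⟩
  have := i.2
  have := j.2
  have : (i : ℕ) * n + n ≤ n * n := by nlinarith
  omega

open Classical in
theorem inputMem_entry (i j : Fin n) :
    inputMem D (1 + i * n + j) = if D.Adj i j then 1 else 0 := by
  unfold inputMem
  rw [if_neg (by omega)]
  refine if_congr ⟨?_, fun h => ⟨i, j, rfl, h⟩⟩ rfl rfl
  rintro ⟨i', j', h, hA⟩
  obtain ⟨h1, h2⟩ := index_inj (i := i) (i' := i') j.2 j'.2 (by omega)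
  rwa [Fin.ext h1, Fin.ext h2]

/-- For `n ≥ 2` this register is the diagonal entry `(1, 1)`; for `n ≤ 1` it lies beyond the matrix.
-/
theorem inputMem_diag (hD : ∀ u, ¬ D.Adj u u) : inputMem D (n + 2) = 0 := by
  by_cases hn : 2 ≤ n
  · have := inputMem_entry (D := D) ⟨1, by omega⟩ ⟨1, by omega⟩
    rw [if_neg (hD _)] at this
    rw [← this]; congr 1; simp; omega
  · refine inputMem_large ?_
    interval_cases n <;> omega

/-- Free memory beyond the matrix cannot be addressed before its size is known. Registers `1` and `n
+ 2` carry no information, since there are no loops, and serve as accumulator and counter: `n + 2`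
passes add `n + 1` each to `n + 3`. The counter ends at `0`, its original value. -/
theorem does_setBase (hD : ∀ u, ¬ D.Adj u u) :
    Does setBase (inputMem D) ((n + 2) * 40 + 60)
      fun m => m = Function.update (inputMem D) 1 (baseAddr n) := by
  let I : Mem → Prop := fun m => ∃ c ≤ n + 2,
    m = Function.update (Function.update (inputMem D) 1 (n + 3 + (n + 2 - c) * (n + 1))) (n + 2) c
  have e0 : ∀ m, m 0 = n → (Expr.add sizeE (.const 2)).eval m = n + 2 := by
    intro m hm; simp [Expr.eval, sizeE, hm]
  have body : ∀ m, I m → (Expr.reg (.add sizeE (.const 2))).eval m ≠ 0 →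
      Does (.seq (.store (.const 1) (.add baseE (.add sizeE (.const 1))))
          (.store (.add sizeE (.const 2)) (.sub (.reg (.add sizeE (.const 2))) (.const 1)))) m 30
        fun m' => I m' ∧ (Expr.reg (.add sizeE (.const 2))).eval m' <
          (Expr.reg (.add sizeE (.const 2))).eval m := by
    rintro m ⟨c, hc, rfl⟩ h0
    simp only [Expr.eval, sizeE] at h0
    simp [inputMem_zero] at h0
    refine (Does.seq (Does.store (Q := _) (Does.store (Q := _) ?_))).mono
      (by simp [Expr.cost, sizeE, baseE]) fun _ h => h
    have h1 : (1 : ℕ) ≠ n + 2 := by omega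
    simp only [Expr.eval, sizeE, baseE]
    simp [inputMem_zero]
    refine ⟨⟨c - 1, by omega, ?_⟩, by omega⟩
    have h2 : n + 3 + (n + 2 - (c - 1)) * (n + 1) = n + 3 + (n + 2 - c) * (n + 1) + (n + 1) := by
      rw [show n + 2 - (c - 1) = n + 2 - c + 1 by omega]
      ring
    funext a
    simp only [Function.update_apply, h2]
    split_ifs <;> omega
  refine (Does.seq (T₂ := (n + 2) * 40 + 40) (Does.store (Q := _) ?_)).mono
    (by simp [Expr.cost, sizeE]; omega) fun _ h => h
  refine (Does.seq (T₂ := (n + 2) * 40 + 10) (Does.store (Q := _) ?_)).mono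
    (by simp [Expr.cost, sizeE]; omega) fun _ h => h
  have h1 : (Expr.const 1).eval (inputMem D) = 1 := rfl
  have h2 : (Expr.add sizeE (.const 3)).eval (inputMem D) = n + 3 := by
    simp [Expr.eval, sizeE, inputMem_zero]
  have h3 : Function.update (inputMem D) 1 (n + 3) 0 = n := by simp [inputMem_zero]
  rw [h1, h2, e0 _ h3]
  refine (Does.loop I body (N := n + 2) ⟨n + 2, le_rfl, by simp⟩ ?_).mono
    (by simp [Expr.cost, sizeE]; omega) ?_
  · simp only [Expr.eval, sizeE]
    simp [inputMem_zero]
  · rintro m ⟨⟨c, hc, rfl⟩, hz⟩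
    simp only [Expr.eval, sizeE] at hz
    simp [inputMem_zero] at hz
    subst hz
    rw [Function.update_comm (by omega)]
    have : Function.update (inputMem D) (n + 2) 0 = inputMem D := by
      rw [← inputMem_diag hD, Function.update_eq_self]
    rw [this]
    rfl

/-- Computation of the table of multiples of the size. -/
def setMul : Prog :=
  .loop (.sub sizeE (cellE 0)) (.seq (.store (.add (.add baseE (.const 16)) (cellE 0)) (cellE 1))
    (.seq (.store (cellA 1) (.add (cellE 1) sizeE)) (.store (cellA 0) (.add (cellE 0) (.const 1)))))

theorem does_setMul {β : ℕ} {lo m : Mem} (h2 : 2 ≤ β) (h0 : lo 0 = n) (h1 : lo 1 = β)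
    (hlo : ∀ a < β, m a = lo a) (hm : ∀ a, β ≤ a → m a = 0) (ρ : ℕ → Fin n) :
    Does setMul m (n * 100 + 100) fun m => Rep β lo (fun _ _ _ => False) ρ 0 m := by
  -- Register `β + 1` counts the entries written so far; register `β + 2` holds the next multiple of
  -- `n`.
  let I : Mem → Prop := fun m => (∀ a < β, m a = lo a) ∧ m (β + 1) ≤ n ∧
    m (β + 2) = m (β + 1) * n ∧ (∀ i < m (β + 1), m (β + 16 + i) = i * n) ∧
    ∀ a, β + 16 + n ≤ a → m a = 0
  have ev0 : ∀ m, I m → m 0 = n := fun m h => (h.1 0 (by omega)).trans h0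
  have ev1 : ∀ m, I m → m 1 = β := fun m h => (h.1 1 (by omega)).trans h1
  have body : ∀ m, I m → (Expr.sub sizeE (cellE 0)).eval m ≠ 0 →
      Does (.seq (.store (.add (.add baseE (.const 16)) (cellE 0)) (cellE 1))
        (.seq (.store (cellA 1) (.add (cellE 1) sizeE))
          (.store (cellA 0) (.add (cellE 0) (.const 1))))) m 60
        fun m' => I m' ∧ (Expr.sub sizeE (cellE 0)).eval m' <
          (Expr.sub sizeE (cellE 0)).eval m := by
    intro m hI hne
    have e0 := ev0 m hI
    have e1 := ev1 m hI
    obtain ⟨hl, hn, hacc, hmul, hz⟩ := hI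
    simp only [Expr.eval, sizeE, cellE, cellA, baseE, e0, e1, add_zero] at hne
    have ev : ∀ m' : Mem, (∀ a < β, m' a = lo a) → m' 0 = n ∧ m' 1 = β := fun m' h =>
      ⟨(h 0 (by omega)).trans h0, (h 1 (by omega)).trans h1⟩
    set c := m (β + 1) with hc
    refine (Does.seq (T₂ := 40) (Does.store (Q := _) ?_)).mono
      (by simp [Expr.cost, baseE, cellE, cellA]) fun _ h => h
    simp only [Expr.eval, cellE, cellA, baseE, e1, add_zero, ← hc, Nat.reduceAdd]
    set m₁ := Function.update m (β + 16 + c) (m (β + 2)) with hm₁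
    have hl₁ : ∀ a < β, m₁ a = lo a := fun a ha => by
      rw [hm₁, Function.update_of_ne (by omega), hl a ha]
    refine (Does.seq (T₂ := 20) (Does.store (Q := _) ?_)).mono
      (by simp [Expr.cost, sizeE]) fun _ h => h
    simp only [Expr.eval, sizeE, (ev m₁ hl₁).1, (ev m₁ hl₁).2]
    set m₂ := Function.update m₁ (β + 2) (m₁ (β + 2) + n) with hm₂
    have hl₂ : ∀ a < β, m₂ a = lo a := fun a ha => by
      rw [hm₂, Function.update_of_ne (by omega), hl₁ a ha]
    refine (Does.store (Q := _) ?_).mono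
      (by simp [Expr.cost]) fun _ h => h
    simp only [Expr.eval, (ev m₂ hl₂).2]
    have hc₂ : m₂ (β + 1) = c := by
      rw [hm₂, Function.update_of_ne (by omega), hm₁, Function.update_of_ne (by omega)]
    rw [hc₂]
    set m₃ := Function.update m₂ (β + 1) (c + 1) with hm₃
    have hl₃ : ∀ a < β, m₃ a = lo a := fun a ha => by
      rw [hm₃, Function.update_of_ne (by omega), hl₂ a ha]
    have hc₃ : m₃ (β + 1) = c + 1 := Function.update_self ..
    have ho : ∀ a, a ≠ β + 1 → a ≠ β + 2 → a ≠ β + 16 + c → m₃ a = m a := fun a ha hb hc => by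
      rw [hm₃, Function.update_of_ne ha, hm₂, Function.update_of_ne hb, hm₁,
        Function.update_of_ne hc]
    refine ⟨⟨hl₃, by omega, ?_, ?_, fun a ha => ?_⟩, ?_⟩
    · rw [hc₃, hm₃, Function.update_of_ne (by omega), hm₂, Function.update_self, hm₁,
        Function.update_of_ne (by omega), hacc]
      ring
    · intro i hi
      rw [hc₃] at hi
      rcases Nat.lt_succ_iff_lt_or_eq.1 hi with hi | rfl
      · rw [ho _ (by omega) (by omega) (by omega), hmul i hi]
      · rw [hm₃, Function.update_of_ne (by omega), hm₂, Function.update_of_ne (by omega), hm₁,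
          Function.update_self, hacc]
    · rw [ho _ (by omega) (by omega) (by omega), hz a ha]
    · simp only [(ev m₃ hl₃).1, (ev m₃ hl₃).2, hc₃, e0]
      omega
  refine (Does.loop I body (N := n) ⟨hlo, ?_, ?_, ?_, fun a ha => hm a (by omega)⟩ ?_).mono ?_ ?_
  · rw [hm _ (by omega)]; omega
  · rw [hm _ (by omega), hm _ (by omega)]; simp
  · rw [hm _ (by omega)]; intro i hi; omega
  · change sizeE.eval m - _ ≤ n
    rw [show sizeE.eval m = m 0 from rfl, hlo 0 (by omega), h0]
    exact Nat.sub_le _ _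
  · simp only [Expr.cost, sizeE, baseE, cellE, cellA]; omega
  · rintro m' ⟨hI, hz⟩
    have e0 := ev0 m' hI
    have e1 := ev1 m' hI
    obtain ⟨hl, hn, hacc, hmul, hz'⟩ := hI
    simp only [Expr.eval, sizeE, cellE, cellA, baseE, e0, e1, add_zero] at hz
    refine ⟨h2, h0, h1, hl, fun v hv => by omega, fun i hi => hmul i (by omega), ?_⟩
    intro k hk i j
    simp only [if_false]
    exact hz' _ (by unfold relAddr; omega)

/-- The copy of the input matrix, without the diagonal. -/
def copyInput : Prog :=
  fill 1 0 (.ite (.add (.sub (cellE 0) (cellE 1)) (.sub (cellE 1) (cellE 0)))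
    (.store baseE (.reg (.add (.add (.const 1)
      (.reg (.add (.add baseE (.const 16)) (cellE 0)))) (cellE 1)))) (.store baseE (.const 0)))

/-- Register `1`, the entry `(0, 0)`, now holds the base address; hence the diagonal is not read but
set to `0`. -/
theorem does_copyInput {β : ℕ} {lo m : Mem} {ρ : ℕ → Fin n} (hD : ∀ u, ¬ D.Adj u u)
    (hβ : n * n < β) (hlo : lo = Function.update (inputMem D) 1 β)
    (h : Rep β lo (fun _ _ _ => False) ρ 0 m) :
    Does copyInput m (fillCost 1 0 100 n) fun m => Rep β lo (initState D) ρ 0 m := by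
  refine (does_fill (by omega) (by omega) D.Adj (fun τ i j m _ hr => ?_) h).mono le_rfl
    fun m' hr => hr.congr_rel fun k _ i j => ?_
  swap
  · unfold initState
    by_cases hk : k = 1
    · subst hk; simp
    · simp [hk]
  set ρ' := Function.update (Function.update ρ 0 i) (0 + 1) j with hρ'
  have e0 : ρ' 0 = i := by simp [hρ']
  have e1 : ρ' 1 = j := by simp [hρ']
  refine (Does.ite (T₁ := 30) (T₂ := 10) (fun hne => ?_) (fun heq => ?_)).mono
    (by simp [Expr.cost, baseE, cellE, cellA]) fun _ h => h
  · refine (Does.store (Q := _) ?_).mono (by simp [Expr.cost, baseE, cellE, cellA]) fun _ h => h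
    simp only [Expr.eval, hr.eval_cellE (show 0 < 0 + 2 by omega),
      hr.eval_cellE (show 1 < 0 + 2 by omega), e0, e1] at hne
    rw [hr.eval_baseE]
    refine ⟨hr.update_res _, ?_⟩
    rw [Function.update_self]
    simp only [Expr.eval, hr.eval_cellE (show 0 < 0 + 2 by omega),
      hr.eval_cellE (show 1 < 0 + 2 by omega), e0, e1, hr.eval_baseE, hr.mul _ i.2]
    have hi := i.2
    have hj := j.2
    have hin : (i : ℕ) * n + n ≤ n * n := by nlinarith
    rw [hr.low _ (by omega), hlo, Function.update_of_ne, inputMem_entry]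
    intro h1
    have : (i : ℕ) * n = 0 := by omega
    rcases Nat.mul_eq_zero.1 this with h | h <;> omega
  · refine (Does.store (Q := _) ?_).mono (by simp [Expr.cost, baseE]) fun _ h => h
    simp only [Expr.eval, hr.eval_cellE (show 0 < 0 + 2 by omega),
      hr.eval_cellE (show 1 < 0 + 2 by omega), e0, e1] at heq
    have : i = j := Fin.ext (by omega)
    subst this
    rw [hr.eval_baseE]
    refine ⟨hr.update_res _, ?_⟩
    rw [Function.update_self, if_neg (hD _)]
    rfl

/-- The output of relation `o`; the two lowest registers are written last. -/
def output (o : ℕ) : Prog :=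
  .seq (.store (cellA 0) (.const 0)) (.seq (.store (cellA 2) (.reg (relE o 0 0)))
    (.seq (.store (cellA 0) (.const 1)) (.seq (.store (cellA 3) (.reg (relE o 0 0)))
      (.seq (.store (cellA 0) sizeE)
        (.seq (.loop (.sub (cellE 0) (.const 2)) (.seq (.store (cellA 0) (.sub (cellE 0) (.const 1)))
          (.store (cellE 0) (.reg (relE o 0 0)))))
          (.seq (.store (.const 0) (cellE 2)) (.store (.const 1) (cellE 3))))))))

/-- Addressing depends only on registers `0` and `1` below the base, so output may overwrite the
others. -/
theorem Rep.change_low {β : ℕ} {lo : Mem} {τ : State n} {ρ : ℕ → Fin n} {d : ℕ} {m : Mem}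
    (h : Rep β lo τ ρ d m) {v : ℕ} (hv : 2 ≤ v) (hv' : v < β) (x : ℕ) :
    Rep β (Function.update lo v x) τ ρ d (Function.update m v x) where
  two := h.two
  size := by rw [Function.update_of_ne (by omega), h.size]
  base := by rw [Function.update_of_ne (by omega), h.base]
  low a ha := by
    by_cases hav : a = v
    · subst hav; simp
    · rw [Function.update_of_ne hav, Function.update_of_ne hav, h.low a ha]
  cell u hu := by rw [Function.update_of_ne (by omega), h.cell u hu]
  mul i hi := by rw [Function.update_of_ne (by omega), h.mul i hi]
  rel k hk i j := by rw [Function.update_of_ne (by unfold relAddr; omega), h.rel k hk i j]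

theorem cost_relE_le (k : ℕ) : (relE k 0 0).cost ≤ 1000 := by
  simp [relE, timesE, Expr.cost, cellE, cellA, baseE, sizeE]

open Classical in
theorem does_output {β o : ℕ} {lo m : Mem} {τ : State n} {ρ : ℕ → Fin n} (ho : o < 32)
    (hn : 0 < n) (hnβ : n ≤ β) (h : Rep β lo τ ρ 0 m) :
    Does (output o) m (n * 2000 + 4000) fun m' =>
      ∀ v : Fin n, m' v = if τ o v v then 1 else 0 := by
  have hcost := cost_relE_le o
  have hread : ∀ (lo : Mem) (m : Mem) (v : Fin n), Rep β lo τ ρ 0 m → m (β + 1) = v →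
      (Expr.reg (relE o 0 0)).eval m = if τ o v v then 1 else 0 := by
    intro lo m v hr hv
    have hr' := hr.push v hv
    have := hr'.eval_relE o (x := 0) (y := 0) (by omega) (by omega)
    rw [Function.update_self] at this
    change m ((relE o 0 0).eval m) = _
    rw [this, hr.rel o ho]
  let F : Mem → Prop := fun m => m (β + 3) = (if τ o ⟨0, hn⟩ ⟨0, hn⟩ then 1 else 0) ∧
    ∀ h : 1 < n, m (β + 4) = if τ o ⟨1, h⟩ ⟨1, h⟩ then 1 else 0
  let I : Mem → Prop := fun m => (∃ lo, Rep β lo τ ρ 0 m) ∧ F m ∧ m (β + 1) ≤ n ∧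
    ∀ v : Fin n, 2 ≤ (v : ℕ) → m (β + 1) ≤ v → m v = if τ o v v then 1 else 0
  have body : ∀ m, I m → (Expr.sub (cellE 0) (.const 2)).eval m ≠ 0 →
      Does (.seq (.store (cellA 0) (.sub (cellE 0) (.const 1)))
          (.store (cellE 0) (.reg (relE o 0 0)))) m 1500
        fun m' => I m' ∧ (Expr.sub (cellE 0) (.const 2)).eval m' <
          (Expr.sub (cellE 0) (.const 2)).eval m := by
    rintro m ⟨⟨lo, hr⟩, hF, hle, hout⟩ hne
    simp only [Expr.eval, hr.eval_cellE', add_zero] at hne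
    refine (Does.seq (T₂ := 1200) (Does.store (Q := _) ?_)).mono
      (by simp [Expr.cost, baseE, cellE, cellA]) fun _ h => h
    simp only [Expr.eval, hr.eval_cellA, hr.eval_cellE', add_zero]
    set c := m (β + 1) with hc
    have hr₁ := hr.update_cell (by omega) (c - 1)
    rw [add_zero] at hr₁
    set m₁ := Function.update m (β + 1) (c - 1) with hm₁
    have hc₁ : m₁ (β + 1) = c - 1 := Function.update_self ..
    have ho₁ : ∀ a, a ≠ β + 1 → m₁ a = m a := fun a ha => Function.update_of_ne ha ..
    refine (Does.store (Q := _) ?_).mono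
      (by simp [Expr.cost, baseE, cellE, cellA]; omega) fun _ h => h
    have hlt : c - 1 < n := by omega
    rw [hread lo m₁ ⟨c - 1, hlt⟩ hr₁ hc₁, hr₁.eval_cellE', add_zero, hc₁]
    have hr₂ := hr₁.change_low (v := c - 1) (by omega) (by omega)
      (if τ o ⟨c - 1, hlt⟩ ⟨c - 1, hlt⟩ then 1 else 0)
    refine ⟨⟨⟨_, hr₂⟩, ⟨?_, fun h => ?_⟩, ?_, fun v hv hcv => ?_⟩, ?_⟩
    · rw [Function.update_of_ne (by omega), ho₁ _ (by omega), hF.1]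
    · rw [Function.update_of_ne (by omega), ho₁ _ (by omega), hF.2 h]
    · rw [Function.update_of_ne (by omega), hc₁]; omega
    · rw [Function.update_of_ne (by omega), hc₁] at hcv
      by_cases hvc : (v : ℕ) = c - 1
      · obtain rfl : v = ⟨c - 1, hlt⟩ := Fin.ext hvc
        simp
      · have := v.2
        rw [Function.update_of_ne hvc, ho₁ _ (by omega), hout v hv (by omega)]
    · simp only [hr₂.eval_cellE', add_zero]
      rw [Function.update_of_ne (by omega), hc₁]
      omega
  have hstep : ∀ {m : Mem} {v : ℕ} {e : Expr} {p : Prog} {T T' : ℕ} {Q : Mem → Prop},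
      Rep β lo τ ρ 0 m → v < 10 → e.cost + T + 10 ≤ T' →
      (∀ m', m' = Function.update m (β + 1 + v) (e.eval m) → Rep β lo τ ρ 0 m' → Does p m' T Q) →
      Does (.seq (.store (cellA v) e) p) m T' Q := by
    intro m v e p T T' Q hr hv hT hp
    refine (Does.seq (T₂ := T) (Does.store (Q := _) ?_)).mono
      (by simp [Expr.cost, cellA, baseE]; omega) fun _ h => h
    rw [hr.eval_cellA]
    refine hp _ rfl ?_
    have := hr.update_free (v := 1 + v) (.inr (by omega)) (by omega) (e.eval m)
    rwa [← add_assoc] at this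
  refine hstep (T := n * 2000 + 3800) h (by omega) (by simp only [Expr.cost]; omega) fun m₁ hm₁ hr₁ => ?_
  refine hstep (T := n * 2000 + 2780) hr₁ (by omega)
    (by simp only [Expr.cost]; omega) fun m₂ hm₂ hr₂ => ?_
  refine hstep (T := n * 2000 + 2740) hr₂ (by omega)
    (by simp only [Expr.cost]; omega) fun m₃ hm₃ hr₃ => ?_
  refine hstep (T := n * 2000 + 1720) hr₃ (by omega)
    (by simp only [Expr.cost]; omega) fun m₄ hm₄ hr₄ => ?_
  refine hstep (T := n * 2000 + 1700) hr₄ (by omega)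
    (by simp only [Expr.cost, sizeE]; omega) fun m₅ hm₅ hr₅ => ?_
  have h0 : m₂ (β + 3) = if τ o ⟨0, hn⟩ ⟨0, hn⟩ then 1 else 0 := by
    have : m₁ (β + 1) = 0 := by rw [hm₁]; simp [Expr.eval]
    rw [hm₂, hread lo m₁ ⟨0, hn⟩ hr₁ this, show β + 1 + 2 = β + 3 by omega, Function.update_self]
  have h1 : ∀ h : 1 < n, m₄ (β + 4) = if τ o ⟨1, h⟩ ⟨1, h⟩ then 1 else 0 := by
    intro h
    have : m₃ (β + 1) = 1 := by rw [hm₃]; simp [Expr.eval]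
    rw [hm₄, hread lo m₃ ⟨1, h⟩ hr₃ this, show β + 1 + 3 = β + 4 by omega, Function.update_self]
  have hF : F m₅ := by
    refine ⟨?_, fun h => ?_⟩
    · rw [hm₅, Function.update_of_ne (by omega), hm₄, Function.update_of_ne (by omega), hm₃,
        Function.update_of_ne (by omega), h0]
    · rw [hm₅, Function.update_of_ne (by omega), h1 h]
  have h5 : m₅ (β + 1) = n := by rw [hm₅, hr₄.eval_sizeE]; simp
  refine (Does.seq (T₂ := 60) ((Does.loop I body (N := n)
    ⟨⟨lo, hr₅⟩, hF, h5.le, fun v _ hv => ?_⟩ ?_).mono le_rfl fun m₆ hI => ?_)).mono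
    (by simp [Expr.cost, cellE, cellA, baseE]; omega) fun _ h => h
  · rw [h5] at hv; omega
  · simp only [Expr.eval, hr₅.eval_cellE', add_zero, h5]; omega
  · obtain ⟨⟨⟨lo', hr₆⟩, hF₆, hle₆, hout⟩, hz⟩ := hI
    have h2 := hr₆.two
    simp only [Expr.eval, hr₆.eval_cellE', add_zero] at hz
    refine (Does.seq (T₂ := 20) (Does.store (Q := _) ?_)).mono
      (by simp [Expr.cost, cellE, cellA, baseE]) fun _ h => h
    rw [show (Expr.const 0).eval m₆ = 0 from rfl, hr₆.eval_cellE', show β + 1 + 2 = β + 3 by omega,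
      hF₆.1]
    refine (Does.store (Q := _) ?_).mono
      (by simp [Expr.cost, cellE, cellA, baseE]) fun _ h => h
    have e1 : ∀ x, (cellE 3).eval (Function.update m₆ 0 x) = m₆ (β + 4) := by
      intro x
      simp only [Expr.eval, cellE, cellA, baseE]
      rw [Function.update_of_ne (by omega), Function.update_of_ne one_ne_zero,
        hr₆.low 1 (by omega), hr₆.base]
    rw [e1]
    intro v
    change Function.update (Function.update m₆ 0 _) 1 _ (v : ℕ) = _
    by_cases hv1 : (v : ℕ) = 1
    · have h1n : 1 < n := hv1 ▸ v.2
      obtain rfl : v = ⟨1, h1n⟩ := Fin.ext hv1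
      rw [Function.update_self, hF₆.2]
    · rw [Function.update_of_ne hv1]
      by_cases hv0 : (v : ℕ) = 0
      · obtain rfl : v = ⟨0, hn⟩ := Fin.ext hv0
        rw [Function.update_self]
      · rw [Function.update_of_ne hv0, hout v (by omega) (by omega)]

end Setup

/-- The complete program computing relation `o` by the statement `p`. -/
def St.program (p : St) (o : ℕ) : Prog :=
  .ite sizeE (.seq setBase (.seq setMul (.seq copyInput (.seq (p.comp 0) (output o))))) .skip

theorem St.program_correct (p : St) (o : ℕ) (hp : p.wf 0 = true) (ho : o < 32) (ho0 : o ≠ 0) :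
    ∃ f : Polynomial ℕ, ∀ (n : ℕ) (D : Digraph (Fin n)), (∀ u, ¬ D.Adj u u) →
      ∃ (m : Mem) (t : ℕ), Runs (p.program o) (inputMem D) m t ∧ t ≤ f.eval n ∧
        ∀ h : 0 < n, outputSet n m =
          {v | p.exec 0 (fun _ => ⟨0, h⟩) (initState D) o v v} := by
  obtain ⟨f, hf⟩ := p.comp_correct 0 hp
  obtain ⟨g, hg⟩ := exists_fillCost 1 0 (Polynomial.C 100)
  simp only [Polynomial.eval_C] at hg
  refine ⟨f + g + Polynomial.C 5000 * Polynomial.X + Polynomial.C 5000, fun n D hD => ?_⟩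
  rcases Nat.eq_zero_or_pos n with rfl | hn
  · refine ⟨_, _, .ite_false ?_ (.skip _), by simp [Expr.cost, sizeE], fun h => by omega⟩
    simp [sizeE, Expr.eval, inputMem_zero]
  have hβ : n * n + n + 3 ≤ baseAddr n := by unfold baseAddr; nlinarith
  have key : Does (p.program o) (inputMem D) ((f.eval n) + (g.eval n) + 5000 * n + 5000) fun m =>
      ∀ h : 0 < n, outputSet n m = {v | p.exec 0 (fun _ => ⟨0, h⟩) (initState D) o v v} := by
    refine (Does.ite (T₁ := f.eval n + g.eval n + 5000 * n + 4990) (T₂ := 1)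
      (fun _ => ?_) fun hz => ?_).mono (by simp [Expr.cost, sizeE]; omega) fun _ h => h
    swap
    · simp [sizeE, Expr.eval, inputMem_zero] at hz
      omega
    refine (Does.seq (T₂ := f.eval n + g.eval n + 4000 * n + 4700)
      ((does_setBase hD).mono le_rfl ?_)).mono (by omega) fun _ h => h
    rintro m₁ rfl
    refine (Does.seq (T₂ := f.eval n + g.eval n + 3000 * n + 4500)
      ((does_setMul (β := baseAddr n) (by omega) ?_ ?_ (fun a _ => rfl) ?_ fun _ => ⟨0, hn⟩).mono le_rfl ?_)).mono
      (by omega) fun _ h => h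
    · rw [Function.update_of_ne zero_ne_one, inputMem_zero]
    · rw [Function.update_self]
    · intro a ha
      rw [Function.update_of_ne (by omega), inputMem_large (by omega)]
    intro m₂ hr₂
    refine (Does.seq (T₂ := f.eval n + 3000 * n + 4400)
      ((does_copyInput hD (by omega) rfl hr₂).mono (hg n).le ?_)).mono (by omega) fun _ h => h
    intro m₃ hr₃
    refine (Does.seq (T₂ := n * 2000 + 4000)
      ((hf (fun _ _ => rfl) hr₃).mono le_rfl ?_)).mono (by omega) fun _ h => h
    rintro m₄ ⟨τ', hτ', hr₄⟩
    refine (does_output ho hn (by omega) hr₄).mono le_rfl ?_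
    intro m₅ hm₅ _
    ext v
    simp only [outputSet, Set.mem_ofPred_eq, hm₅ v]
    rw [hτ' o ho0]
    simp
  obtain ⟨m, t, h₁, h₂, h₃⟩ := key
  exact ⟨m, t, h₁, by simpa using h₂, h₃⟩

end KernelDE

namespace KernelDE

/-! ### Kernels by deferred acceptance -/

section Stable

variable {V : Type*}

/-- Symmetrized and reflexive adjacency. -/
def Near (D : V → V → Prop) (u v : V) : Prop := u = v ∨ D u v ∨ D v u

theorem Near.symm {D : V → V → Prop} {u v : V} (h : Near D u v) : Near D v u := by
  unfold Near at *; tauto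

theorem Near.rfl {D : V → V → Prop} {u : V} : Near D u u := .inl (Eq.refl _)

/-- Every nonempty clique has a vertex that all others point to and one that points to all
others. -/
def CliqueExtremes (D : V → V → Prop) : Prop :=
  ∀ Q : V → Prop, (∃ v, Q v) → (∀ u v, Q u → Q v → Near D u v) →
    (∃ e, Q e ∧ ∀ g, Q g → g = e ∨ D g e) ∧ (∃ e, Q e ∧ ∀ g, Q g → g = e ∨ D e g)

/-- `K` is a kernel of the subgraph of `D` induced by `R`. -/
def KernelOn (D : V → V → Prop) (R K : V → Prop) : Prop :=
  (∀ v, K v → R v) ∧ (∀ u v, K u → K v → Near D u v → u = v) ∧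
    ∀ u, R u → ¬ K u → ∃ v, K v ∧ D u v

/-- `X` and `Y` are equivalence relations on `H` whose union is adjacency or equality. -/
structure Bicolored (D : V → V → Prop) (H : V → Prop) (X Y : V → V → Prop) : Prop where
  near : ∀ u v, H u → H v → (Near D u v ↔ X u v ∨ Y u v)
  reflX : ∀ u, H u → X u u
  reflY : ∀ u, H u → Y u u
  symmX : ∀ u v, X u v → X v u
  symmY : ∀ u v, Y u v → Y v u
  transX : ∀ u v w, H u → H v → H w → X u v → X v w → X u w
  transY : ∀ u v w, H u → H v → H w → Y u v → Y v w → Y u w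

theorem Bicolored.mono {D : V → V → Prop} {H H' : V → Prop} {X Y : V → V → Prop}
    (h : Bicolored D H X Y) (hH : ∀ v, H' v → H v) : Bicolored D H' X Y where
  near u v hu hv := h.near u v (hH _ hu) (hH _ hv)
  reflX u hu := h.reflX u (hH _ hu)
  reflY u hu := h.reflY u (hH _ hu)
  symmX := h.symmX
  symmY := h.symmY
  transX u v w hu hv hw := h.transX u v w (hH _ hu) (hH _ hv) (hH _ hw)
  transY u v w hu hv hw := h.transY u v w (hH _ hu) (hH _ hv) (hH _ hw)

/-- `e` is preferred to all members of `S` in its class. -/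
def Best (D X : V → V → Prop) (S : V → Prop) (e : V) : Prop :=
  ∀ g, S g → X e g → g = e ∨ D g e

/-- All members of `S` in the class of `f` are preferred to `f`. -/
def Worst (D Y : V → V → Prop) (S : V → Prop) (f : V) : Prop :=
  ∀ g, S g → Y f g → g = f ∨ D f g

variable {D X Y : V → V → Prop} {R : V → Prop}

/-- The state of deferred acceptance: `S` is the set of vertices not yet rejected, `M` the set of
current proposals. -/
structure Deferred (D X Y : V → V → Prop) (R S M : V → Prop) : Prop where
  sub : ∀ v, S v → R v
  mem : ∀ v, M v → S v
  best : ∀ v, M v → Best D X S v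
  one : ∀ u v, M u → M v → X u v → u = v
  -- This is what finally yields absorption: a rejected vertex points to all survivors of its class,
  -- and one of them is a proposal.
  rejected : ∀ f, R f → ¬ S f → (∃ g, M g ∧ Y f g) ∧ ∀ g, S g → Y f g → D f g

theorem Deferred.start (R : V → Prop) : Deferred D X Y R R fun _ => False :=
  ⟨fun _ h => h, fun _ h => h.elim, fun _ h => h.elim, fun _ _ h => h.elim,
    fun _ h h' => absurd h h'⟩

variable [LinearOrder V]

/-- The best elements of the classes that do not meet `M` propose. -/
def Propose (D X : V → V → Prop) (S M : V → Prop) (e : V) : Prop :=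
  S e ∧ (¬ ∃ m, M m ∧ X e m) ∧ Best D X S e ∧ ∀ g, S g → X e g → Best D X S g → ¬ g < e

/-- The worst elements of the classes that meet `M` twice are rejected. -/
def Reject (D Y : V → V → Prop) (S M : V → Prop) (f : V) : Prop :=
  S f ∧ Worst D Y S f ∧ (∀ g, S g → Y f g → Worst D Y S g → ¬ g < f) ∧
    ∃ e, ∃ e', M e ∧ M e' ∧ e ≠ e' ∧ Y f e ∧ Y f e'

/-- Breaks ties: because of edges oriented both ways, a class can have several best or worst
members. -/
theorem exists_least [Fintype V] (P : V → Prop) (h : ∃ v, P v) :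
    ∃ v, P v ∧ ∀ g, P g → ¬ g < v := by
  classical
  obtain ⟨v, hv⟩ := h
  obtain ⟨m, hm, hmin⟩ := (Finset.univ.filter P).exists_min_image id ⟨v, by simpa using hv⟩
  exact ⟨m, by simpa using hm, fun g hg => not_lt.2 (hmin g (by simpa using hg))⟩

theorem Deferred.propose (hB : Bicolored D R X Y) {S M : V → Prop}
    (h : Deferred D X Y R S M) : Deferred D X Y R S fun v => M v ∨ Propose D X S M v where
  sub := h.sub
  mem v hv := hv.elim (h.mem v) fun hv => hv.1
  best v hv := hv.elim (h.best v) fun hv => hv.2.2.1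
  one u v hu hv huv := by
    rcases hu with hu | hu <;> rcases hv with hv | hv
    · exact h.one u v hu hv huv
    · exact absurd ⟨u, hu, hB.symmX _ _ huv⟩ hv.2.1
    · exact absurd ⟨v, hv, huv⟩ hu.2.1
    · exact le_antisymm (not_lt.1 (hu.2.2.2 v hv.1 huv hv.2.2.1))
        (not_lt.1 (hv.2.2.2 u hu.1 (hB.symmX _ _ huv) hu.2.2.1))
  rejected f hf hS := by
    obtain ⟨⟨g, hg, hfg⟩, h'⟩ := h.rejected f hf hS
    exact ⟨⟨g, .inl hg, hfg⟩, h'⟩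

/-- The survivors in an `X`-class form a clique, which has a member to which all others point. So
after the proposals every class with a survivor has a proposal. -/
theorem Deferred.covered [Fintype V] (hB : Bicolored D R X Y) (hD : CliqueExtremes D) {S M : V → Prop}
    (h : Deferred D X Y R S M) (v : V) (hv : S v) :
    ∃ e, (M e ∨ Propose D X S M e) ∧ X v e := by
  by_cases hc : ∃ m, M m ∧ X v m
  · obtain ⟨m, hm, hvm⟩ := hc
    exact ⟨m, .inl hm, hvm⟩
  · obtain ⟨e, ⟨hSe, hve⟩, he⟩ := (hD (fun g => S g ∧ X v g) ⟨v, hv, hB.reflX v (h.sub v hv)⟩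
      fun a b ha hb => (hB.near a b (h.sub a ha.1) (h.sub b hb.1)).2
        (.inl (hB.transX a v b (h.sub _ ha.1) (h.sub _ hv) (h.sub _ hb.1)
          (hB.symmX _ _ ha.2) hb.2))).1
    obtain ⟨e, ⟨hSe, hve, he⟩, hmin⟩ := exists_least (fun e => S e ∧ X v e ∧ Best D X S e)
      ⟨e, hSe, hve, fun g hg heg => he g ⟨hg, hB.transX v e g (h.sub _ hv) (h.sub _ hSe) (h.sub _ hg)
        hve heg⟩⟩
    refine ⟨e, .inr ⟨hSe, ?_, he, fun g hg heg hbg => hmin g ⟨hg, ?_, hbg⟩⟩, hve⟩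
    · rintro ⟨m, hm, hem⟩
      exact hc ⟨m, hm, hB.transX v e m (h.sub _ hv) (h.sub _ hSe) (h.sub _ (h.mem _ hm)) hve hem⟩
    · exact hB.transX v e g (h.sub _ hv) (h.sub _ hSe) (h.sub _ hg) hve heg

/-- A class loses at most one vertex per round, and only if it holds two proposals, so it keeps a
proposal. The vertex lost was worst among the survivors, and later survivors are fewer. -/
theorem Deferred.reject (hB : Bicolored D R X Y) {S M : V → Prop} (h : Deferred D X Y R S M) :
    Deferred D X Y R (fun v => S v ∧ ¬ Reject D Y S M v) fun v => M v ∧ ¬ Reject D Y S M v where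
  sub v hv := h.sub v hv.1
  mem v hv := ⟨h.mem v hv.1, hv.2⟩
  best v hv g hg := h.best v hv.1 g hg.1
  one u v hu hv := h.one u v hu.1 hv.1
  rejected f hf hS := by
    have uniq : ∀ g g', Reject D Y S M g → Reject D Y S M g' → Y g g' → g = g' := by
      intro g g' hg hg' hgg
      exact le_antisymm (not_lt.1 (hg.2.2.1 g' hg'.1 hgg hg'.2.1))
        (not_lt.1 (hg'.2.2.1 g hg.1 (hB.symmY _ _ hgg) hg.2.1))
    -- If the proposal `g` on which `f` relied is itself rejected, one of the two proposals that
    -- caused this differs from `g` and takes its place.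
    have other : ∀ f g, R f → S g → Y f g → Reject D Y S M g →
        ∃ g', (M g' ∧ ¬ Reject D Y S M g') ∧ Y f g' := by
      intro f g hf hg hfg hr
      obtain ⟨e, e', he, he', hne, hge, hge'⟩ := hr.2.2.2
      have hRg := h.sub _ hg
      have aux : ∀ e, M e → Y g e → e ≠ g → ∃ g', (M g' ∧ ¬ Reject D Y S M g') ∧ Y f g' :=
        fun e he hge hne => ⟨e, ⟨he, fun hr' => hne (uniq g e hr hr' hge).symm⟩,
          hB.transY f g e hf hRg (h.sub _ (h.mem _ he)) hfg hge⟩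
      by_cases hcase : e = g
      · exact aux e' he' hge' fun h' => hne (hcase.trans h'.symm)
      · exact aux e he hge hcase
    by_cases hSf : S f
    · have hr : Reject D Y S M f := by by_contra hr; exact hS ⟨hSf, hr⟩
      refine ⟨other f f hf hSf (hB.reflY f hf) hr, fun g hg hfg => ?_⟩
      rcases hr.2.1 g hg.1 hfg with rfl | hd
      · exact absurd hr hg.2
      · exact hd
    · obtain ⟨⟨g, hg, hfg⟩, h'⟩ := h.rejected f hf hSf
      refine ⟨?_, fun g hg => h' g hg.1⟩
      by_cases hr : Reject D Y S M g
      · exact other f g hf (h.mem _ hg) hfg hr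
      · exact ⟨g, ⟨hg, hr⟩, hfg⟩

/-- Two adjacent proposals would share a `Y`-class, whose worst survivor would then be rejected.
Survivors are absorbed by the proposal of their `X`-class, rejected vertices by a proposal of their
`Y`-class. -/
theorem Deferred.kernelOn [Fintype V] (hB : Bicolored D R X Y) (hD : CliqueExtremes D)
    {S M : V → Prop} (h : Deferred D X Y R S M)
    (hcov : ∀ v, S v → ∃ e, M e ∧ X v e) (hrej : ∀ f, ¬ Reject D Y S M f) :
    KernelOn D R M := by
  refine ⟨fun v hv => h.sub v (h.mem v hv), fun u v hu hv huv => ?_, fun u hu hM => ?_⟩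
  · have hRu := h.sub u (h.mem u hu)
    have hRv := h.sub v (h.mem v hv)
    rcases (hB.near u v hRu hRv).1 huv with hx | hy
    · exact h.one u v hu hv hx
    · by_contra hne
      obtain ⟨f, ⟨hSf, huf⟩, hf⟩ := (hD (fun g => S g ∧ Y u g)
        ⟨u, h.mem u hu, hB.reflY u hRu⟩ fun a b ha hb =>
          (hB.near a b (h.sub a ha.1) (h.sub b hb.1)).2
          (.inr (hB.transY a u b (h.sub _ ha.1) hRu (h.sub _ hb.1)
          (hB.symmY _ _ ha.2) hb.2))).2
      obtain ⟨f, ⟨hSf, huf, hf⟩, hmin⟩ := exists_least (fun f => S f ∧ Y u f ∧ Worst D Y S f)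
        ⟨f, hSf, huf, fun g hg hfg => hf g ⟨hg, hB.transY u f g hRu (h.sub _ hSf) (h.sub _ hg)
          huf hfg⟩⟩
      have hRf := h.sub f hSf
      refine hrej f ⟨hSf, hf, fun g hg hfg hw => hmin g ⟨hg, ?_, hw⟩, u, v, hu, hv, hne,
        hB.symmY _ _ huf, hB.transY f u v hRf hRu hRv (hB.symmY _ _ huf) hy⟩
      exact hB.transY u f g hRu hRf (h.sub _ hg) huf hfg
  · by_cases hS : S u
    · obtain ⟨e, he, hue⟩ := hcov u hS
      rcases h.best e he u hS (hB.symmX _ _ hue) with rfl | hd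
      · exact absurd he hM
      · exact ⟨e, he, hd⟩
    · obtain ⟨⟨g, hg, hfg⟩, h'⟩ := h.rejected u hu hS
      exact ⟨g, hg, h' g (h.mem g hg) hfg⟩

end Stable

end KernelDE

namespace KernelDE

/-! ### Formulas and statements relative to the binding level -/

/-- Formulas as functions of the binding level. -/
abbrev LFm : Type := ℕ → Fm

/-- Statements as functions of the binding level. -/
abbrev LSt : Type := ℕ → St

namespace LFm

/-- Atomic formula. -/
def rel (k x y : ℕ) : LFm := fun _ => .rel k x y
/-- Membership in the set of vertices that relation `k` relates to themselves. -/
def mem (k x : ℕ) : LFm := rel k x x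
/-- Equality. -/
def eq (x y : ℕ) : LFm := fun _ => .eq x y
/-- Order. -/
def lt (x y : ℕ) : LFm := fun _ => .lt x y
/-- Negation. -/
def neg (φ : LFm) : LFm := fun d => .neg (φ d)
/-- Conjunction. -/
def and (φ ψ : LFm) : LFm := fun d => .and (φ d) (ψ d)
/-- Disjunction. -/
def or (φ ψ : LFm) : LFm := neg (and (neg φ) (neg ψ))
/-- Implication. -/
def imp (φ ψ : LFm) : LFm := neg (and φ (neg ψ))
/-- Existential quantification. -/
def ex (φ : ℕ → LFm) : LFm := fun d => .ex (φ d (d + 1))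
/-- Universal quantification. -/
def all (φ : ℕ → LFm) : LFm := neg (ex fun x => neg (φ x))

/-- Truth at binding level `d`. -/
def Holds {n : ℕ} (σ : State n) (d : ℕ) (ρ : ℕ → Fin n) (φ : LFm) : Prop := (φ d).eval σ d ρ

section Holds

variable {n : ℕ} {σ : State n} {d : ℕ} {ρ : ℕ → Fin n}

@[simp] theorem holds_rel {k x y : ℕ} : Holds σ d ρ (rel k x y) ↔ σ k (ρ x) (ρ y) := Iff.rfl
@[simp] theorem holds_mem {k x : ℕ} : Holds σ d ρ (mem k x) ↔ σ k (ρ x) (ρ x) := Iff.rfl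
@[simp] theorem holds_eq {x y : ℕ} : Holds σ d ρ (eq x y) ↔ ρ x = ρ y := Iff.rfl
@[simp] theorem holds_lt {x y : ℕ} : Holds σ d ρ (lt x y) ↔ ρ x < ρ y := Iff.rfl
@[simp] theorem holds_neg {φ : LFm} : Holds σ d ρ (neg φ) ↔ ¬ Holds σ d ρ φ := Iff.rfl
@[simp] theorem holds_and {φ ψ : LFm} :
    Holds σ d ρ (and φ ψ) ↔ Holds σ d ρ φ ∧ Holds σ d ρ ψ := Iff.rfl
@[simp] theorem holds_or {φ ψ : LFm} :
    Holds σ d ρ (or φ ψ) ↔ Holds σ d ρ φ ∨ Holds σ d ρ ψ := by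
  simp only [or, holds_neg, holds_and]; tauto
@[simp] theorem holds_imp {φ ψ : LFm} :
    Holds σ d ρ (imp φ ψ) ↔ (Holds σ d ρ φ → Holds σ d ρ ψ) := by
  simp only [imp, holds_neg, holds_and]; tauto
@[simp] theorem holds_ex {φ : ℕ → LFm} :
    Holds σ d ρ (ex φ) ↔ ∃ i, Holds σ (d + 1) (Function.update ρ d i) (φ d) := Iff.rfl
@[simp] theorem holds_all {φ : ℕ → LFm} :
    Holds σ d ρ (all φ) ↔ ∀ i, Holds σ (d + 1) (Function.update ρ d i) (φ d) := by
  simp only [all, holds_neg, holds_ex, not_exists, not_not]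

end Holds

end LFm

namespace LSt

/-- Simultaneous update of relation `k`. -/
def upd (k : ℕ) (φ : ℕ → ℕ → LFm) : LSt := fun d => .upd k (φ d (d + 1) (d + 2))
/-- Composition. -/
def seq (p q : LSt) : LSt := fun d => .seq (p d) (q d)
/-- Conditional execution. -/
def when (φ : LFm) (p : LSt) : LSt := fun d => .ite (φ d) (p d) .skip
/-- Ascending loop. -/
def up (p : ℕ → LSt) : LSt := fun d => .up (p d (d + 1))
/-- Descending loop. -/
def down (p : ℕ → LSt) : LSt := fun d => .down (p d (d + 1))

/-- The effect of a statement. -/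
noncomputable def run {n : ℕ} (p : LSt) (d : ℕ) (ρ : ℕ → Fin n) (σ : State n) : State n :=
  (p d).exec d ρ σ

section Run

variable {n : ℕ} {σ : State n} {d : ℕ} {ρ : ℕ → Fin n}

theorem run_upd {k : ℕ} {φ : ℕ → ℕ → LFm} : (upd k φ).run d ρ σ =
    Function.update σ k fun i j =>
      LFm.Holds σ (d + 2) (Function.update (Function.update ρ d i) (d + 1) j) (φ d (d + 1)) := rfl

theorem run_seq {p q : LSt} : (seq p q).run d ρ σ = q.run d ρ (p.run d ρ σ) := rfl

theorem run_when_pos {φ : LFm} {p : LSt} (h : LFm.Holds σ d ρ φ) :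
    (when φ p).run d ρ σ = p.run d ρ σ := if_pos h

theorem run_when_neg {φ : LFm} {p : LSt} (h : ¬ LFm.Holds σ d ρ φ) :
    (when φ p).run d ρ σ = σ := if_neg h

theorem run_up_induct {p : ℕ → LSt} (I : ℕ → State n → Prop) (h0 : I 0 σ)
    (hs : ∀ i (hi : i < n) σ, I i σ →
      I (i + 1) ((p d).run (d + 1) (Function.update ρ d ⟨i, hi⟩) σ)) :
    I n ((up p).run d ρ σ) :=
  iterUp_induct I h0 fun i hi σ' h => by
    simp only [hi, dite_true]; exact hs i hi σ' h

theorem run_down_induct {p : ℕ → LSt} (I : ℕ → State n → Prop) (h0 : I n σ)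
    (hs : ∀ i (hi : i < n) σ, I (i + 1) σ →
      I i ((p d).run (d + 1) (Function.update ρ d ⟨i, hi⟩) σ)) :
    I 0 ((down p).run d ρ σ) :=
  iterDown_induct I h0 fun i hi σ' h => by
    simp only [hi, dite_true]; exact hs i hi σ' h

end Run

end LSt

/-! ### The relations of the program

`1`: arcs; `2`: vertices not yet treated; `3`: private parts of the leaves by stage; `4`: candidates
of a stage; `5`: their kernels; `6`: remaining kernels; `7`: output; `8`, `9`: private part and
boundary of a leaf; `10`, `11`: its coloring; `12`: success of the search; `13`, `14`: private part
and boundary of a candidate leaf; `15`, `16`: colored pairs; `17`: vertices to be solved; `18`: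
proposals; `19`: vertices not rejected; `20`: good pairs; `21`: rejected vertices; `23`, `24`:
coloring of a candidate leaf. -/

/-- The vertices that relation `k` relates to themselves. -/
def State.set {n : ℕ} (σ : State n) (k : ℕ) (v : Fin n) : Prop := σ k v v

theorem State.set_update_self {n : ℕ} (σ : State n) (k : ℕ) (P : Fin n → Fin n → Prop) :
    State.set (Function.update σ k P) k = fun v => P v v := by
  funext v; simp [State.set]

theorem State.set_update_ne {n : ℕ} (σ : State n) {k k' : ℕ} (h : k' ≠ k)
    (P : Fin n → Fin n → Prop) : State.set (Function.update σ k P) k' = σ.set k' := by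
  funext v; simp [State.set, h]

theorem State.set_congr {n : ℕ} {σ σ' : State n} {k : ℕ} (h : σ k = σ' k) : σ.set k = σ'.set k := by
  funext v; simp [State.set, h]

theorem LSt.run_frame {n k d : ℕ} {ρ : ℕ → Fin n} {σ : State n} (p : LSt)
    (h : (p d).writes k = false) : p.run d ρ σ k = σ k :=
  St.exec_frame _ _ _ _ h

/-! ### Deferred acceptance as a program -/

section Acceptance

open LFm

/-- `Best` as a formula. -/
def bestF (x : ℕ) : LFm :=
  all fun g => imp (mem 19 g) (imp (rel 10 x g) (or (eq g x) (rel 1 g x)))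

/-- `Worst` as a formula. -/
def worstF (x : ℕ) : LFm :=
  all fun g => imp (mem 19 g) (imp (rel 11 x g) (or (eq g x) (rel 1 x g)))

/-- `Propose` as a formula. -/
def proposeF (x : ℕ) : LFm :=
  and (mem 19 x) (and (neg (ex fun m => and (mem 18 m) (rel 10 x m))) (and (bestF x)
    (all fun g => imp (mem 19 g) (imp (rel 10 x g) (imp (bestF g) (neg (lt g x)))))))

/-- `Reject` as a formula. -/
def rejectF (x : ℕ) : LFm :=
  and (mem 19 x) (and (worstF x) (and
    (all fun g => imp (mem 19 g) (imp (rel 11 x g) (imp (worstF g) (neg (lt g x)))))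
    (ex fun e => ex fun e' => and (mem 18 e) (and (mem 18 e') (and (neg (eq e e'))
      (and (rel 11 x e) (rel 11 x e')))))))

/-- One round of deferred acceptance. -/
def acceptRound : LSt :=
  .seq (.upd 18 fun x _ => or (mem 18 x) (proposeF x))
    (.seq (.upd 21 fun x _ => rejectF x)
      (.seq (.upd 19 fun x _ => and (mem 19 x) (neg (mem 21 x)))
        (.upd 18 fun x _ => and (mem 18 x) (neg (mem 21 x)))))

/-- Deferred acceptance on the vertices in relation `17`. -/
def accept : LSt :=
  .seq (.upd 19 fun x _ => mem 17 x) (.seq (.upd 18 fun x _ => neg (eq x x))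
    (.up fun _ => acceptRound))

variable {n : ℕ} {σ : State n} {d : ℕ} {ρ : ℕ → Fin n}

theorem update_lt {x : ℕ} (hx : x < d) (i : Fin n) : Function.update ρ d i x = ρ x :=
  Function.update_of_ne hx.ne _ _

theorem update_pair (i j : Fin n) :
    Function.update (Function.update ρ d i) (d + 1) j d = i ∧
      Function.update (Function.update ρ d i) (d + 1) j (d + 1) = j := by
  simp

theorem holds_bestF {x : ℕ} (hx : x < d) :
    Holds σ d ρ (bestF x) ↔ Best (σ 1) (σ 10) (σ.set 19) (ρ x) := by
  simp only [bestF, holds_all, holds_imp, holds_mem, holds_rel, holds_or, holds_eq,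
    update_lt hx, Function.update_self]
  rfl

theorem holds_worstF {x : ℕ} (hx : x < d) :
    Holds σ d ρ (worstF x) ↔ Worst (σ 1) (σ 11) (σ.set 19) (ρ x) := by
  simp only [worstF, holds_all, holds_imp, holds_mem, holds_rel, holds_or, holds_eq,
    update_lt hx, Function.update_self]
  rfl

theorem holds_proposeF {x : ℕ} (hx : x < d) :
    Holds σ d ρ (proposeF x) ↔ Propose (σ 1) (σ 10) (σ.set 19) (σ.set 18) (ρ x) := by
  simp only [proposeF, holds_and, holds_neg, holds_ex, holds_all, holds_imp, holds_mem, holds_rel,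
    holds_lt, holds_bestF hx, holds_bestF (Nat.lt_succ_self d), update_lt hx, Function.update_self]
  rfl

theorem holds_rejectF {x : ℕ} (hx : x < d) :
    Holds σ d ρ (rejectF x) ↔ Reject (σ 1) (σ 11) (σ.set 19) (σ.set 18) (ρ x) := by
  simp only [rejectF, holds_and, holds_neg, holds_ex, holds_all, holds_imp, holds_mem, holds_rel,
    holds_lt, holds_eq, holds_worstF hx, holds_worstF (Nat.lt_succ_self d), update_lt hx,
    update_lt (Nat.lt_succ_of_lt hx), update_lt (Nat.lt_succ_self d), Function.update_self]
  rfl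

theorem run_acceptRound :
    (acceptRound.run d ρ σ).set 18 = (fun v => (σ.set 18 v ∨
      Propose (σ 1) (σ 10) (σ.set 19) (σ.set 18) v) ∧
      ¬ Reject (σ 1) (σ 11) (σ.set 19) (fun v => σ.set 18 v ∨
        Propose (σ 1) (σ 10) (σ.set 19) (σ.set 18) v) v) ∧
    (acceptRound.run d ρ σ).set 19 = (fun v => σ.set 19 v ∧
      ¬ Reject (σ 1) (σ 11) (σ.set 19) (fun v => σ.set 18 v ∨
        Propose (σ 1) (σ 10) (σ.set 19) (σ.set 18) v) v) := by
  have h : d < d + 2 := by omega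
  simp only [acceptRound, LSt.run_seq, LSt.run_upd, holds_or, holds_and, holds_neg, holds_mem,
    holds_proposeF h, holds_rejectF h, update_pair]
  constructor <;> simp [State.set_update_self, State.set_update_ne] <;> rfl

/-- A round without rejection leads to a final state, any other round loses a survivor; so after `n`
rounds the state is final or there are no survivors, which is final as well. -/
theorem run_accept (hB : Bicolored (σ 1) (σ.set 17) (σ 10) (σ 11)) (hD : CliqueExtremes (σ 1)) :
    KernelOn (σ 1) (σ.set 17) ((accept.run d ρ σ).set 18) := by
  classical
  set D := σ 1 with hD'
  set X := σ 10 with hX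
  set Y := σ 11 with hY
  set R := σ.set 17 with hR
  let Done : (Fin n → Prop) → (Fin n → Prop) → Prop := fun S M =>
    (∀ v, S v → ∃ e, M e ∧ X v e) ∧ ∀ f, ¬ Reject D Y S M f
  have hempty : ∀ {S : Fin n → Prop}, {v | S v}.ncard + n ≤ n → ∀ v, ¬ S v := by
    intro S h v hv
    have : {v | S v} = ∅ := (Set.ncard_eq_zero (Set.toFinite _)).1 (by omega)
    exact Set.notMem_empty v (this ▸ hv)
  have key := LSt.run_up_induct (p := fun _ => acceptRound) (d := d) (ρ := ρ)
    (σ := LSt.run (.seq (.upd 19 fun x _ => mem 17 x) (.upd 18 fun x _ => neg (eq x x))) d ρ σ)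
    (fun i σ' => σ' 1 = D ∧ σ' 10 = X ∧ σ' 11 = Y ∧
      Deferred D X Y R (σ'.set 19) (σ'.set 18) ∧
      (Done (σ'.set 19) (σ'.set 18) ∨ {v | σ'.set 19 v}.ncard + i ≤ n)) ?_ ?_
  · obtain ⟨-, -, -, hdef, hdone⟩ := key
    refine hdef.kernelOn hB hD ?_ ?_ <;> rcases hdone with h | h
    · exact h.1
    · exact fun v hv => absurd hv (hempty h v)
    · exact h.2
    · exact fun v hv => absurd hv.1 (hempty h v)
  · have e19 : State.set (LSt.run (.seq (.upd 19 fun x _ => mem 17 x)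
        (.upd 18 fun x _ => neg (eq x x))) d ρ σ) 19 = R := by
      simp [LSt.run_seq, LSt.run_upd, State.set_update_self, State.set_update_ne, hR]
      rfl
    have e18 : State.set (LSt.run (.seq (.upd 19 fun x _ => mem 17 x)
        (.upd 18 fun x _ => neg (eq x x))) d ρ σ) 18 = fun _ => False := by
      simp [LSt.run_seq, LSt.run_upd, State.set_update_self]
    refine ⟨LSt.run_frame _ rfl, LSt.run_frame _ rfl, LSt.run_frame _ rfl, ?_, .inr ?_⟩
    · rw [e18, e19]
      exact Deferred.start R
    · exact (Set.ncard_le_ncard (Set.subset_univ _)).trans (by simp)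
  · rintro i hi σ' ⟨h1, h10, h11, hdef, hdone⟩
    obtain ⟨e18, e19⟩ := run_acceptRound (σ := σ') (d := d + 1) (ρ := Function.update ρ d ⟨i, hi⟩)
    rw [h1, h10, h11] at e18 e19
    refine ⟨(LSt.run_frame _ rfl).trans h1, (LSt.run_frame _ rfl).trans h10,
      (LSt.run_frame _ rfl).trans h11, ?_, ?_⟩
    · rw [e18, e19]
      exact (hdef.propose hB).reject hB
    · rw [e18, e19]
      set S := σ'.set 19
      set M := σ'.set 18
      by_cases hrej : ∃ f, Reject D Y S (fun v => M v ∨ Propose D X S M v) f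
      · right
        obtain ⟨f, hf⟩ := hrej
        have hlt : {v | S v ∧ ¬ Reject D Y S (fun v => M v ∨ Propose D X S M v) v}.ncard <
            {v | S v}.ncard :=
          Set.ncard_lt_ncard ⟨fun v hv => hv.1, fun hsub => (hsub hf.1).2 hf⟩ (Set.toFinite _)
        rcases hdone with hdone | hcard
        -- In a final state every class already has its proposal, so nothing new is proposed and
        -- nothing is rejected.
        · exfalso
          have hM : (fun v => M v ∨ Propose D X S M v) = M := by
            funext v
            refine propext (or_iff_left fun hp => hp.2.1 ?_)
            exact hdone.1 v hp.1
          rw [hM] at hf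
          exact hdone.2 f hf
        · have : {v | S v ∧ ¬ Reject D Y S (fun v => M v ∨ Propose D X S M v) v}.ncard + (i + 1) ≤
            n := by omega
          exact this
      · left
        push Not at hrej
        have hS : (fun v => S v ∧ ¬ Reject D Y S (fun v => M v ∨ Propose D X S M v) v) = S := by
          funext v; exact propext (and_iff_left (hrej v))
        have hM : (fun v => (M v ∨ Propose D X S M v) ∧
            ¬ Reject D Y S (fun v => M v ∨ Propose D X S M v) v) =
            fun v => M v ∨ Propose D X S M v := by
          funext v; exact propext (and_iff_left (hrej v))
        rw [hS, hM]
        exact ⟨fun v hv => hdef.covered hB hD v hv, hrej⟩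

end Acceptance

end KernelDE

namespace KernelDE

/-! ### Gluing along clique separators -/

section Glue

variable {V : Type*}

/-- A part `A` of `S` that is separated from the rest by the clique `C`, with a coloring. -/
structure Leaf (D : V → V → Prop) (S A C : V → Prop) (X Y : V → V → Prop) : Prop where
  subA : ∀ v, A v → S v
  subC : ∀ v, C v → S v
  disj : ∀ v, A v → ¬ C v
  nonempty : ∃ v, A v
  closed : ∀ u v, A u → S v → Near D u v → A v ∨ C v
  clique : ∀ u v, C u → C v → Near D u v
  colored : Bicolored D (fun v => A v ∨ C v) X Y

/-- The kernel `K` of the rest extended by the recorded kernels: those of the candidate `c` in `K`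
are given by `KK c`, and `KN` is used if there is none. -/
def Extend (A Cs : V → Prop) (KK : V → V → Prop) (KN K : V → Prop) (v : V) : Prop :=
  K v ∨ A v ∧ ((∃ c, K c ∧ Cs c ∧ KK c v) ∨ (¬ ∃ c, K c ∧ Cs c) ∧ KN v)

variable {D : V → V → Prop} {S A C R Cs KN : V → Prop} {X Y KK : V → V → Prop}

/-- The candidates `Cs` found so far, with kernels that contain them, and the set `R` of the
remaining vertices of the leaf. -/
structure Solved (D : V → V → Prop) (A C R Cs : V → Prop) (KK : V → V → Prop) : Prop where
  rest : ∀ v, R v ↔ A v ∨ C v ∧ ¬ Cs v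
  sub : ∀ v, Cs v → C v
  kernel : ∀ c, Cs c → ∃ Rc M : V → Prop, (∀ v, A v → Rc v) ∧ (∀ v, Rc v → A v ∨ C v) ∧
    (∀ v, C v → ¬ Cs v → Rc v) ∧ KernelOn D Rc M ∧ M c ∧ ∀ v, A v → (KK c v ↔ M v)

/-- A member of `K` with a neighbor in `A` must be a candidate. If `K` contains the candidate `c`,
its recorded kernel `N` meets the clique `C` in `c` only, and it absorbs all of `R` outside it,
because its domain contained `A` and every vertex of `C` that never became a candidate. If `K`
contains no candidate, nothing in `K` is adjacent to `A`, and `M`, which lies in `A`, absorbs `R`.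
-/
theorem Solved.extend (hL : Leaf D S A C X Y) (h : Solved D A C R Cs KK) {M : V → Prop}
    (hM : KernelOn D R M) (hMC : ∀ v, M v → ¬ C v) (hKN : ∀ v, A v → (KN v ↔ M v)) {K : V → Prop}
    (hK : KernelOn D (fun v => S v ∧ ¬ R v) K) : KernelOn D S (Extend A Cs KK KN K) := by
  have hAR : ∀ v, A v → R v := fun v hv => (h.rest v).2 (.inl hv)
  have inC : ∀ u v, K u → A v → Near D u v → Cs u := by
    intro u v hu hv huv
    have hSu := hK.1 u hu
    have hAu : ¬ A u := fun h' => hSu.2 (hAR u h')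
    have hCu := (hL.closed v u hv hSu.1 huv.symm).resolve_left hAu
    by_contra hCs
    exact hSu.2 ((h.rest u).2 (.inr ⟨hCu, hCs⟩))
  by_cases hc : ∃ c, K c ∧ Cs c
  · obtain ⟨c, hKc, hCc⟩ := hc
    have uniq : ∀ u, K u → C u → u = c := fun u hu hCu =>
      hK.2.1 u c hu hKc (hL.clique u c hCu (h.sub c hCc))
    obtain ⟨Rc, N, hA, hsub, hCR, hN, hNc, hKKc⟩ := h.kernel c hCc
    have ext : ∀ v, Extend A Cs KK KN K v ↔ K v ∨ A v ∧ N v := by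
      intro v
      refine or_congr_right (and_congr_right fun hv => ⟨?_, fun hNv => ?_⟩)
      · rintro (⟨c', h1, h2, h3⟩ | ⟨h1, -⟩)
        · rw [uniq c' h1 (h.sub _ h2)] at h3
          exact (hKKc v hv).1 h3
        · exact absurd ⟨c, hKc, hCc⟩ h1
      · exact .inl ⟨c, hKc, hCc, (hKKc v hv).2 hNv⟩
    have cross : ∀ u v, K u → A v → N v → ¬ Near D u v := by
      intro u v hu hv hNv huv
      have := uniq u hu (h.sub u (inC u v hu hv huv))
      subst this
      have := hN.2.1 u v hNc hNv huv
      subst this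
      exact hL.disj _ hv (h.sub _ hCc)
    refine ⟨fun v hv => ?_, fun u v hu hv huv => ?_, fun u hu hnu => ?_⟩
    · exact ((ext v).1 hv).elim (fun h' => (hK.1 v h').1) fun h' => hL.subA v h'.1
    · rcases (ext u).1 hu with hu | hu <;> rcases (ext v).1 hv with hv | hv
      · exact hK.2.1 u v hu hv huv
      · exact absurd huv (cross u v hu hv.1 hv.2)
      · exact absurd huv.symm (cross v u hv hu.1 hu.2)
      · exact hN.2.1 u v hu.2 hv.2 huv
    · have hKu : ¬ K u := fun h' => hnu (.inl h')
      by_cases hR : R u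
      · have hRc : Rc u := by
          rcases (h.rest u).1 hR with h' | h'
          · exact hA u h'
          · exact hCR u h'.1 h'.2
        have hNu : ¬ N u := by
          intro hNu
          rcases hsub u hRc with h' | h'
          · exact hnu ((ext u).2 (.inr ⟨h', hNu⟩))
          · exact hKu (hN.2.1 u c hNu hNc (hL.clique u c h' (h.sub c hCc)) ▸ hKc)
        obtain ⟨v, hv, huv⟩ := hN.2.2 u hRc hNu
        refine ⟨v, (ext v).2 ?_, huv⟩
        rcases hsub v (hN.1 v hv) with h' | h'
        · exact .inr ⟨h', hv⟩
        · exact .inl (hN.2.1 v c hv hNc (hL.clique v c h' (h.sub c hCc)) ▸ hKc)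
      · obtain ⟨v, hv, huv⟩ := hK.2.2 u ⟨hu, hR⟩ hKu
        exact ⟨v, .inl hv, huv⟩
  · have ext : ∀ v, Extend A Cs KK KN K v ↔ K v ∨ A v ∧ M v := by
      intro v
      refine or_congr_right (and_congr_right fun hv => ⟨?_, fun hMv => ?_⟩)
      · rintro (⟨c', h1, h2, h3⟩ | ⟨-, h1⟩)
        · exact absurd ⟨c', h1, h2⟩ hc
        · exact (hKN v hv).1 h1
      · exact .inr ⟨hc, (hKN v hv).2 hMv⟩
    have cross : ∀ u v, K u → A v → ¬ Near D u v := fun u v hu hv huv =>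
      hc ⟨u, hu, inC u v hu hv huv⟩
    refine ⟨fun v hv => ?_, fun u v hu hv huv => ?_, fun u hu hnu => ?_⟩
    · exact ((ext v).1 hv).elim (fun h' => (hK.1 v h').1) fun h' => hL.subA v h'.1
    · rcases (ext u).1 hu with hu | hu <;> rcases (ext v).1 hv with hv | hv
      · exact hK.2.1 u v hu hv huv
      · exact absurd huv (cross u v hu hv.1)
      · exact absurd huv.symm (cross v u hv hu.1)
      · exact hM.2.1 u v hu.2 hv.2 huv
    · have hKu : ¬ K u := fun h' => hnu (.inl h')
      by_cases hR : R u
      · have inA : ∀ v, M v → A v := fun v hv =>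
          ((h.rest v).1 (hM.1 v hv)).resolve_right fun h' => hMC v hv h'.1
        have hMu : ¬ M u := fun hMu => hnu ((ext u).2 (.inr ⟨inA u hMu, hMu⟩))
        obtain ⟨v, hv, huv⟩ := hM.2.2 u hR hMu
        exact ⟨v, (ext v).2 (.inr ⟨inA v hv, hv⟩), huv⟩
      · obtain ⟨v, hv, huv⟩ := hK.2.2 u ⟨hu, hR⟩ hKu
        exact ⟨v, .inl hv, huv⟩

theorem Solved.start : Solved D A C (fun v => A v ∨ C v) (fun _ => False) KK :=
  ⟨fun v => by simp, fun _ h => h.elim, fun _ h => h.elim⟩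

/-- A new candidate was not a candidate before, since it came from `R`. By `hfresh` its row of `KK`
is therefore still empty on `A`, and the trace of `M` can be recorded there. -/
theorem Solved.step (hL : Leaf D S A C X Y) (h : Solved D A C R Cs KK) {M : V → Prop}
    (hM : KernelOn D R M)
    (hfresh : ∀ c v, A v → KK c v → Cs c) :
    Solved D A C (fun v => R v ∧ ¬ (M v ∧ C v)) (fun v => Cs v ∨ M v ∧ C v)
      (fun c v => KK c v ∨ (M c ∧ C c) ∧ M v ∧ A v) where
  rest v := by
    rw [h.rest]
    have := hL.disj v
    tauto
  sub v hv := hv.elim (h.sub v) fun hv => hv.2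
  kernel c hc := by
    by_cases hCs : Cs c
    · obtain ⟨Rc, N, hA, hsub, hCR, hN, hNc, hKKc⟩ := h.kernel c hCs
      refine ⟨Rc, N, hA, hsub, fun v h1 h2 => hCR v h1 fun h3 => h2 (.inl h3), hN, hNc,
        fun v hv => ?_⟩
      rw [← hKKc v hv]
      refine or_iff_left fun hc' => ?_
      exact ((h.rest c).1 (hM.1 c hc'.1.1)).elim (fun h' => hL.disj c h' (h.sub c hCs))
        fun h' => h'.2 hCs
    · have hMc := hc.resolve_left hCs
      refine ⟨R, M, fun v hv => (h.rest v).2 (.inl hv), fun v hv => ((h.rest v).1 hv).imp id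
        fun h' => h'.1, fun v h1 h2 => (h.rest v).2 (.inr ⟨h1, fun h3 => h2 (.inl h3)⟩), hM,
        hMc.1, fun v hv => ⟨?_, fun hMv => .inr ⟨hMc, hMv, hv⟩⟩⟩
      rintro (h' | h')
      · exact absurd (hfresh c v hv h') hCs
      · exact h'.2.1

end Glue

/-! ### The treatment of a leaf as a program -/

section SolveLeaf

open LFm

/-- One round for a leaf: a kernel of the remaining vertices is computed and recorded at stage
`j`, and its member in the boundary becomes a candidate. -/
def solveRound (j : ℕ) : LSt :=
  .seq accept (.seq (.upd 4 fun x y => or (rel 4 x y) (and (eq x j) (and (mem 18 y) (mem 9 y))))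
    (.seq (.upd 5 fun x y =>
        or (rel 5 x y) (and (and (mem 18 x) (mem 9 x)) (and (mem 18 y) (mem 8 y))))
      (.seq (.upd 17 fun x _ => and (mem 17 x) (neg (and (mem 18 x) (mem 9 x))))
        (.upd 22 fun _ _ => ex fun m => and (mem 18 m) (mem 9 m)))))

/-- Initialization for a leaf. -/
def solveInit : LSt :=
  .seq (.upd 17 fun x _ => or (mem 8 x) (mem 9 x)) (.upd 22 fun x _ => eq x x)

/-- Rounds are performed as long as candidates are found. -/
def solveLoop (j : ℕ) : LSt :=
  .up fun _ => .when (ex fun x => mem 22 x) (solveRound j)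

/-- The last kernel is recorded, and the treated vertices are removed. -/
def solveEnd (j : ℕ) : LSt :=
  .seq (.upd 6 fun x _ => or (mem 6 x) (and (mem 18 x) (mem 8 x)))
    (.seq (.upd 3 fun x y => or (rel 3 x y) (and (eq x j) (mem 8 y)))
      (.upd 2 fun x _ => and (mem 2 x) (neg (mem 17 x))))

/-- The treatment of a leaf at stage `j`. -/
def solveLeaf (j : ℕ) : LSt := .seq solveInit (.seq (solveLoop j) (solveEnd j))

variable {n : ℕ} {σ : State n} {d : ℕ} {ρ : ℕ → Fin n}

theorem run_solveRound {j : ℕ} (hj : j < d)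
    (hB : Bicolored (σ 1) (σ.set 17) (σ 10) (σ 11)) (hD : CliqueExtremes (σ 1)) :
    ∃ M, KernelOn (σ 1) (σ.set 17) M ∧ ((solveRound j).run d ρ σ).set 18 = M ∧
      ((solveRound j).run d ρ σ) 4 = (fun x y => σ 4 x y ∨ x = ρ j ∧ M y ∧ σ.set 9 y) ∧
      ((solveRound j).run d ρ σ) 5 = (fun x y => σ 5 x y ∨ (M x ∧ σ.set 9 x) ∧ M y ∧ σ.set 8 y) ∧
      ((solveRound j).run d ρ σ).set 17 = (fun v => σ.set 17 v ∧ ¬ (M v ∧ σ.set 9 v)) ∧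
      ((solveRound j).run d ρ σ).set 22 = (fun _ => ∃ m, M m ∧ σ.set 9 m) := by
  refine ⟨_, run_accept (d := d) (ρ := ρ) hB hD, ?_⟩
  have h4 : accept.run d ρ σ 4 = σ 4 := LSt.run_frame _ rfl
  have h5 : accept.run d ρ σ 5 = σ 5 := LSt.run_frame _ rfl
  have h8 : (accept.run d ρ σ).set 8 = σ.set 8 := State.set_congr (LSt.run_frame _ rfl)
  have h9 : (accept.run d ρ σ).set 9 = σ.set 9 := State.set_congr (LSt.run_frame _ rfl)
  have h17 : (accept.run d ρ σ).set 17 = σ.set 17 := State.set_congr (LSt.run_frame _ rfl)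
  have hj' : j ≠ d + 1 := by omega
  simp only [solveRound, LSt.run_seq]
  rw [← h4, ← h5, ← h8, ← h9, ← h17]
  generalize accept.run d ρ σ = τ
  simp only [LSt.run_upd, holds_or, holds_and, holds_neg, holds_mem, holds_rel, holds_ex, holds_eq,
    Function.update_of_ne hj.ne, Function.update_of_ne hj', update_pair]
  refine ⟨?_, ?_, ?_, ?_, ?_⟩ <;>
    simp [State.set_update_self, State.set_update_ne, Function.update_of_ne] <;> rfl

theorem run_solveInit :
    (solveInit.run d ρ σ).set 17 = (fun v => σ.set 8 v ∨ σ.set 9 v) ∧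
      (solveInit.run d ρ σ).set 22 = fun _ => True := by
  simp only [solveInit, LSt.run_seq, LSt.run_upd, holds_or, holds_mem, holds_eq, update_pair]
  constructor <;> simp [State.set_update_self, State.set_update_ne]
  rfl

theorem run_solveEnd {j : ℕ} (hj : j < d) :
    ((solveEnd j).run d ρ σ).set 6 = (fun v => σ.set 6 v ∨ σ.set 18 v ∧ σ.set 8 v) ∧
      (solveEnd j).run d ρ σ 3 = (fun x y => σ 3 x y ∨ x = ρ j ∧ σ.set 8 y) ∧
      ((solveEnd j).run d ρ σ).set 2 = fun v => σ.set 2 v ∧ ¬ σ.set 17 v := by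
  have hj' : j ≠ d + 1 := by omega
  simp only [solveEnd, LSt.run_seq, LSt.run_upd, holds_or, holds_and, holds_neg, holds_mem,
    holds_rel, holds_eq, update_pair, Function.update_of_ne hj.ne, Function.update_of_ne hj']
  refine ⟨?_, ?_, ?_⟩ <;>
    simp [State.set_update_self, State.set_update_ne, Function.update_of_ne] <;> rfl

/-- The invariant of the rounds for a leaf. -/
structure RoundInv (σ τ : State n) (j : Fin n) (i : ℕ) : Prop where
  arcs : τ 1 = σ 1
  colX : τ 10 = σ 10
  colY : τ 11 = σ 11
  inner : τ.set 8 = σ.set 8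
  bdry : τ.set 9 = σ.set 9
  solved : Solved (σ 1) (σ.set 8) (σ.set 9) (τ.set 17) (τ 4 j) (τ 5)
  fresh : ∀ c v, σ.set 8 v → τ 5 c v → τ 4 j c
  old₄ : ∀ x, x ≠ j → τ 4 x = σ 4 x
  old₅ : ∀ c v, ¬ σ.set 8 v → (τ 5 c v ↔ σ 5 c v)
  -- Each active round removes a boundary vertex. The strict inequality leaves room for the last
  -- round, which finds a kernel avoiding the boundary; for `i = n` the first alternative is
  -- impossible.
  status : ((∃ v, τ.set 22 v) ∧ {v | σ.set 9 v ∧ τ.set 17 v}.ncard + i < n) ∨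
    ((¬ ∃ v, τ.set 22 v) ∧ KernelOn (σ 1) (τ.set 17) (τ.set 18) ∧ ∀ v, τ.set 18 v → ¬ σ.set 9 v)

theorem run_solveLoop {j : ℕ} (hj : j < d) (hD : CliqueExtremes (σ 1))
    (hL : Leaf (σ 1) (σ.set 2) (σ.set 8) (σ.set 9) (σ 10) (σ 11)) {τ : State n}
    (h : RoundInv σ τ (ρ j) 0) : RoundInv σ ((solveLoop j).run d ρ τ) (ρ j) n := by
  refine LSt.run_up_induct (fun i τ => RoundInv σ τ (ρ j) i) h fun i hi τ h => ?_
  have hρ : Function.update ρ d ⟨i, hi⟩ j = ρ j := update_lt hj _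
  by_cases hact : ∃ v, τ.set 22 v
  swap
  · rw [LSt.run_when_neg]
    · exact { h with status := .inr (h.status.resolve_left fun h' => hact h'.1) }
    · rw [holds_ex]
      rintro ⟨v, hv⟩
      exact hact ⟨v, by simpa [State.set] using hv⟩
  rw [LSt.run_when_pos]
  swap
  · rw [holds_ex]
    obtain ⟨v, hv⟩ := hact
    exact ⟨v, by simpa [State.set] using hv⟩
  have hcard := (h.status.resolve_right fun h' => h'.1 hact).2
  have hB : Bicolored (τ 1) (τ.set 17) (τ 10) (τ 11) := by
    rw [h.arcs, h.colX, h.colY]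
    exact hL.colored.mono fun v hv => ((h.solved.rest v).1 hv).imp id fun h' => h'.1
  obtain ⟨M, hM, e18, e4, e5, e17, e22⟩ := run_solveRound (σ := τ) (d := d + 1)
    (ρ := Function.update ρ d ⟨i, hi⟩) (j := j) (by omega) hB (by rw [h.arcs]; exact hD)
  rw [h.arcs] at hM
  rw [hρ, h.bdry] at e4
  rw [h.bdry, h.inner] at e5
  rw [h.bdry] at e17 e22
  set τ' := (solveRound j).run (d + 1) (Function.update ρ d ⟨i, hi⟩) τ with hτ'
  have hs := h.solved.step hL hM h.fresh
  have e4j : τ' 4 (ρ j) = fun v => τ 4 (ρ j) v ∨ M v ∧ σ.set 9 v := by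
    rw [e4]; simp
  refine ⟨(LSt.run_frame _ rfl).trans h.arcs, (LSt.run_frame _ rfl).trans h.colX,
    (LSt.run_frame _ rfl).trans h.colY, (State.set_congr (LSt.run_frame _ rfl)).trans h.inner,
    (State.set_congr (LSt.run_frame _ rfl)).trans h.bdry, ?_, ?_, ?_, ?_, ?_⟩
  · rw [e17, e4j, e5]
    exact hs
  · intro c v hv hc
    rw [e5] at hc
    rw [e4j]
    exact hc.imp (h.fresh c v hv) fun h' => h'.1
  · intro x hx
    rw [e4, ← h.old₄ x hx]
    simp [hx]
  · intro c v hv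
    rw [e5, ← h.old₅ c v hv]
    simp [hv]
  · rw [e22, e17, e18]
    by_cases hc : ∃ m, M m ∧ σ.set 9 m
    · refine .inl ⟨⟨ρ j, hc⟩, ?_⟩
      obtain ⟨c, hMc, hCc⟩ := hc
      have : {v | σ.set 9 v ∧ τ.set 17 v ∧ ¬ (M v ∧ σ.set 9 v)}.ncard <
          {v | σ.set 9 v ∧ τ.set 17 v}.ncard :=
        Set.ncard_lt_ncard ⟨fun v hv => ⟨hv.1, hv.2.1⟩,
          fun hsub => (hsub ⟨hCc, hM.1 c hMc⟩ : _ ∧ _ ∧ ¬ _).2.2 ⟨hMc, hCc⟩⟩ (Set.toFinite _)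
      exact lt_of_lt_of_le (Nat.add_lt_add_right this _) (by omega)
    · refine .inr ⟨fun ⟨_, h'⟩ => hc h', ?_, fun v hv hCv => hc ⟨v, hv, hCv⟩⟩
      have : (fun v => τ.set 17 v ∧ ¬ (M v ∧ σ.set 9 v)) = τ.set 17 := by
        funext v
        exact propext (and_iff_left fun h' => hc ⟨v, h'⟩)
      rw [this]
      exact hM

/-- Relation `5` is indexed by candidates, not stages, and one vertex may be a candidate at several
stages. The entries do not collide because they lie in the columns of the private part, which are
empty at the start; the same holds for relation `6`. -/
theorem run_solveLeaf {j : ℕ} (hj : j < d) (hD : CliqueExtremes (σ 1))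
    (hL : Leaf (σ 1) (σ.set 2) (σ.set 8) (σ.set 9) (σ 10) (σ 11)) (h4 : ∀ v, ¬ σ 4 (ρ j) v)
    (h3 : ∀ v, ¬ σ 3 (ρ j) v) (h5 : ∀ c v, σ.set 8 v → ¬ σ 5 c v)
    (h6 : ∀ v, σ.set 8 v → ¬ σ.set 6 v) {σ' : State n} (hσ' : σ' = (solveLeaf j).run d ρ σ) :
    (∀ x y, σ' 3 x y ↔ σ 3 x y ∨ x = ρ j ∧ σ.set 8 y) ∧
    (∀ x, x ≠ ρ j → σ' 4 x = σ 4 x) ∧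
    (∀ c v, ¬ σ.set 8 v → (σ' 5 c v ↔ σ 5 c v)) ∧
    (∀ v, ¬ σ.set 8 v → (σ'.set 6 v ↔ σ.set 6 v)) ∧
    (∀ v, σ'.set 2 v → σ.set 2 v ∧ ¬ σ.set 8 v) ∧
    ∀ K, KernelOn (σ 1) (σ'.set 2) K →
      KernelOn (σ 1) (σ.set 2) (Extend (σ' 3 (ρ j)) (σ' 4 (ρ j)) (σ' 5) (σ'.set 6) K) := by
  -- The nonempty private part is disjoint from the boundary.
  have hcard : {v | σ.set 9 v}.ncard < n := by
    obtain ⟨a, ha⟩ := hL.nonempty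
    have : {v | σ.set 9 v} ⊂ Set.univ :=
      ⟨Set.subset_univ _, fun h => hL.disj a ha (h (Set.mem_univ a))⟩
    simpa using Set.ncard_lt_ncard this (Set.toFinite _)
  obtain ⟨e17, e22⟩ := run_solveInit (σ := σ) (d := d) (ρ := ρ)
  have h0 : RoundInv σ (solveInit.run d ρ σ) (ρ j) 0 := by
    refine ⟨LSt.run_frame _ rfl, LSt.run_frame _ rfl, LSt.run_frame _ rfl,
      State.set_congr (LSt.run_frame _ rfl), State.set_congr (LSt.run_frame _ rfl), ?_, ?_, ?_, ?_,
      .inl ⟨?_, ?_⟩⟩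
    · have e4 : solveInit.run d ρ σ 4 (ρ j) = fun _ => False := by
        rw [LSt.run_frame _ rfl]
        funext v
        simpa using h4 v
      rw [e17, e4]
      exact Solved.start
    · intro c v hv h
      rw [LSt.run_frame _ rfl] at h
      exact absurd h (h5 c v hv)
    · intro x _
      rw [LSt.run_frame _ rfl]
    · intro c v _
      rw [LSt.run_frame _ rfl]
    · rw [e22]; exact ⟨ρ j, trivial⟩
    · exact lt_of_le_of_lt (Set.ncard_le_ncard (fun v hv => hv.1) (Set.toFinite _)) hcard
  have h1 := run_solveLoop hj hD hL h0
  have f2 : ((solveLoop j).run d ρ (solveInit.run d ρ σ)).set 2 = σ.set 2 :=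
    State.set_congr ((LSt.run_frame _ rfl).trans (LSt.run_frame _ rfl))
  have f3 : (solveLoop j).run d ρ (solveInit.run d ρ σ) 3 = σ 3 :=
    (LSt.run_frame _ rfl).trans (LSt.run_frame _ rfl)
  have f6 : ((solveLoop j).run d ρ (solveInit.run d ρ σ)).set 6 = σ.set 6 :=
    State.set_congr ((LSt.run_frame _ rfl).trans (LSt.run_frame _ rfl))
  have hσ₁ : σ' = (solveEnd j).run d ρ ((solveLoop j).run d ρ (solveInit.run d ρ σ)) := hσ'
  generalize (solveLoop j).run d ρ (solveInit.run d ρ σ) = τ at *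
  obtain ⟨e6, e3, e2⟩ := run_solveEnd (σ := τ) (ρ := ρ) hj
  rw [← hσ₁] at e6 e3 e2
  have e4 : σ' 4 = τ 4 := by rw [hσ₁]; exact LSt.run_frame _ rfl
  have e5 : σ' 5 = τ 5 := by rw [hσ₁]; exact LSt.run_frame _ rfl
  rw [h1.inner] at e6 e3
  rw [f3] at e3
  rw [f2] at e2
  rw [f6] at e6
  have e3j : σ' 3 (ρ j) = σ.set 8 := by
    rw [e3]; funext v; simp [h3 v]
  rcases h1.status with ⟨_, h⟩ | ⟨_, hK, hKC⟩
  · omega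
  refine ⟨fun x y => by rw [e3], fun x hx => by rw [e4]; exact h1.old₄ x hx,
    fun c v hv => by rw [e5]; exact h1.old₅ c v hv, fun v hv => by rw [e6]; simp [hv],
    fun v hv => ?_, fun K hK' => ?_⟩
  · rw [e2] at hv
    exact ⟨hv.1, fun hA => hv.2 ((h1.solved.rest v).2 (.inl hA))⟩
  · rw [e3j, e4, e5, e6]
    rw [e2] at hK'
    refine h1.solved.extend hL hK hKC (fun v hv => ?_) hK'
    simp [hv, h6 v hv]

end SolveLeaf

end KernelDE

namespace KernelDE

/-! ### Search for a leaf -/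

section Search

variable {V : Type*}

/-- `A` is the component of `p` in the subgraph induced by `S`, without the vertices of `Q` other
than `p`. -/
structure IsComponent (D : V → V → Prop) (S Q : V → Prop) (p : V) (A : V → Prop) : Prop where
  start : A p
  closed : ∀ u v, A u → S v → ¬ Q v → Near D u v → A v
  least : ∀ T : V → Prop, T p → (∀ u v, T u → S v → ¬ Q v → Near D u v → T v) → ∀ v, A v → T v

/-- The neighbors of `A` in `S`. -/
def Boundary (D : V → V → Prop) (S A : V → Prop) (v : V) : Prop :=
  S v ∧ ¬ A v ∧ ∃ u, A u ∧ Near D u v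

/-- Two adjacent vertices of `H` whose common neighborhood is a clique. -/
def GoodPair (D : V → V → Prop) (H : V → Prop) (a b : V) : Prop :=
  H a ∧ H b ∧ Near D a b ∧
    ∀ s, ∀ t, H s → H t → Near D a s → Near D b s → Near D a t → Near D b t → Near D s t

/-- The pairs that get the color `P` in one step from the pairs of colors `P` and `P'`. -/
def Derive (D : V → V → Prop) (G P P' : V → V → Prop) (a c : V) : Prop :=
  P c a ∨ G a c ∧ ∃ b, P a b ∧ Near D b c ∨ P' a b ∧ ¬ Near D b c

/-- The coloring of pairs generated by the pair `(p, e)`. -/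
structure IsColoring (D : V → V → Prop) (G : V → V → Prop) (p e : V) (P₀ P₁ : V → V → Prop) :
    Prop where
  start : G p e → P₀ p e
  closed₀ : ∀ a c, Derive D G P₀ P₁ a c → P₀ a c
  closed₁ : ∀ a c, Derive D G P₁ P₀ a c → P₁ a c
  least : ∀ T₀ T₁ : V → V → Prop, (G p e → T₀ p e) → (∀ a c, Derive D G T₀ T₁ a c → T₀ a c) →
    (∀ a c, Derive D G T₁ T₀ a c → T₁ a c) → (∀ a c, P₀ a c → T₀ a c) ∧ ∀ a c, P₁ a c → T₁ a c

/-- Two vertices of `H` are equal or belong to the common neighborhood of a colored pair. -/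
def SameClass (D : V → V → Prop) (H : V → Prop) (P : V → V → Prop) (u v : V) : Prop :=
  H u ∧ H v ∧ (u = v ∨ ∃ a, ∃ b, P a b ∧ Near D a u ∧ Near D b u ∧ Near D a v ∧ Near D b v)

/-- Adjacency in `H` means that one of two labels agrees. -/
def Labeled {L : Type*} (D : V → V → Prop) (H : V → Prop) (x y : V → L) : Prop :=
  ∀ u v, H u → H v → (Near D u v ↔ x u = x v ∨ y u = y v)

variable {L : Type*} {D : V → V → Prop} {S A C H : V → Prop} {x y : V → L}

theorem Labeled.swap (h : Labeled D H x y) : Labeled D H y x :=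
  fun u v hu hv => (h u v hu hv).trans or_comm

theorem Labeled.mono (h : Labeled D H x y) {H' : V → Prop} (hH : ∀ v, H' v → H v) :
    Labeled D H' x y := fun u v hu hv => h u v (hH u hu) (hH v hv)

/-- A common neighbor with another `x`-label would have to agree with both `a` and `b` in `y`. -/
theorem Labeled.goodPair (h : Labeled D H x y) {a b : V} (ha : H a) (hb : H b) (hx : x a = x b)
    (hy : y a ≠ y b) : GoodPair D H a b ∧
      ∀ z, H z → (Near D a z ∧ Near D b z ↔ x z = x a) := by
  have key : ∀ z, H z → (Near D a z ∧ Near D b z ↔ x z = x a) := by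
    intro z hz
    rw [h a z ha hz, h b z hb hz, ← hx]
    constructor
    · rintro ⟨h1 | h1, h2 | h2⟩
      · exact h1.symm
      · exact h1.symm
      · exact h2.symm
      · exact absurd (h1.trans h2.symm) hy
    · intro h'
      exact ⟨.inl h'.symm, .inl h'.symm⟩
  refine ⟨⟨ha, hb, (h a b ha hb).2 (.inl hx), fun s t hs ht h1 h2 h3 h4 => ?_⟩, key⟩
  exact (h s t hs ht).2 (.inl (((key s hs).1 ⟨h1, h2⟩).trans ((key t ht).1 ⟨h3, h4⟩).symm))

/-- The common neighborhood of a good pair is a class of one of the labels. -/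
theorem Labeled.class_of_goodPair (h : Labeled D H x y) {a b : V} (hG : GoodPair D H a b) :
    (∀ z, H z → (Near D a z ∧ Near D b z ↔ x z = x a)) ∨
      ∀ z, H z → (Near D a z ∧ Near D b z ↔ y z = y a) := by
  obtain ⟨ha, hb, hab, hcl⟩ := hG
  by_cases hx : x a = x b
  · by_cases hy : y a = y b
    · have key : ∀ z, H z → (Near D a z ∧ Near D b z ↔ x z = x a ∨ y z = y a) := by
        intro z hz
        rw [h a z ha hz, h b z hb hz, ← hx, ← hy]
        constructor
        · rintro ⟨h1, _⟩
          exact h1.imp Eq.symm Eq.symm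
        · intro h'
          exact ⟨h'.imp Eq.symm Eq.symm, h'.imp Eq.symm Eq.symm⟩
      -- Here the common neighborhood is the union of an `x`-class and a `y`-class. As it is a
      -- clique, one of the two contains the other.
      by_cases hex : ∃ z, H z ∧ y z = y a ∧ x z ≠ x a
      · obtain ⟨z, hz, hyz, hxz⟩ := hex
        right
        intro w hw
        rw [key w hw]
        refine ⟨fun h' => h'.elim (fun hxw => ?_) id, .inr⟩
        have n1 := (key z hz).2 (.inr hyz)
        have n2 := (key w hw).2 (.inl hxw)
        rcases (h z w hz hw).1 (hcl z w hz hw n1.1 n1.2 n2.1 n2.2) with h1 | h1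
        · exact absurd (h1.trans hxw) hxz
        · exact h1.symm.trans hyz
      · left
        intro w hw
        rw [key w hw]
        refine ⟨fun h' => h'.elim id fun hyw => ?_, .inl⟩
        by_contra hxw
        exact hex ⟨w, hw, hyw, hxw⟩
    · exact .inl (h.goodPair ha hb hx hy).2
  · have hy := ((h a b ha hb).1 hab).resolve_left hx
    exact .inr (h.swap.goodPair ha hb hy hx).2

theorem Near.symm_iff {u v : V} : Near D u v ↔ Near D v u := ⟨Near.symm, Near.symm⟩

theorem GoodPair.symm {a b : V} (h : GoodPair D H a b) : GoodPair D H b a :=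
  ⟨h.2.1, h.1, h.2.2.1.symm, fun s t hs ht h1 h2 h3 h4 => h.2.2.2 s t hs ht h2 h1 h4 h3⟩

/-- Pairs whose common neighborhood is a class of the label `x`. -/
def LabelPair (D : V → V → Prop) (H : V → Prop) (x : V → L) (a b : V) : Prop :=
  GoodPair D H a b ∧ ∀ z, H z → (Near D a z ∧ Near D b z ↔ x z = x a)

theorem LabelPair.label_eq {a b : V} (h : LabelPair D H x a b) : x b = x a :=
  (h.2 b h.1.2.1).1 ⟨h.1.2.2.1, Near.rfl⟩

/-- For good pairs `(a, b)` and `(a, c)`: if `b` and `c` are near, both common neighborhoods are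
cliques containing `a`, `b`, `c`, and they coincide. If not, `c` is outside the class of `(a, b)`,
so `(a, c)` belongs to the other label. -/
theorem LabelPair.derive (h : Labeled D H x y) (a c : V)
    (hd : Derive D (GoodPair D H) (LabelPair D H x) (LabelPair D H y) a c) :
    LabelPair D H x a c := by
  rcases hd with hd | ⟨hG, b, ⟨hP, hN⟩ | ⟨hP, hN⟩⟩
  · refine ⟨hd.1.symm, fun z hz => ?_⟩
    rw [and_comm, hd.2 z hz, hd.label_eq]
  · rcases h.class_of_goodPair hG with hc | hc
    · exact ⟨hG, hc⟩
    · refine ⟨hG, fun z hz => ?_⟩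
      rw [← hP.2 z hz]
      have hcP : Near D a c ∧ Near D b c := ⟨hG.2.2.1, hN⟩
      refine ⟨fun hz' => ⟨hz'.1, ?_⟩, fun hz' => ⟨hz'.1, ?_⟩⟩
      · exact hG.2.2.2 b z hP.1.2.1 hz hP.1.2.2.1 hN.symm hz'.1 hz'.2
      · exact hP.1.2.2.2 c z hG.2.1 hz hcP.1 hcP.2 hz'.1 hz'.2
  · rcases h.class_of_goodPair hG with hc | hc
    · exact ⟨hG, hc⟩
    · exfalso
      have := (hc c hG.2.1).1 ⟨hG.2.2.1, Near.rfl⟩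
      exact hN ((hP.2 c hG.2.1).2 this).2

variable {p e : V} {P₀ P₁ : V → V → Prop}

theorem IsColoring.labelPair (h : Labeled D H x y) (hP : IsColoring D (GoodPair D H) p e P₀ P₁)
    (hpe : LabelPair D H x p e) :
    (∀ a c, P₀ a c → LabelPair D H x a c) ∧ ∀ a c, P₁ a c → LabelPair D H y a c :=
  hP.least _ _ (fun _ => hpe) (LabelPair.derive h) (LabelPair.derive h.swap)

/-- All good pairs are colored in a connected graph. -/
theorem IsColoring.all (h : Labeled D H x y) (hP : IsColoring D (GoodPair D H) p e P₀ P₁)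
    (hG : GoodPair D H p e)
    (hconn : ∀ T : V → Prop, T p → (∀ u v, H u → H v → T u → Near D u v → T v) → ∀ v, H v → T v) :
    (∀ a c, GoodPair D H a c → P₀ a c ∨ P₁ a c) ∧ ∀ u v, H u → H v → Near D u v →
      SameClass D H P₀ u v ∨ SameClass D H P₁ u v := by
  have step : ∀ a b c, P₀ a b ∨ P₁ a b → GoodPair D H a c → P₀ a c ∨ P₁ a c := by
    intro a b c hab hac
    by_cases hN : Near D b c
    · exact hab.imp (fun h => hP.closed₀ _ _ (.inr ⟨hac, b, .inl ⟨h, hN⟩⟩))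
        fun h => hP.closed₁ _ _ (.inr ⟨hac, b, .inl ⟨h, hN⟩⟩)
    · exact hab.symm.imp (fun h => hP.closed₀ _ _ (.inr ⟨hac, b, .inr ⟨h, hN⟩⟩))
        fun h => hP.closed₁ _ _ (.inr ⟨hac, b, .inr ⟨h, hN⟩⟩)
  have symm : ∀ a b, P₀ a b ∨ P₁ a b → P₀ b a ∨ P₁ b a := fun a b hab =>
    hab.imp (fun h => hP.closed₀ _ _ (.inl h)) fun h => hP.closed₁ _ _ (.inl h)
  -- A common neighbor `s` that is not adjacent to another one `t` forms good pairs with both `u`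
  -- and `v`: if `s` shared both labels with one of them, it would be adjacent to `t`. So the
  -- coloring passes from `u` to `v` by way of `s`.
  have bad : ∀ u v, H u → H v → Near D u v → ¬ GoodPair D H u v →
      ∃ w, GoodPair D H u w ∧ GoodPair D H v w ∧ Near D w v := by
    intro u v hu hv huv hb
    have : ∃ s t, H s ∧ H t ∧ Near D u s ∧ Near D v s ∧ Near D u t ∧ Near D v t ∧
        ¬ Near D s t := by
      by_contra hcon
      push Not at hcon
      exact hb ⟨hu, hv, huv, hcon⟩
    obtain ⟨s, t, hs, ht, h1, h2, h3, h4, hst⟩ := this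
    refine ⟨s, ?_, ?_, h2.symm⟩
    · by_cases hx : x u = x s
      · refine (h.goodPair hu hs hx fun hy => ?_).1
        rcases (h u t hu ht).1 h3 with h' | h'
        · exact hst ((h s t hs ht).2 (.inl (hx.symm.trans h')))
        · exact hst ((h s t hs ht).2 (.inr (hy.symm.trans h')))
      · have hy := ((h u s hu hs).1 h1).resolve_left hx
        exact (h.swap.goodPair hu hs hy hx).1
    · by_cases hx : x v = x s
      · refine (h.goodPair hv hs hx fun hy => ?_).1
        rcases (h v t hv ht).1 h4 with h' | h'
        · exact hst ((h s t hs ht).2 (.inl (hx.symm.trans h')))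
        · exact hst ((h s t hs ht).2 (.inr (hy.symm.trans h')))
      · have hy := ((h v s hv hs).1 h2).resolve_left hx
        exact (h.swap.goodPair hv hs hy hx).1
  have reach : ∀ v, H v → ∃ b, P₀ v b ∨ P₁ v b := by
    refine hconn _ ⟨e, .inl (hP.start hG)⟩ ?_
    rintro u v hu hv ⟨b, hb⟩ huv
    by_cases hg : GoodPair D H u v
    · exact ⟨u, symm u v (step u b v hb hg)⟩
    · obtain ⟨w, h1, h2, -⟩ := bad u v hu hv huv hg
      exact ⟨w, symm w v (step w u v (symm u w (step u b w hb h1)) h2.symm)⟩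
  have all : ∀ a c, GoodPair D H a c → P₀ a c ∨ P₁ a c := fun a c hac => by
    obtain ⟨b, hb⟩ := reach a hac.1
    exact step a b c hb hac
  refine ⟨all, fun u v hu hv huv => ?_⟩
  by_cases hg : GoodPair D H u v
  · exact (all u v hg).imp (fun h => ⟨hu, hv, .inr ⟨u, v, h, Near.rfl, huv.symm, huv, Near.rfl⟩⟩)
      fun h => ⟨hu, hv, .inr ⟨u, v, h, Near.rfl, huv.symm, huv, Near.rfl⟩⟩
  · obtain ⟨w, h1, -, h2⟩ := bad u v hu hv huv hg
    have hwu := h1.2.2.1.symm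
    exact (all u w h1).imp (fun h => ⟨hu, hv, .inr ⟨u, w, h, Near.rfl, hwu, huv, h2⟩⟩)
      fun h => ⟨hu, hv, .inr ⟨u, w, h, Near.rfl, hwu, huv, h2⟩⟩

/-- A relation of distinct vertices is witnessed by a pair whose common neighborhood is the whole
label class; transitivity follows. -/
theorem sameClass_iff (hP : ∀ a c, P₀ a c → LabelPair D H x a c) {u v : V}
    (h : SameClass D H P₀ u v) :
    x u = x v ∧ (u = v ∨ ∀ w, H w → x w = x u → SameClass D H P₀ u w) := by
  obtain ⟨hu, hv, rfl | ⟨a, b, hab, h1, h2, h3, h4⟩⟩ := h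
  · exact ⟨rfl, .inl rfl⟩
  · have hL := hP a b hab
    have e1 := (hL.2 u hu).1 ⟨h1, h2⟩
    have e2 := (hL.2 v hv).1 ⟨h3, h4⟩
    refine ⟨e1.trans e2.symm, .inr fun w hw hxw => ⟨hu, hw, .inr ⟨a, b, hab, h1, h2, ?_⟩⟩⟩
    exact (hL.2 w hw).2 (hxw.trans e1)

theorem sameClass_trans (hP : ∀ a c, P₀ a c → LabelPair D H x a c) {u v w : V}
    (h₁ : SameClass D H P₀ u v) (h₂ : SameClass D H P₀ v w) : SameClass D H P₀ u w := by
  obtain ⟨e1, rfl | h1⟩ := sameClass_iff hP h₁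
  · exact h₂
  · exact h1 w h₂.2.1 ((sameClass_iff hP h₂).1.symm.trans e1.symm)

/-- The coloring generated by a good pair is correct in a connected labeled graph. -/
theorem IsColoring.correct (h : Labeled D H x y) (hP : IsColoring D (GoodPair D H) p e P₀ P₁)
    (hG : GoodPair D H p e)
    (hconn : ∀ T : V → Prop, T p → (∀ u v, H u → H v → T u → Near D u v → T v) → ∀ v, H v → T v) :
    (∀ u v w, SameClass D H P₀ u v → SameClass D H P₀ v w → SameClass D H P₀ u w) ∧
    (∀ u v w, SameClass D H P₁ u v → SameClass D H P₁ v w → SameClass D H P₁ u w) ∧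
    ∀ u v, H u → H v → (Near D u v ↔ SameClass D H P₀ u v ∨ SameClass D H P₁ u v) := by
  -- It is unknown which label the starting pair represents; the two labels may be exchanged.
  have main : ∀ x y : V → L, Labeled D H x y → LabelPair D H x p e →
      (∀ u v w, SameClass D H P₀ u v → SameClass D H P₀ v w → SameClass D H P₀ u w) ∧
      (∀ u v w, SameClass D H P₁ u v → SameClass D H P₁ v w → SameClass D H P₁ u w) ∧
      ∀ u v, H u → H v → (Near D u v ↔ SameClass D H P₀ u v ∨ SameClass D H P₁ u v) := by
    intro x y h hpe
    obtain ⟨h0, h1⟩ := hP.labelPair h hpe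
    refine ⟨fun u v w => sameClass_trans h0, fun u v w => sameClass_trans h1, fun u v hu hv =>
      ⟨(hP.all h hG hconn).2 u v hu hv, fun h' => (h u v hu hv).2 ?_⟩⟩
    exact h'.imp (fun h' => (sameClass_iff h0 h').1) fun h' => (sameClass_iff h1 h').1
  rcases h.class_of_goodPair hG with hc | hc
  · exact main x y h ⟨hG, hc⟩
  · exact main y x h.swap ⟨hG, hc⟩

end Search

end KernelDE

namespace KernelDE

/-! ### Every star contains a certified leaf -/

section Star

variable {V : Type*}

/-- The private part `A` of a leaf whose boundary `C` lies in a class of the first label. -/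
structure Star {L : Type*} (D : V → V → Prop) (S A C : V → Prop) (x y : V → L) : Prop where
  subA : ∀ v, A v → S v
  nonempty : ∃ v, A v
  closed : ∀ u v, A u → S v → Near D u v → A v ∨ C v
  labeled : Labeled D (fun v => A v ∨ C v) x y
  label_eq : ∀ u v, C u → C v → x u = x v
  label_ne : ∀ u v, A u → C v → x u ≠ x v

/-- The coloring generated by `(p, e)` certifies that `A` is the private part of a leaf. -/
def Certified (D : V → V → Prop) (S A : V → Prop) (P₀ P₁ : V → V → Prop) : Prop :=
  (∀ u v, Boundary D S A u → Boundary D S A v → Near D u v) ∧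
  (∀ u v w, SameClass D (fun v => A v ∨ Boundary D S A v) P₀ u v →
    SameClass D (fun v => A v ∨ Boundary D S A v) P₀ v w →
    SameClass D (fun v => A v ∨ Boundary D S A v) P₀ u w) ∧
  (∀ u v w, SameClass D (fun v => A v ∨ Boundary D S A v) P₁ u v →
    SameClass D (fun v => A v ∨ Boundary D S A v) P₁ v w →
    SameClass D (fun v => A v ∨ Boundary D S A v) P₁ u w) ∧
  ∀ u v, A u ∨ Boundary D S A u → A v ∨ Boundary D S A v →
    (Near D u v ↔ SameClass D (fun v => A v ∨ Boundary D S A v) P₀ u v ∨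
      SameClass D (fun v => A v ∨ Boundary D S A v) P₁ u v)

variable {L : Type*} {D : V → V → Prop} {S A C Q : V → Prop} {x y : V → L} {p : V}

theorem IsComponent.unique {A' : V → Prop} (h : IsComponent D S Q p A)
    (h' : IsComponent D S Q p A') : A = A' :=
  funext fun v => propext ⟨h.least _ h'.start h'.closed v, h'.least _ h.start h.closed v⟩

theorem IsComponent.connected (h : IsComponent D S Q p A) (T : V → Prop) (hp : T p)
    (hT : ∀ u v, A u ∨ Boundary D S A u → A v ∨ Boundary D S A v → T u → Near D u v → T v)
    (v : V) (hv : A v ∨ Boundary D S A v) : T v := by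
  have hA : ∀ v, A v → A v ∧ T v := h.least _ ⟨h.start, hp⟩ fun u v hu hv hQ huv => by
    have := h.closed u v hu.1 hv hQ huv
    exact ⟨this, hT u v (.inl hu.1) (.inl this) hu.2 huv⟩
  rcases hv with hv | hv
  · exact (hA v hv).2
  · obtain ⟨u, hu, huv⟩ := hv.2.2
    exact hT u v (.inl hu) (.inr hv) (hA u hu).2 huv

/-- A vertex of a labeled graph lies in a good pair. -/
theorem Labeled.exists_goodPair {H : V → Prop} (h : Labeled D H x y) (hp : H p) :
    ∃ e, GoodPair D H p e := by
  by_cases hc : ∀ s t, H s → H t → Near D p s → Near D p t → Near D s t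
  · exact ⟨p, hp, hp, Near.rfl, fun s t hs ht h1 _ h3 _ => hc s t hs ht h1 h3⟩
  · push Not at hc
    obtain ⟨s, t, hs, ht, h1, h2, hst⟩ := hc
    refine ⟨s, ?_⟩
    by_cases hx : x p = x s
    · refine (h.goodPair hp hs hx fun hy => hst ?_).1
      rw [h s t hs ht, ← hx, ← hy]
      exact (h p t hp ht).1 h2
    · exact (h.swap.goodPair hp hs (((h p s hp hs).1 h1).resolve_left hx) hx).1

/-- A separating common neighborhood that lies inside a star. -/
theorem Star.exists_separation (h : Star D S A C x y) :
    ∃ c d p, A p ∧ ∀ A', IsComponent D S (fun z => Near D z c ∧ Near D z d) p A' →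
      (∀ v, A' v → A v) ∧ (∀ v, Boundary D S A' v → A v ∨ C v) ∧
      ∀ u v, Boundary D S A' u → Boundary D S A' v → Near D u v := by
  -- A simplicial vertex is a leaf by itself: with `c = d = p` its whole neighborhood is removed.
  by_cases hsimp : ∃ p, A p ∧ ∀ u v, S u → S v → Near D p u → Near D p v → Near D u v
  · obtain ⟨p, hp, hcl⟩ := hsimp
    refine ⟨p, p, p, hp, fun A' hA' => ?_⟩
    have hA'p : ∀ v, A' v → v = p := hA'.least _ rfl fun u v hu _ hQ huv =>
      absurd (And.intro (hu ▸ huv.symm) (hu ▸ huv.symm)) hQ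
    have hB : ∀ v, Boundary D S A' v → S v ∧ Near D p v := by
      rintro v ⟨hv, -, u, hu, huv⟩
      exact ⟨hv, hA'p u hu ▸ huv⟩
    exact ⟨fun v hv => hA'p v hv ▸ hp, fun v hv => h.closed p v hp (hB v hv).1 (hB v hv).2,
      fun u v hu hv => hcl u v (hB u hu).1 (hB v hv).1 (hB u hu).2 (hB v hv).2⟩
  push Not at hsimp
  -- Common pattern: if the common neighborhood of `c` and `d` is, within `A ∪ C`, a clique `Q`
  -- containing every vertex of `C` with a neighbor in `A`, the component of `p` cannot leave `A`
  -- and its boundary lies in `Q`.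
  have sep : ∀ (c d p : V) (Q : V → Prop), A p → (∀ v, A v ∨ C v →
      (Near D c v ∧ Near D d v ↔ Q v)) → (∀ u v, A u → C v → Near D u v → Q v) →
      (∀ u v, A u ∨ C u → A v ∨ C v → Q u → Q v → Near D u v) →
      ∃ c d p, A p ∧ ∀ A', IsComponent D S (fun z => Near D z c ∧ Near D z d) p A' →
      (∀ v, A' v → A v) ∧ (∀ v, Boundary D S A' v → A v ∨ C v) ∧
      ∀ u v, Boundary D S A' u → Boundary D S A' v → Near D u v := by
    intro c d p Q hp hQ hC hcl
    refine ⟨c, d, p, hp, fun A' hA' => ?_⟩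
    have hQ' : ∀ v, A v ∨ C v → (Near D v c ∧ Near D v d ↔ Q v) := fun v hv => by
      rw [← hQ v hv, Near.symm_iff, Near.symm_iff (u := v)]
    have hsub : ∀ v, A' v → A v := hA'.least _ hp fun u v hu hv hnQ huv => by
      have := h.closed u v hu hv huv
      exact this.resolve_right fun hv' => hnQ ((hQ' v this).2 (hC u v hu hv' huv))
    have hB : ∀ v, Boundary D S A' v → (A v ∨ C v) ∧ Q v := by
      rintro v ⟨hv, hnv, u, hu, huv⟩
      have hAC := h.closed u v (hsub u hu) hv huv
      refine ⟨hAC, ?_⟩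
      by_contra hnQ
      exact hnv (hA'.closed u v hu hv (fun h' => hnQ ((hQ' v hAC).1 h')) huv)
    exact ⟨hsub, fun v hv => (hB v hv).1,
      fun u v hu hv => hcl u v (hB u hu).1 (hB v hv).1 (hB u hu).2 (hB v hv).2⟩
  have clx : ∀ m u v, A u ∨ C u → A v ∨ C v → x u = m → x v = m → Near D u v :=
    fun m u v hu hv h1 h2 => (h.labeled u v hu hv).2 (.inl (h1.trans h2.symm))
  have cly : ∀ m u v, A u ∨ C u → A v ∨ C v → y u = m → y v = m → Near D u v :=
    fun m u v hu hv h1 h2 => (h.labeled u v hu hv).2 (.inr (h1.trans h2.symm))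
  obtain ⟨p₀, hp₀⟩ := h.nonempty
  -- Two boundary vertices with different second labels cut out exactly the first-label class that
  -- contains `C`.
  by_cases hC : ∃ c d, C c ∧ C d ∧ y c ≠ y d
  · obtain ⟨c, d, hc, hd, hcd⟩ := hC
    have hx : x c = x d := h.label_eq c d hc hd
    exact sep c d p₀ (fun v => x v = x c) hp₀
      (h.labeled.goodPair (.inr hc) (.inr hd) hx hcd).2
      (fun u v _ hv _ => h.label_eq v c hv hc) (clx _)
  push Not at hC
  -- Now `C` lies in one second-label class. A neighbor `u` of `c` in `A` shares just that label,
  -- and the pair cuts out this class; as `u` is not simplicial, some vertex of `A` lies outside it.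
  by_cases hAC : ∃ u c, A u ∧ C c ∧ Near D u c
  · obtain ⟨u, c, hu, hc, huc⟩ := hAC
    have hxu : x u ≠ x c := h.label_ne u c hu hc
    have hyu : y u = y c := ((h.labeled u c (.inl hu) (.inr hc)).1 huc).resolve_left hxu
    obtain ⟨s, t, hs, ht, hus, hut, hst⟩ := hsimp u hu
    have hp : ∃ p, (A p ∨ C p) ∧ y p ≠ y u := by
      by_contra! hcon
      have hs' := h.closed u s hu hs hus
      have ht' := h.closed u t hu ht hut
      exact hst (cly (y u) s t hs' ht' (hcon s hs') (hcon t ht'))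
    obtain ⟨p, hp, hpy⟩ := hp
    have hpA : A p := hp.resolve_right fun h' => hpy ((hC p c h' hc).trans hyu.symm)
    exact sep u c p (fun v => y v = y u) hpA
      (h.labeled.swap.goodPair (.inl hu) (.inr hc) hyu hxu).2
      (fun w v _ hv _ => (hC v c hv hc).trans hyu.symm) (cly _)
  push Not at hAC
  -- Now no edge joins `A` and `C`. Two nonadjacent neighbors of `p₀` share different labels with
  -- it: `p₀` and the one with its second label cut out a class, and the other one remains as the
  -- starting vertex.
  obtain ⟨a, b, ha, hb, h1, h2, hab⟩ := hsimp p₀ hp₀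
  have ha' := (h.closed p₀ a hp₀ ha h1).resolve_right fun h' => hAC _ _ hp₀ h' h1
  have hb' := (h.closed p₀ b hp₀ hb h2).resolve_right fun h' => hAC _ _ hp₀ h' h2
  have fin : ∀ a b, A a → A b → Near D p₀ b → ¬ Near D a b → y p₀ = y a →
      ∃ c d p, A p ∧ ∀ A', IsComponent D S (fun z => Near D z c ∧ Near D z d) p A' →
      (∀ v, A' v → A v) ∧ (∀ v, Boundary D S A' v → A v ∨ C v) ∧
      ∀ u v, Boundary D S A' u → Boundary D S A' v → Near D u v := by
    intro a b ha hb h2 hab hya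
    have hyb : y b ≠ y p₀ := fun hy =>
      hab (cly _ a b (.inl ha) (.inl hb) hya.symm hy)
    have hxb : x p₀ = x b :=
      ((h.labeled p₀ b (.inl hp₀) (.inl hb)).1 h2).resolve_right fun h' => hyb h'.symm
    have hxa : x p₀ ≠ x a := fun hx =>
      hab (clx _ a b (.inl ha) (.inl hb) hx.symm hxb.symm)
    exact sep p₀ a b (fun v => y v = y p₀) hb
      (h.labeled.swap.goodPair (.inl hp₀) (.inl ha) hya hxa).2
      (fun u v hu hv huv => absurd huv (hAC u v hu hv)) (cly _)
  rcases (h.labeled p₀ a (.inl hp₀) (.inl ha')).1 h1 with hx | hy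
  · rcases (h.labeled p₀ b (.inl hp₀) (.inl hb')).1 h2 with hx' | hy'
    · exact absurd (clx _ a b (.inl ha') (.inl hb') hx.symm hx'.symm) hab
    · exact fin b a hb' ha' h1 (fun h' => hab h'.symm) hy'
  · exact fin a b ha' hb' h2 hab hy

/-- Inside a star some common neighborhood separates a certified leaf. -/
theorem Star.exists_certified (h : Star D S A C x y) :
    ∃ c d p e, S p ∧ ∀ A' P₀ P₁,
      IsComponent D S (fun z => Near D z c ∧ Near D z d) p A' →
      IsColoring D (GoodPair D fun v => A' v ∨ Boundary D S A' v) p e P₀ P₁ →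
      Certified D S A' P₀ P₁ := by
  obtain ⟨c, d, p, hp, hsep⟩ := h.exists_separation
  by_cases hex : ∃ A', IsComponent D S (fun z => Near D z c ∧ Near D z d) p A'
  · obtain ⟨A', hA'⟩ := hex
    obtain ⟨h1, h2, h3⟩ := hsep A' hA'
    have hlab : Labeled D (fun v => A' v ∨ Boundary D S A' v) x y :=
      h.labeled.mono fun v hv => hv.elim (fun hv => .inl (h1 v hv)) (h2 v)
    obtain ⟨e, he⟩ := hlab.exists_goodPair (.inl hA'.start)
    refine ⟨c, d, p, e, h.subA p hp, fun A'' P₀ P₁ hA'' hP => ?_⟩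
    obtain rfl := hA'.unique hA''
    exact ⟨h3, hP.correct hlab he hA'.connected⟩
  · exact ⟨c, d, p, p, h.subA p hp, fun A' _ _ hA' => absurd ⟨A', hA'⟩ hex⟩

end Star

end KernelDE

namespace KernelDE

/-- Soundness of the test for an arbitrary pair of colorings: the properties of a leaf that are not
tested hold by the form of `Boundary` and `SameClass`. -/
theorem Certified.leaf {V : Type*} {D : V → V → Prop} {S A : V → Prop} {P₀ P₁ : V → V → Prop}
    (h : Certified D S A P₀ P₁) (hA : ∀ v, A v → S v) (hne : ∃ v, A v) :
    Leaf D S A (Boundary D S A) (SameClass D (fun v => A v ∨ Boundary D S A v) P₀)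
      (SameClass D (fun v => A v ∨ Boundary D S A v) P₁) where
  subA := hA
  subC _ hv := hv.1
  disj _ hv hv' := hv'.2.1 hv
  nonempty := hne
  closed u v hu hv huv := by
    by_cases hv' : A v
    · exact .inl hv'
    · exact .inr ⟨hv, hv', u, hu, huv⟩
  clique := h.1
  colored :=
    { near := h.2.2.2
      reflX := fun _ hu => ⟨hu, hu, .inl rfl⟩
      reflY := fun _ hu => ⟨hu, hu, .inl rfl⟩
      symmX := fun _ _ ⟨hu, hv, h⟩ => ⟨hv, hu, h.imp Eq.symm
        fun ⟨a, b, h0, h1, h2, h3, h4⟩ => ⟨a, b, h0, h3, h4, h1, h2⟩⟩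
      symmY := fun _ _ ⟨hu, hv, h⟩ => ⟨hv, hu, h.imp Eq.symm
        fun ⟨a, b, h0, h1, h2, h3, h4⟩ => ⟨a, b, h0, h3, h4, h1, h2⟩⟩
      transX := fun u v w _ _ _ => h.2.1 u v w
      transY := fun u v w _ _ _ => h.2.2.1 u v w }

/-- Exhaustive search: success is never lost, and a good index forces it. The form suits nested
loops, where `G` is again an existence statement. -/
theorem LSt.run_up_search {n d : ℕ} {ρ : ℕ → Fin n} {σ : State n} {p : ℕ → LSt}
    (Inv Found : State n → Prop) (G : Fin n → Prop)
    (h : ∀ i τ, Inv τ → Inv ((p d).run (d + 1) (Function.update ρ d i) τ) ∧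
      (Found τ ∨ G i → Found ((p d).run (d + 1) (Function.update ρ d i) τ))) (hσ : Inv σ) :
    Inv ((up p).run d ρ σ) ∧ (Found σ ∨ (∃ i, G i) → Found ((up p).run d ρ σ)) := by
  have key := run_up_induct (p := p) (ρ := ρ) (d := d) (σ := σ)
    (fun i τ => Inv τ ∧ (Found σ ∨ (∃ k : Fin n, k < i ∧ G k) → Found τ))
    ⟨hσ, fun h' => h'.resolve_right (by simp)⟩ fun i hi τ hτ => by
      obtain ⟨h1, h2⟩ := h ⟨i, hi⟩ τ hτ.1
      refine ⟨h1, fun h' => h2 ?_⟩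
      rcases h' with h' | ⟨k, hk, hG⟩
      · exact .inl (hτ.2 (.inl h'))
      · rcases Nat.lt_succ_iff_lt_or_eq.1 hk with hk | hk
        · exact .inl (hτ.2 (.inr ⟨k, hk, hG⟩))
        · exact .inr ((Fin.ext hk : k = ⟨i, hi⟩) ▸ hG)
  exact ⟨key.1, fun h' => key.2 (h'.imp_right fun ⟨i, hi⟩ => ⟨i, i.2, hi⟩)⟩

/-! ### The search as a program: components and colorings -/

section SearchProgram

open LFm

variable {n : ℕ} {σ : State n} {d : ℕ} {ρ : ℕ → Fin n}

/-- `Near` as a formula. -/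
def nearF (x y : ℕ) : LFm := or (eq x y) (or (rel 1 x y) (rel 1 y x))

theorem holds_nearF {x y : ℕ} : Holds σ d ρ (nearF x y) ↔ Near (σ 1) (ρ x) (ρ y) := by
  simp only [nearF, holds_or, holds_eq, holds_rel]; rfl

/-- One step towards the component of `p`. -/
def growRound (c c' : ℕ) : LSt :=
  .upd 13 fun x _ => or (mem 13 x) (and (mem 2 x) (and (neg (and (nearF x c) (nearF x c')))
    (ex fun u => and (mem 13 u) (nearF u x))))

/-- The component of `p`. -/
def grow (c c' p : ℕ) : LSt := .seq (.upd 13 fun x _ => eq x p) (.up fun _ => growRound c c')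

theorem run_growRound {c c' : ℕ} (hc : c < d) (hc' : c' < d) :
    ((growRound c c').run d ρ σ).set 13 = fun v => σ.set 13 v ∨ σ.set 2 v ∧
      ¬ (Near (σ 1) v (ρ c) ∧ Near (σ 1) v (ρ c')) ∧ ∃ u, σ.set 13 u ∧ Near (σ 1) u v := by
  have h1 : c ≠ d + 1 := by omega
  have h2 : c' ≠ d + 1 := by omega
  simp only [growRound, LSt.run_upd, holds_or, holds_and, holds_neg, holds_mem, holds_ex,
    holds_nearF, Function.update_of_ne hc.ne, Function.update_of_ne hc'.ne,
    Function.update_of_ne h1, Function.update_of_ne h2, update_pair]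
  simp [State.set_update_self]
  rfl

/-- An increasing operator fixes a set or adds an element. -/
theorem ncard_lt_of_subset_ne {α : Type*} [Finite α] {P P' : α → Prop} (h : ∀ v, P v → P' v)
    (hne : P' ≠ P) : {v | P v}.ncard < {v | P' v}.ncard :=
  Set.ncard_lt_ncard ⟨h, fun h' => hne (funext fun v => propext ⟨fun hv => h' hv, h v⟩)⟩

/-- Starting from one vertex, each round adds a vertex or the set is closed, so `n` rounds suffice.
-/
theorem run_grow {c c' p : ℕ} (hc : c < d) (hc' : c' < d) (hp : p < d) :
    IsComponent (σ 1) (σ.set 2) (fun z => Near (σ 1) z (ρ c) ∧ Near (σ 1) z (ρ c')) (ρ p)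
      (((grow c c' p).run d ρ σ).set 13) := by
  set Q : Fin n → Prop := fun z => Near (σ 1) z (ρ c) ∧ Near (σ 1) z (ρ c')
  have key := LSt.run_up_induct (p := fun _ => growRound c c') (d := d) (ρ := ρ)
    (σ := (LSt.upd 13 fun x _ => eq x p).run d ρ σ)
    (fun i τ => τ 1 = σ 1 ∧ τ.set 2 = σ.set 2 ∧ τ.set 13 (ρ p) ∧
      (∀ T : Fin n → Prop, T (ρ p) →
        (∀ u v, T u → σ.set 2 v → ¬ Q v → Near (σ 1) u v → T v) → ∀ v, τ.set 13 v → T v) ∧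
      ((∀ u v, τ.set 13 u → σ.set 2 v → ¬ Q v → Near (σ 1) u v → τ.set 13 v) ∨
        i < {v | τ.set 13 v}.ncard)) ?_ ?_
  · obtain ⟨-, -, h1, h2, h3⟩ := key
    refine ⟨h1, h3.resolve_right fun h' => ?_, h2⟩
    have := Set.ncard_le_card {v | ((LSt.up fun _ => growRound c c').run d ρ
      ((LSt.upd 13 fun x _ => eq x p).run d ρ σ)).set 13 v}
    simp at this
    omega
  · have hp' : p ≠ d + 1 := by omega
    have h13 : ((LSt.upd 13 fun x _ => eq x p).run d ρ σ).set 13 = fun v => v = ρ p := by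
      simp only [LSt.run_upd, holds_eq, update_pair, Function.update_of_ne hp.ne,
        Function.update_of_ne hp', State.set_update_self]
    refine ⟨LSt.run_frame _ rfl, State.set_congr (LSt.run_frame _ rfl), ?_, ?_, .inr ?_⟩
    · rw [h13]
    · rw [h13]
      rintro T hT - v rfl
      exact hT
    · rw [h13, Set.ncard_pos]
      exact ⟨ρ p, rfl⟩
  · rintro i hi τ ⟨h1, h2, h3, h4, h5⟩
    have h13 := run_growRound (σ := τ) (ρ := Function.update ρ d ⟨i, hi⟩)
      (Nat.lt_succ_of_lt hc) (Nat.lt_succ_of_lt hc')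
    rw [update_lt hc, update_lt hc', h1, h2] at h13
    refine ⟨(LSt.run_frame _ rfl).trans h1,
      (State.set_congr (LSt.run_frame _ rfl)).trans h2, ?_, ?_, ?_⟩
    · rw [h13]; exact .inl h3
    · rw [h13]
      rintro T hT hcl v (hv | ⟨hv, hQ, u, hu, huv⟩)
      · exact h4 T hT hcl v hv
      · exact hcl u v (h4 T hT hcl u hu) hv hQ huv
    · by_cases heq : ((growRound c c').run (d + 1) (Function.update ρ d ⟨i, hi⟩) τ).set 13 =
        τ.set 13
      · left
        rw [heq]
        intro u v hu hv hQ huv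
        rw [← heq, h13]
        exact .inr ⟨hv, hQ, u, hu, huv⟩
      · right
        rcases h5 with h5 | h5
        · refine absurd ?_ heq
          rw [h13]
          funext v
          refine propext ⟨?_, .inl⟩
          rintro (hv | ⟨hv, hQ, u, hu, huv⟩)
          · exact hv
          · exact h5 u v hu hv hQ huv
        · refine lt_of_le_of_lt (Nat.succ_le_of_lt h5) (ncard_lt_of_subset_ne (fun v hv => ?_) heq)
          rw [h13]
          exact .inl hv

/-- `Derive` as a formula. -/
def deriveF (k k' x y : ℕ) : LFm :=
  or (rel k y x) (and (rel 20 x y) (ex fun b =>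
    or (and (rel k x b) (nearF b y)) (and (rel k' x b) (neg (nearF b y)))))

theorem holds_deriveF {k k' x y : ℕ} (hx : x < d) (hy : y < d) :
    Holds σ d ρ (deriveF k k' x y) ↔ Derive (σ 1) (σ 20) (σ k) (σ k') (ρ x) (ρ y) := by
  simp only [deriveF, holds_or, holds_and, holds_rel, holds_ex, holds_neg, holds_nearF,
    update_lt hx, update_lt hy, Function.update_self]
  rfl

/-- One round of coloring pairs. -/
def colorRound : LSt :=
  .seq (.upd 15 fun x y => or (rel 15 x y) (deriveF 15 16 x y))
    (.upd 16 fun x y => or (rel 16 x y) (deriveF 16 15 x y))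

/-- The coloring of the good pairs generated by `(p, e)`. -/
def color (p e : ℕ) : LSt :=
  .seq (.upd 15 fun x y => and (eq x p) (and (eq y e) (rel 20 x y)))
    -- These are `2n²` rounds, as many as there are pairs in the two colors together; each round
    -- colors a new pair or nothing changes any more.
    (.seq (.upd 16 fun x _ => neg (eq x x)) (.up fun _ => .up fun _ => .seq colorRound colorRound))

theorem run_colorRound : colorRound.run d ρ σ 15 =
      (fun a c => σ 15 a c ∨ Derive (σ 1) (σ 20) (σ 15) (σ 16) a c) ∧
    colorRound.run d ρ σ 16 = fun a c => σ 16 a c ∨ Derive (σ 1) (σ 20) (σ 16)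
      (fun a c => σ 15 a c ∨ Derive (σ 1) (σ 20) (σ 15) (σ 16) a c) a c := by
  have h0 : d < d + 2 := by omega
  have h1 : d + 1 < d + 2 := by omega
  simp only [colorRound, LSt.run_seq, LSt.run_upd, holds_or, holds_rel, holds_deriveF h0 h1,
    update_pair]
  constructor <;> simp [Function.update_of_ne]

/-- The invariant of coloring pairs. -/
structure ColorInv (D G : Fin n → Fin n → Prop) (p e : Fin n) (m : ℕ) (τ : State n) : Prop where
  arcs : τ 1 = D
  good : τ 20 = G
  start : G p e → τ 15 p e
  least : ∀ T₀ T₁ : Fin n → Fin n → Prop, (G p e → T₀ p e) →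
    (∀ a c, Derive D G T₀ T₁ a c → T₀ a c) → (∀ a c, Derive D G T₁ T₀ a c → T₁ a c) →
    (∀ a c, τ 15 a c → T₀ a c) ∧ ∀ a c, τ 16 a c → T₁ a c
  progress : ((∀ a c, Derive D G (τ 15) (τ 16) a c → τ 15 a c) ∧
      ∀ a c, Derive D G (τ 16) (τ 15) a c → τ 16 a c) ∨
    m ≤ {q : Fin n × Fin n | τ 15 q.1 q.2}.ncard + {q : Fin n × Fin n | τ 16 q.1 q.2}.ncard

theorem Derive.mono {V : Type*} {D G P P' T T' : V → V → Prop} {a c : V}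
    (h : Derive D G P P' a c) (hP : ∀ a c, P a c → T a c) (hP' : ∀ a c, P' a c → T' a c) :
    Derive D G T T' a c :=
  h.imp (hP _ _) fun ⟨h, b, hb⟩ => ⟨h, b, hb.imp (And.imp_left (hP _ _)) (And.imp_left (hP' _ _))⟩

theorem ncard_pairs_le {P P' : Fin n → Fin n → Prop} (h : ∀ a c, P a c → P' a c) :
    {q : Fin n × Fin n | P q.1 q.2}.ncard ≤ {q : Fin n × Fin n | P' q.1 q.2}.ncard :=
  Set.ncard_le_ncard fun q hq => h q.1 q.2 hq

theorem ncard_pairs_lt {P P' : Fin n → Fin n → Prop} (h : ∀ a c, P a c → P' a c) (hne : P' ≠ P) :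
    {q : Fin n × Fin n | P q.1 q.2}.ncard < {q : Fin n × Fin n | P' q.1 q.2}.ncard :=
  ncard_lt_of_subset_ne (P := fun q : Fin n × Fin n => P q.1 q.2) (fun q hq => h q.1 q.2 hq)
    fun h' => hne (funext fun a => funext fun c => congrFun h' (a, c))

theorem ColorInv.round {D G : Fin n → Fin n → Prop} {p e : Fin n} {m : ℕ} {τ : State n}
    (h : ColorInv D G p e m τ) : ColorInv D G p e (m + 1) (colorRound.run d ρ τ) := by
  obtain ⟨h15, h16⟩ := run_colorRound (σ := τ) (d := d) (ρ := ρ)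
  have i15 : ∀ a c, τ 15 a c → colorRound.run d ρ τ 15 a c := fun a c hac => by
    rw [h15]; exact .inl hac
  have i16 : ∀ a c, τ 16 a c → colorRound.run d ρ τ 16 a c := fun a c hac => by
    rw [h16]; exact .inl hac
  rw [← h15] at h16
  rw [h.arcs, h.good] at h15 h16
  refine ⟨(LSt.run_frame _ rfl).trans h.arcs, (LSt.run_frame _ rfl).trans h.good,
    fun hG => i15 _ _ (h.start hG), fun T₀ T₁ h0 h1 h2 => ?_, ?_⟩
  · obtain ⟨l0, l1⟩ := h.least T₀ T₁ h0 h1 h2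
    have l0' : ∀ a c, colorRound.run d ρ τ 15 a c → T₀ a c := by
      rw [h15]
      rintro a c (hac | hac)
      · exact l0 a c hac
      · exact h1 a c (hac.mono l0 l1)
    refine ⟨l0', ?_⟩
    rw [h16]
    rintro a c (hac | hac)
    · exact l1 a c hac
    · exact h2 a c (hac.mono l1 l0')
  · by_cases e15 : colorRound.run d ρ τ 15 = τ 15
    · by_cases e16 : colorRound.run d ρ τ 16 = τ 16
      · left
        rw [e15] at h16
        rw [e15, e16]
        exact ⟨fun a c hac => by rw [← e15, h15]; exact .inr hac,
          fun a c hac => by rw [← e16, h16]; exact .inr hac⟩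
      · right
        rcases h.progress with hp | hp
        · refine absurd ?_ e16
          rw [h16, e15]
          exact funext fun a => funext fun c => propext ⟨fun h' => h'.elim id (hp.2 a c), .inl⟩
        · have := ncard_pairs_lt i16 e16
          have := ncard_pairs_le i15
          omega
    · right
      rcases h.progress with hp | hp
      · refine absurd ?_ e15
        rw [h15]
        exact funext fun a => funext fun c => propext ⟨fun h' => h'.elim id (hp.1 a c), .inl⟩
      · have := ncard_pairs_lt i15 e15
        have := ncard_pairs_le i16
        omega

theorem run_color {p e : ℕ} (hp : p < d) (he : e < d) :
    IsColoring (σ 1) (σ 20) (ρ p) (ρ e) ((color p e).run d ρ σ 15) ((color p e).run d ρ σ 16) := by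
  have hp' : p ≠ d + 1 := by omega
  have he' : e ≠ d + 1 := by omega
  set σ₁ := (LSt.upd 16 fun x _ => neg (eq x x)).run d ρ
    ((LSt.upd 15 fun x y => and (eq x p) (and (eq y e) (rel 20 x y))).run d ρ σ) with hσ₁
  have e15 : σ₁ 15 = fun x y => x = ρ p ∧ y = ρ e ∧ σ 20 x y := by
    rw [hσ₁]
    simp only [LSt.run_upd, holds_eq, holds_rel, holds_and, holds_neg, update_pair,
      Function.update_of_ne hp.ne, Function.update_of_ne hp', Function.update_of_ne he.ne,
      Function.update_of_ne he']
    simp [Function.update_of_ne]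
  have e16 : σ₁ 16 = fun _ _ => False := by
    rw [hσ₁]
    simp only [LSt.run_upd, holds_eq, holds_neg, update_pair]
    simp
  have key := LSt.run_up_induct (p := fun _ => .up fun _ => .seq colorRound colorRound) (d := d)
    (ρ := ρ) (σ := σ₁) (fun i τ => ColorInv (σ 1) (σ 20) (ρ p) (ρ e) (i * (2 * n)) τ) ?_ ?_
  · change ColorInv (σ 1) (σ 20) (ρ p) (ρ e) (n * (2 * n)) ((color p e).run d ρ σ) at key
    generalize (color p e).run d ρ σ = τ at key
    refine ⟨key.start, ?_, ?_, key.least⟩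
    all_goals
      rcases key.progress with h | h
      · first | exact h.1 | exact h.2
      · have b : ∀ P : Fin n → Fin n → Prop,
            ({q : Fin n × Fin n | P q.1 q.2}.ncard ≤ n * n) ∧
            (n * n ≤ {q : Fin n × Fin n | P q.1 q.2}.ncard → ∀ a c, P a c) := by
          intro P
          have h1 := Set.ncard_le_card {q : Fin n × Fin n | P q.1 q.2}
          have h2 : Nat.card (Fin n × Fin n) = n * n := by simp
          rw [h2] at h1
          refine ⟨h1, fun h3 a c => ?_⟩
          have h4 : {q : Fin n × Fin n | P q.1 q.2} = Set.univ :=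
            Set.eq_univ_iff_ncard _ |>.2 (by rw [h2]; omega)
          exact h4.symm.subset (Set.mem_univ (a, c))
        have h15 := b (τ 15)
        have h16 := b (τ 16)
        have : n * (2 * n) = n * n + n * n := by ring
        intro a c _
        first | exact h15.2 (by omega) a c | exact h16.2 (by omega) a c
  · refine ⟨(LSt.run_frame _ rfl).trans (LSt.run_frame _ rfl),
      (LSt.run_frame _ rfl).trans (LSt.run_frame _ rfl), fun hG => ?_,
      fun T₀ T₁ h0 _ _ => ?_, .inr (by simp)⟩
    · rw [e15]; exact ⟨rfl, rfl, hG⟩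
    · rw [e15, e16]
      refine ⟨?_, fun _ _ h => h.elim⟩
      rintro a c ⟨rfl, rfl, h⟩
      exact h0 h
  · intro i hi τ hτ
    have := LSt.run_up_induct (p := fun _ => .seq colorRound colorRound) (d := d + 1)
      (ρ := Function.update ρ d ⟨i, hi⟩) (σ := τ)
      (fun j τ => ColorInv (σ 1) (σ 20) (ρ p) (ρ e) (i * (2 * n) + 2 * j) τ) hτ
      fun j hj τ hτ => hτ.round.round
    rwa [show i * (2 * n) + 2 * n = (i + 1) * (2 * n) by ring] at this

end SearchProgram

end KernelDE

namespace KernelDE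

/-! ### The search as a program: test and choice of a leaf -/

section SearchProgram

open LFm

variable {n : ℕ} {σ : State n} {d : ℕ} {ρ : ℕ → Fin n}

/-- The vertices of the candidate leaf. -/
def leafF (x : ℕ) : LFm := or (mem 13 x) (mem 14 x)

/-- `GoodPair` as a formula. -/
def goodF (x y : ℕ) : LFm :=
  and (leafF x) (and (leafF y) (and (nearF x y) (all fun s => all fun t => imp (leafF s)
    (imp (leafF t) (imp (nearF x s) (imp (nearF y s) (imp (nearF x t) (imp (nearF y t)
      (nearF s t)))))))))

/-- `SameClass` as a formula. -/
def sameF (k x y : ℕ) : LFm :=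
  and (leafF x) (and (leafF y) (or (eq x y) (ex fun a => ex fun b => and (rel k a b)
    (and (nearF a x) (and (nearF b x) (and (nearF a y) (nearF b y)))))))

/-- The boundary of a candidate leaf. -/
def boundary : LSt :=
  .upd 14 fun x _ => and (mem 2 x) (and (neg (mem 13 x))
    (ex fun u => and (mem 13 u) (nearF u x)))

/-- The boundary of a candidate leaf and its good pairs. -/
def frameLeaf : LSt := .seq boundary (.upd 20 goodF)

/-- The classes of a candidate leaf. -/
def classes : LSt := .seq (.upd 23 (sameF 15)) (.upd 24 (sameF 16))

/-- Transitivity as a formula. -/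
def transF (k : ℕ) : LFm :=
  all fun u => all fun v => all fun w => imp (rel k u v) (imp (rel k v w) (rel k u w))

/-- The test of a candidate leaf. -/
def testF : LFm :=
  and (neg (ex fun x => mem 12 x)) (and (all fun x => imp (mem 13 x) (mem 2 x))
    (and (all fun u => all fun v => imp (mem 14 u) (imp (mem 14 v) (nearF u v)))
      (and (transF 23) (and (transF 24) (all fun u => all fun v => imp (leafF u) (imp (leafF v)
        (and (imp (nearF u v) (or (rel 23 u v) (rel 24 u v)))
          (imp (or (rel 23 u v) (rel 24 u v)) (nearF u v)))))))))

/-- A candidate leaf is chosen. -/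
def choose : LSt :=
  .seq (.upd 8 fun x _ => mem 13 x) (.seq (.upd 9 fun x _ => mem 14 x)
    (.seq (.upd 10 (rel 23)) (.seq (.upd 11 (rel 24)) (.upd 12 fun x _ => eq x x))))

/-- The candidate leaf determined by four vertices. -/
def candidate (c c' p e : ℕ) : LSt :=
  .seq (grow c c' p) (.seq frameLeaf (.seq (color p e) (.seq classes (.when testF choose))))

/-- The search for a leaf. -/
def search : LSt :=
  .seq (.upd 12 fun x _ => neg (eq x x)) (.up fun c => .up fun c' => .up fun p => .up fun e =>
    candidate c c' p e)

theorem holds_leafF {x : ℕ} : Holds σ d ρ (leafF x) ↔ σ.set 13 (ρ x) ∨ σ.set 14 (ρ x) := by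
  simp only [leafF, holds_or, holds_mem]; rfl

theorem holds_goodF {x y : ℕ} (hx : x < d) (hy : y < d) : Holds σ d ρ (goodF x y) ↔
    GoodPair (σ 1) (fun v => σ.set 13 v ∨ σ.set 14 v) (ρ x) (ρ y) := by
  simp only [goodF, holds_and, holds_all, holds_imp, holds_leafF, holds_nearF, update_lt hx,
    update_lt hy, update_lt (Nat.lt_succ_of_lt hx), update_lt (Nat.lt_succ_of_lt hy),
    update_pair]
  rfl

theorem holds_sameF {k x y : ℕ} (hx : x < d) (hy : y < d) : Holds σ d ρ (sameF k x y) ↔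
    SameClass (σ 1) (fun v => σ.set 13 v ∨ σ.set 14 v) (σ k) (ρ x) (ρ y) := by
  simp only [sameF, holds_and, holds_or, holds_eq, holds_rel, holds_ex, holds_leafF, holds_nearF,
    update_lt hx, update_lt hy, update_lt (Nat.lt_succ_of_lt hx),
    update_lt (Nat.lt_succ_of_lt hy), update_pair]
  rfl

theorem run_frameLeaf :
    (frameLeaf.run d ρ σ).set 14 = Boundary (σ 1) (σ.set 2) (σ.set 13) ∧
    frameLeaf.run d ρ σ 20 = GoodPair (σ 1)
      (fun v => σ.set 13 v ∨ Boundary (σ 1) (σ.set 2) (σ.set 13) v) := by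
  have h0 : d < d + 2 := by omega
  have h1 : d + 1 < d + 2 := by omega
  have e14 : (boundary.run d ρ σ).set 14 = Boundary (σ 1) (σ.set 2) (σ.set 13) := by
    simp only [boundary, LSt.run_upd, holds_and, holds_neg, holds_mem, holds_ex, holds_nearF,
      update_lt h0, update_pair, State.set_update_self, Function.update_self]
    rfl
  have e1 : boundary.run d ρ σ 1 = σ 1 := LSt.run_frame _ rfl
  have e13 : (boundary.run d ρ σ).set 13 = σ.set 13 := State.set_congr (LSt.run_frame _ rfl)
  rw [← e14, ← e1, ← e13, frameLeaf, LSt.run_seq]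
  refine ⟨State.set_congr (LSt.run_frame _ rfl), ?_⟩
  rw [LSt.run_upd, Function.update_self]
  simp only [holds_goodF h0 h1, update_pair]

theorem run_classes :
    classes.run d ρ σ 23 = SameClass (σ 1) (fun v => σ.set 13 v ∨ σ.set 14 v) (σ 15) ∧
    classes.run d ρ σ 24 = SameClass (σ 1) (fun v => σ.set 13 v ∨ σ.set 14 v) (σ 16) := by
  have h0 : d < d + 2 := by omega
  have h1 : d + 1 < d + 2 := by omega
  simp only [classes, LSt.run_seq, LSt.run_upd, holds_sameF h0 h1, update_pair]
  constructor <;> simp [State.set_update_ne, Function.update_of_ne]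

theorem holds_transF {k : ℕ} : Holds σ d ρ (transF k) ↔
    ∀ u v w, σ k u v → σ k v w → σ k u w := by
  have h0 : d < d + 1 + 1 := by omega
  have h1 : d + 1 < d + 1 + 1 := by omega
  simp only [transF, holds_all, holds_imp, holds_rel, update_lt h0, update_lt h1, update_pair,
    Function.update_self]

theorem holds_testF : Holds σ d ρ testF ↔ (¬ ∃ v, σ.set 12 v) ∧ (∀ v, σ.set 13 v → σ.set 2 v) ∧
    (∀ u v, σ.set 14 u → σ.set 14 v → Near (σ 1) u v) ∧
    (∀ u v w, σ 23 u v → σ 23 v w → σ 23 u w) ∧ (∀ u v w, σ 24 u v → σ 24 v w → σ 24 u w) ∧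
    ∀ u v, σ.set 13 u ∨ σ.set 14 u → σ.set 13 v ∨ σ.set 14 v →
      (Near (σ 1) u v ↔ σ 23 u v ∨ σ 24 u v) := by
  have h0 : d < d + 1 := by omega
  simp only [testF, holds_and, holds_or, holds_neg, holds_ex, holds_all, holds_imp, holds_mem,
    holds_rel, holds_transF, holds_leafF, holds_nearF, update_pair, Function.update_self,
    ← iff_iff_implies_and_implies]
  rfl

theorem run_choose : (choose.run d ρ σ).set 8 = σ.set 13 ∧ (choose.run d ρ σ).set 9 = σ.set 14 ∧
    choose.run d ρ σ 10 = σ 23 ∧ choose.run d ρ σ 11 = σ 24 ∧ ∀ v, (choose.run d ρ σ).set 12 v := by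
  simp only [choose, LSt.run_seq, LSt.run_upd, holds_mem, holds_rel, holds_eq, update_pair]
  refine ⟨?_, ?_, ?_, ?_, ?_⟩ <;>
    simp [State.set_update_self, State.set_update_ne, Function.update_of_ne] <;> rfl

/-- The invariant of the search for a leaf. -/
structure SearchInv (D : Fin n → Fin n → Prop) (S : Fin n → Prop) (τ : State n) : Prop where
  arcs : τ 1 = D
  alive : τ.set 2 = S
  leaf : (∃ v, τ.set 12 v) → Leaf D S (τ.set 8) (τ.set 9) (τ 10) (τ 11)

/-- The component and coloring computed here are instances of the `A'`, `P₀`, `P₁` over which the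
hypothesis quantifies. The test also asks that nothing was found before, so that the first find is
kept. -/
theorem run_candidate {D : Fin n → Fin n → Prop} {S : Fin n → Prop} {c c' p e : ℕ} (hc : c < d)
    (hc' : c' < d) (hp : p < d) (he : e < d) (h : SearchInv D S σ) :
    SearchInv D S ((candidate c c' p e).run d ρ σ) ∧
    (((∃ v, σ.set 12 v) ∨ (S (ρ p) ∧ ∀ A' P₀ P₁,
      IsComponent D S (fun z => Near D z (ρ c) ∧ Near D z (ρ c')) (ρ p) A' →
      IsColoring D (GoodPair D fun v => A' v ∨ Boundary D S A' v) (ρ p) (ρ e) P₀ P₁ →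
      Certified D S A' P₀ P₁)) → ∃ v, ((candidate c c' p e).run d ρ σ).set 12 v) := by
  have hA := run_grow (σ := σ) (ρ := ρ) hc hc' hp
  rw [h.arcs, h.alive] at hA
  set σ₁ := (grow c c' p).run d ρ σ with hσ₁
  have f₁ : ∀ k, ((grow c c' p) d).writes k = false → σ₁ k = σ k := fun k hk => LSt.run_frame _ hk
  obtain ⟨hB, hG⟩ := run_frameLeaf (σ := σ₁) (d := d) (ρ := ρ)
  set σ₂ := frameLeaf.run d ρ σ₁ with hσ₂
  have f₂ : ∀ k, (frameLeaf d).writes k = false → σ₂ k = σ₁ k := fun k hk => LSt.run_frame _ hk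
  have hP := run_color (σ := σ₂) (ρ := ρ) hp he
  set σ₃ := (color p e).run d ρ σ₂ with hσ₃
  have f₃ : ∀ k, ((color p e) d).writes k = false → σ₃ k = σ₂ k := fun k hk => LSt.run_frame _ hk
  obtain ⟨h23, h24⟩ := run_classes (σ := σ₃) (d := d) (ρ := ρ)
  set σ₄ := classes.run d ρ σ₃ with hσ₄
  have f₄ : ∀ k, (classes d).writes k = false → σ₄ k = σ₃ k := fun k hk => LSt.run_frame _ hk
  have hrun : (candidate c c' p e).run d ρ σ = (LSt.when testF choose).run d ρ σ₄ := rfl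
  have a₁ : σ₁ 1 = D := (f₁ 1 rfl).trans h.arcs
  have s₁ : σ₁.set 2 = S := (State.set_congr (f₁ 2 rfl)).trans h.alive
  rw [a₁, s₁] at hB hG
  have a₂ : σ₂ 1 = D := (f₂ 1 rfl).trans a₁
  have a₃ : σ₃ 1 = D := (f₃ 1 rfl).trans a₂
  have a₄ : σ₄ 1 = D := (f₄ 1 rfl).trans a₃
  have s₄ : σ₄.set 2 = S := (State.set_congr ((f₄ 2 rfl).trans ((f₃ 2 rfl).trans (f₂ 2 rfl)))).trans s₁
  have A₃ : σ₃.set 13 = σ₁.set 13 := State.set_congr ((f₃ 13 rfl).trans (f₂ 13 rfl))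
  have A₄ : σ₄.set 13 = σ₁.set 13 := (State.set_congr (f₄ 13 rfl)).trans A₃
  have B₃ : σ₃.set 14 = Boundary D S (σ₁.set 13) := (State.set_congr (f₃ 14 rfl)).trans hB
  have B₄ : σ₄.set 14 = Boundary D S (σ₁.set 13) := (State.set_congr (f₄ 14 rfl)).trans B₃
  rw [a₂, hG] at hP
  rw [a₃, A₃, B₃] at h23 h24
  have old : ∀ k, ((grow c c' p) d).writes k = false → (frameLeaf d).writes k = false →
      ((color p e) d).writes k = false → (classes d).writes k = false → σ₄ k = σ k :=
    fun k h1 h2 h3 h4 => (f₄ k h4).trans ((f₃ k h3).trans ((f₂ k h2).trans (f₁ k h1)))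
  have o8 : σ₄.set 8 = σ.set 8 := State.set_congr (old 8 rfl rfl rfl rfl)
  have o9 : σ₄.set 9 = σ.set 9 := State.set_congr (old 9 rfl rfl rfl rfl)
  have o10 : σ₄ 10 = σ 10 := old 10 rfl rfl rfl rfl
  have o11 : σ₄ 11 = σ 11 := old 11 rfl rfl rfl rfl
  have o12 : σ₄.set 12 = σ.set 12 := State.set_congr (old 12 rfl rfl rfl rfl)
  have htest : Holds σ₄ d ρ testF ↔ (¬ ∃ v, σ.set 12 v) ∧ (∀ v, σ₁.set 13 v → S v) ∧
      Certified D S (σ₁.set 13) (σ₃ 15) (σ₃ 16) := by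
    rw [holds_testF, a₄, s₄, A₄, B₄, o12, h23, h24]
    rfl
  rw [hrun]
  clear_value σ₁ σ₂ σ₃ σ₄
  by_cases ht : Holds σ₄ d ρ testF
  · rw [LSt.run_when_pos ht]
    obtain ⟨c8, c9, c10, c11, c12⟩ := run_choose (σ := σ₄) (d := d) (ρ := ρ)
    refine ⟨⟨(LSt.run_frame _ rfl).trans a₄, (State.set_congr (LSt.run_frame _ rfl)).trans s₄,
      fun _ => ?_⟩, fun _ => ⟨ρ p, c12 _⟩⟩
    rw [c8, c9, c10, c11, A₄, B₄, h23, h24]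
    have := htest.1 ht
    exact this.2.2.leaf this.2.1 ⟨ρ p, hA.start⟩
  · rw [LSt.run_when_neg ht]
    refine ⟨⟨a₄, s₄, ?_⟩, ?_⟩
    · rw [o8, o9, o10, o11, o12]
      exact h.leaf
    · rw [o12]
      rintro (hf | ⟨hS, hcert⟩)
      · exact hf
      · by_contra hf
        exact ht (htest.2 ⟨hf, hA.least S hS fun _ v _ hv _ _ => hv, hcert _ _ _ hA hP⟩)

/-- The search finds a leaf if there is a star. -/
theorem run_search {D : Fin n → Fin n → Prop} {S : Fin n → Prop} (hD : σ 1 = D)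
    (hS : σ.set 2 = S) : SearchInv D S (search.run d ρ σ) ∧
      ((∃ c c' p e, S p ∧ ∀ A' P₀ P₁, IsComponent D S (fun z => Near D z c ∧ Near D z c') p A' →
        IsColoring D (GoodPair D fun v => A' v ∨ Boundary D S A' v) p e P₀ P₁ →
        Certified D S A' P₀ P₁) → ∃ v, (search.run d ρ σ).set 12 v) := by
  have h12 : ((LSt.upd 12 fun x _ => neg (eq x x)).run d ρ σ).set 12 = fun _ => False := by
    simp only [LSt.run_upd, holds_neg, holds_eq, State.set_update_self, not_true]
  have h0 : SearchInv D S ((LSt.upd 12 fun x _ => neg (eq x x)).run d ρ σ) :=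
    ⟨(LSt.run_frame _ rfl).trans hD, (State.set_congr (LSt.run_frame _ rfl)).trans hS, by
      rw [h12]; rintro ⟨_, h⟩; exact h.elim⟩
  have key := LSt.run_up_search (p := fun c => .up fun c' => .up fun p => .up fun e =>
    candidate c c' p e) (d := d) (ρ := ρ) (SearchInv D S) (fun τ => ∃ v, τ.set 12 v)
    (fun c => ∃ c' p e, S p ∧ ∀ A' P₀ P₁, IsComponent D S (fun z => Near D z c ∧ Near D z c') p A' →
        IsColoring D (GoodPair D fun v => A' v ∨ Boundary D S A' v) p e P₀ P₁ →
        Certified D S A' P₀ P₁) (fun c τ hτ => ?_) h0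
  · exact ⟨key.1, fun h => key.2 (.inr h)⟩
  refine LSt.run_up_search _ (fun τ => ∃ v, τ.set 12 v) _ (fun c' τ hτ => ?_) hτ
  refine LSt.run_up_search _ (fun τ => ∃ v, τ.set 12 v) _ (fun p τ hτ => ?_) hτ
  refine LSt.run_up_search _ (fun τ => ∃ v, τ.set 12 v) _ (fun e τ hτ => ?_) hτ
  have := run_candidate (d := d + 1 + 1 + 1 + 1)
    (ρ := Function.update (Function.update (Function.update (Function.update ρ d c) (d + 1) c')
      (d + 1 + 1) p) (d + 1 + 1 + 1) e) (show d < d + 1 + 1 + 1 + 1 by omega)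
    (show d + 1 < d + 1 + 1 + 1 + 1 by omega) (show d + 1 + 1 < d + 1 + 1 + 1 + 1 by omega)
    (show d + 1 + 1 + 1 < d + 1 + 1 + 1 + 1 by omega) hτ
  have e1 : d ≠ d + 1 := by omega
  have e2 : d ≠ d + 1 + 1 := by omega
  have e3 : d ≠ d + 1 + 1 + 1 := by omega
  have e4 : d + 1 ≠ d + 1 + 1 := by omega
  have e5 : d + 1 ≠ d + 1 + 1 + 1 := by omega
  have e6 : d + 1 + 1 ≠ d + 1 + 1 + 1 := by omega
  simp only [Function.update_self, Function.update_of_ne e1, Function.update_of_ne e2,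
    Function.update_of_ne e3, Function.update_of_ne e4, Function.update_of_ne e5,
    Function.update_of_ne e6] at this
  exact this

end SearchProgram

end KernelDE

namespace KernelDE

/-! ### Stages forwards, extension backwards -/

section MainProgram

open LFm

variable {n : ℕ} {σ : State n} {d : ℕ} {ρ : ℕ → Fin n}

/-- A stage: a leaf is searched and treated. -/
def stage (j : ℕ) : LSt := .seq search (.when (ex fun x => mem 12 x) (solveLeaf j))

/-- The kernel is extended to the leaf of stage `j`. -/
def extend (j : ℕ) : LSt :=
  .upd 7 fun x _ => or (mem 7 x) (and (rel 3 j x) (or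
    (ex fun c => and (mem 7 c) (and (rel 4 j c) (rel 5 c x)))
    (and (neg (ex fun c => and (mem 7 c) (rel 4 j c))) (mem 6 x))))

/-- The computation of a kernel. -/
def kernelProgram : LSt :=
  .seq (.upd 2 fun x _ => eq x x) (.seq (.up stage) (.down extend))

theorem run_extend {j : ℕ} (hj : j < d) : ((extend j).run d ρ σ).set 7 =
    Extend (σ 3 (ρ j)) (σ 4 (ρ j)) (σ 5) (σ.set 6) (σ.set 7) := by
  have h0 : d < d + 2 := by omega
  have h1 : j < d + 2 := by omega
  have h2 : j ≠ d + 1 := by omega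
  simp only [extend, LSt.run_upd, holds_or, holds_and, holds_neg, holds_mem, holds_rel, holds_ex,
    update_lt h0, update_lt h1, update_pair, Function.update_self, Function.update_of_ne hj.ne,
    Function.update_of_ne h2, State.set_update_self]
  rfl

theorem Extend.congr {V : Type*} {A Cs KN KN' K : V → Prop} {KK KK' : V → V → Prop}
    (h : ∀ v, A v → (∀ c, KK c v ↔ KK' c v) ∧ (KN v ↔ KN' v)) :
    Extend A Cs KK KN K = Extend A Cs KK' KN' K := by
  funext v
  refine propext (or_congr_right (and_congr_right fun hv => ?_))
  obtain ⟨h1, h2⟩ := h v hv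
  simp only [h1, h2]

/-- The invariant of the stages: `R j` holds the vertices that are untreated before stage `j`. -/
structure StageInv (D : Fin n → Fin n → Prop) (R : ℕ → Fin n → Prop) (i : ℕ) (τ : State n) :
    Prop where
  arcs : τ 1 = D
  none : τ.set 7 = fun _ => False
  all : R 0 = fun _ => True
  alive : R i = τ.set 2
  anti : ∀ j < i, ∀ v, R (j + 1) v → R j v
  step : ∀ j : Fin n, j < i → ∀ K, KernelOn D (R (j + 1)) K →
    KernelOn D (R j) (Extend (τ 3 j) (τ 4 j) (τ 5) (τ.set 6) K)
  treated : ∀ j : Fin n, j < i → ∀ v, τ 3 j v → ¬ R (j + 1) v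
  rows : ∀ j : Fin n, i ≤ j → ∀ v, ¬ τ 3 j v ∧ ¬ τ 4 j v
  columns : ∀ v, R i v → (∀ c, ¬ τ 5 c v) ∧ ¬ τ.set 6 v
  -- Each stage removes at least one vertex, so nothing is left after `n` stages.
  progress : (∀ v, ¬ R i v) ∨ i + {v | R i v}.ncard ≤ n

/-- Later stages write only into columns of live vertices, so they leave the records of earlier
private parts intact. -/
theorem StageInv.not_alive {D : Fin n → Fin n → Prop} {R : ℕ → Fin n → Prop} {i : ℕ} {τ : State n}
    (h : StageInv D R i τ) {j : Fin n} (hj : j < i) {v : Fin n} (hv : τ 3 j v) : ¬ R i v := by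
  have mono : ∀ k, j + 1 + k ≤ i → R (j + 1 + k) v → R (j + 1) v := by
    intro k
    induction k with
    | zero => exact fun _ => id
    | succ k ih => exact fun hk h' => ih (by omega) (h.anti _ (by omega) v h')
  intro h'
  obtain ⟨k, rfl⟩ := Nat.exists_eq_add_of_le (show (j : ℕ) + 1 ≤ i from hj)
  exact h.treated j hj v hv (mono k le_rfl h')

theorem StageInv.round {D : Fin n → Fin n → Prop} (hD : CliqueExtremes D)
    (hstar : ∀ S : Fin n → Prop, (∃ v, S v) → ∃ (L : Type) (A C : Fin n → Prop) (x y : Fin n → L),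
      Star D S A C x y) {R : ℕ → Fin n → Prop} {i : ℕ} {τ : State n}
    (h : StageInv D R i τ) {j : ℕ} (hj : j < d) (hi : ρ j = i) :
    ∃ R', StageInv D R' (i + 1) ((stage j).run d ρ τ) := by
  obtain ⟨h1, h2⟩ := run_search (d := d) (ρ := ρ) h.arcs h.alive.symm
  have f3 : search.run d ρ τ 3 = τ 3 := LSt.run_frame _ rfl
  have f4 : search.run d ρ τ 4 = τ 4 := LSt.run_frame _ rfl
  have f5 : search.run d ρ τ 5 = τ 5 := LSt.run_frame _ rfl
  have f6 : (search.run d ρ τ).set 6 = τ.set 6 := State.set_congr (LSt.run_frame _ rfl)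
  have f7 : (search.run d ρ τ).set 7 = τ.set 7 := State.set_congr (LSt.run_frame _ rfl)
  rw [stage, LSt.run_seq]
  generalize search.run d ρ τ = σ at *
  have hrow := h.rows (ρ j) hi.ge
  have lt_cases : ∀ k : Fin n, k < i + 1 → k < i ∨ k = ρ j := fun k hk =>
    (Nat.lt_succ_iff_lt_or_eq.1 hk).imp_right fun hk => Fin.ext (hk.trans hi.symm)
  have hfound : Holds σ d ρ (ex fun x => mem 12 x) ↔ ∃ v, σ.set 12 v := by
    simp only [holds_ex, holds_mem, Function.update_self]; rfl
  have ne : ∀ k : ℕ, k < i + 1 → k ≠ i + 1 := fun k hk => hk.ne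
  by_cases hf : ∃ v, σ.set 12 v
  · rw [LSt.run_when_pos (hfound.2 hf)]
    have hL := h1.leaf hf
    obtain ⟨s3, s4, s5, s6, s2, sK⟩ := run_solveLeaf (σ := σ) (ρ := ρ) hj (by rw [h1.arcs]; exact hD)
      (by rw [h1.arcs, h1.alive]; exact hL)
      (fun v => by rw [f4]; exact (hrow v).2) (fun v => by rw [f3]; exact (hrow v).1)
      (fun c v hv => by rw [f5]; exact (h.columns v (hL.subA v hv)).1 c)
      (fun v hv => by rw [f6]; exact (h.columns v (hL.subA v hv)).2) rfl
    rw [f3] at s3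
    rw [f4] at s4
    rw [f5] at s5
    rw [f6] at s6
    rw [h1.alive] at s2 sK
    rw [h1.arcs] at sK
    have a1 : (solveLeaf j).run d ρ σ 1 = D := (LSt.run_frame _ rfl).trans h1.arcs
    have a7 : ((solveLeaf j).run d ρ σ).set 7 = τ.set 7 :=
      (State.set_congr (LSt.run_frame _ rfl)).trans f7
    generalize (solveLeaf j).run d ρ σ = σ' at *
    have old3 : ∀ k, k ≠ ρ j → σ' 3 k = τ 3 k := fun k hk => by
      funext v; refine propext ((s3 k v).trans (or_iff_left fun h' => hk h'.1))
    have new3 : σ' 3 (ρ j) = σ.set 8 := by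
      funext v
      exact propext ((s3 _ v).trans ⟨fun h' => h'.elim (fun h' => absurd h' (hrow v).1) And.right,
        fun h' => .inr ⟨rfl, h'⟩⟩)
    have ne_j : ∀ k : Fin n, k < i → k ≠ ρ j := fun k hk h' => by rw [h'] at hk; omega
    refine ⟨Function.update R (i + 1) (σ'.set 2), ?_⟩
    refine ⟨a1, a7.trans h.none, ?_, Function.update_self .., ?_, ?_, ?_, ?_, ?_, ?_⟩
    · rw [Function.update_of_ne (by omega)]; exact h.all
    · intro k hk v
      rw [Function.update_of_ne (ne k hk)]
      rcases Nat.lt_succ_iff_lt_or_eq.1 hk with hk | rfl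
      · rw [Function.update_of_ne (by omega)]; exact h.anti k hk v
      · rw [Function.update_self]; exact fun hv => (s2 v hv).1
    · intro k hk K
      rw [Function.update_of_ne (ne k hk)]
      rcases lt_cases k hk with hk | rfl
      · rw [Function.update_of_ne (by omega), old3 k (ne_j k hk), s4 k (ne_j k hk),
          Extend.congr (KK' := τ 5) (KN' := τ.set 6)]
        · exact h.step k hk K
        · intro v hv
          have : ¬ σ.set 8 v := fun h' => h.not_alive hk hv (hL.subA v h')
          exact ⟨fun c => s5 c v this, s6 v this⟩
      · rw [hi, Function.update_self]; exact sK K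
    · intro k hk v
      rcases lt_cases k hk with hk | rfl
      · rw [Function.update_of_ne (by omega), old3 k (ne_j k hk)]; exact h.treated k hk v
      · rw [hi, Function.update_self, new3]; exact fun hv hv' => (s2 v hv').2 hv
    · intro k hk v
      have hk' : k ≠ ρ j := fun h' => by rw [h'] at hk; omega
      rw [old3 k hk', s4 k hk']
      exact h.rows k (by omega) v
    · rw [Function.update_self]
      intro v hv
      obtain ⟨hv1, hv2⟩ := s2 v hv
      have := h.columns v hv1
      exact ⟨fun c hc => this.1 c ((s5 c v hv2).1 hc), fun h' => this.2 ((s6 v hv2).1 h')⟩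
    · rw [Function.update_self]
      refine h.progress.imp (fun hp v hv => hp v (s2 v hv).1) fun hp => ?_
      obtain ⟨a, ha⟩ := hL.nonempty
      have : {v | σ'.set 2 v}.ncard < {v | R i v}.ncard :=
        ncard_lt_of_subset_ne (fun v hv => (s2 v hv).1) fun h' =>
          (s2 a (h' ▸ hL.subA a ha)).2 ha
      omega
  · rw [LSt.run_when_neg (mt hfound.1 hf)]
    have hS : ∀ v, ¬ R i v := fun v hv => by
      obtain ⟨L, A, C, x, y, hst⟩ := hstar (R i) ⟨v, hv⟩
      exact hf (h2 hst.exists_certified)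
    refine ⟨Function.update R (i + 1) (R i), h1.arcs, f7.trans h.none, ?_, ?_, ?_, ?_, ?_, ?_, ?_, ?_⟩
    · rw [Function.update_of_ne (by omega)]; exact h.all
    · rw [Function.update_self, h1.alive]
    · intro k hk v
      rw [Function.update_of_ne (ne k hk)]
      rcases Nat.lt_succ_iff_lt_or_eq.1 hk with hk | rfl
      · rw [Function.update_of_ne (by omega)]; exact h.anti k hk v
      · rw [Function.update_self]; exact id
    · intro k hk K
      rw [Function.update_of_ne (ne k hk), f3, f4, f5, f6]
      rcases lt_cases k hk with hk | rfl
      · rw [Function.update_of_ne (by omega)]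
        exact h.step k hk K
      · rw [hi, Function.update_self]
        have : Extend (τ 3 (ρ j)) (τ 4 (ρ j)) (τ 5) (τ.set 6) K = K :=
          funext fun v => propext (or_iff_left fun h' => (hrow v).1 h'.1)
        rw [this]
        exact id
    · intro k hk v
      rw [f3]
      rcases lt_cases k hk with hk | rfl
      · rw [Function.update_of_ne (by omega)]; exact h.treated k hk v
      · exact fun hv => absurd hv (hrow v).1
    · intro k hk v
      rw [f3, f4]
      exact h.rows k (by omega) v
    · rw [Function.update_self]
      exact fun v hv => absurd hv (hS v)
    · rw [Function.update_self]
      exact .inl hS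

/-- The program computes a kernel if every nonempty set of vertices contains a star. -/
theorem run_kernelProgram {D : Fin n → Fin n → Prop} (hD : CliqueExtremes D)
    (hstar : ∀ S : Fin n → Prop, (∃ v, S v) → ∃ (L : Type) (A C : Fin n → Prop) (x y : Fin n → L),
      Star D S A C x y) (h1 : σ 1 = D) (h : ∀ k, k ≠ 1 → ∀ u v, ¬ σ k u v) :
    KernelOn D (fun _ => True) ((kernelProgram.run d ρ σ).set 7) := by
  rw [kernelProgram, LSt.run_seq, LSt.run_seq]
  have h2 : ((LSt.upd 2 fun x _ => eq x x).run d ρ σ).set 2 = fun _ => True := by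
    simp only [LSt.run_upd, holds_eq, State.set_update_self]
  have f : ∀ k, k ≠ 2 → (LSt.upd 2 fun x _ => eq x x).run d ρ σ k = σ k := fun k hk => by
    rw [LSt.run_upd, Function.update_of_ne hk]
  generalize (LSt.upd 2 fun x _ => eq x x).run d ρ σ = τ at *
  have emp : ∀ k, k ≠ 1 → k ≠ 2 → ∀ u v, ¬ τ k u v := fun k hk hk' => by rw [f k hk']; exact h k hk
  obtain ⟨R, hR⟩ := LSt.run_up_induct (p := stage) (d := d) (ρ := ρ) (σ := τ)
    (fun i τ => ∃ R, StageInv D R i τ) ⟨fun _ _ => True,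
      { arcs := (f 1 (by omega)).trans h1
        none := funext fun v => eq_false (emp 7 (by omega) (by omega) v v)
        all := rfl
        alive := h2.symm
        anti := by simp
        step := by simp
        treated := by simp
        rows := fun j _ v => ⟨emp 3 (by omega) (by omega) j v, emp 4 (by omega) (by omega) j v⟩
        columns := fun v _ => ⟨fun c => emp 5 (by omega) (by omega) c v,
          emp 6 (by omega) (by omega) v v⟩
        progress := .inr (by simp) }⟩
    fun i hi τ ⟨R, hR⟩ => hR.round hD hstar (Nat.lt_succ_self d) (by simp)
  generalize (LSt.up stage).run d ρ τ = τ₁ at hR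
  have hn : ∀ v, ¬ R n v := by
    refine hR.progress.elim id fun hp v hv => ?_
    have : 0 < {v | R n v}.ncard := (Set.ncard_pos).2 ⟨v, hv⟩
    omega
  -- The empty set is a kernel of the empty digraph after all stages; undoing them in reverse order
  -- leads back to all vertices.
  have key := LSt.run_down_induct (p := extend) (d := d) (ρ := ρ) (σ := τ₁)
    (fun i τ => τ 3 = τ₁ 3 ∧ τ 4 = τ₁ 4 ∧ τ 5 = τ₁ 5 ∧ τ 6 = τ₁ 6 ∧ KernelOn D (R i) (τ.set 7))
    ⟨rfl, rfl, rfl, rfl, by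
      rw [hR.none]
      exact ⟨fun _ h => h.elim, fun _ _ h => h.elim, fun u hu => absurd hu (hn u)⟩⟩
    fun i hi τ ⟨e3, e4, e5, e6, hK⟩ =>
      ⟨(LSt.run_frame _ rfl).trans e3, (LSt.run_frame _ rfl).trans e4,
        (LSt.run_frame _ rfl).trans e5, (LSt.run_frame _ rfl).trans e6, by
          rw [run_extend (Nat.lt_succ_self d), e3, e4, e5, State.set_congr e6, Function.update_self]
          exact hR.step ⟨i, hi⟩ hi _ hK⟩
  rw [← hR.all]
  exact key.2.2.2.2

theorem kernelProgram_wf : (kernelProgram 0).wf 0 = true := by decide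

end MainProgram

end KernelDE

namespace KernelDE

/-! ### Extreme vertices of cliques -/

section Cliques

variable {V : Type*} {D : Digraph V} {G : SimpleGraph V}

theorem near_iff (hD : IsSuperOrientation D G) (u v : V) :
    Near D.Adj u v ↔ u = v ∨ G.Adj u v := by
  rw [hD]; rfl

/-- Inside a clique the transitive closure of the one-way arcs is a strict order. A vertex with no
one-way arc to the others receives an arc from each of them; dually for no one-way arc from the
others. -/
theorem CliqueAcyclic.cliqueExtremes [Finite V] (h : CliqueAcyclic D G) (hD : IsSuperOrientation D G) :
    CliqueExtremes D.Adj := by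
  rintro Q ⟨q, hq⟩ hQ
  have hC : G.IsClique {v | Q v} := fun u hu v hv huv =>
    ((near_iff hD u v).1 (hQ u v hu hv)).resolve_left huv
  set r : V → V → Prop :=
    Relation.TransGen fun u v => u ∈ {v | Q v} ∧ v ∈ {v | Q v} ∧ OneWay D u v with hr
  have : Std.Irrefl r := ⟨h _ hC⟩
  have : IsTrans V r := ⟨fun _ _ _ => Relation.TransGen.trans⟩
  constructor
  · obtain ⟨e, he, hmin⟩ := (Finite.wellFounded_of_trans_of_irrefl (Function.swap r)).has_min
      {v | Q v} ⟨q, hq⟩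
    refine ⟨e, he, fun g hg => ?_⟩
    rcases hQ g e hg he with h' | h' | h'
    · exact .inl h'
    · exact .inr h'
    · by_contra hcon
      push Not at hcon
      exact hmin g hg (.single ⟨he, hg, h', hcon.2⟩)
  · obtain ⟨e, he, hmin⟩ := (Finite.wellFounded_of_trans_of_irrefl r).has_min {v | Q v} ⟨q, hq⟩
    refine ⟨e, he, fun g hg => ?_⟩
    rcases hQ g e hg he with h' | h' | h'
    · exact .inl h'
    · by_contra hcon
      push Not at hcon
      exact hmin g hg (.single ⟨hg, he, h', hcon.2⟩)
    · exact .inr h'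

end Cliques

/-! ### Arcs of directed paths -/

section Paths

variable {W : Type*}

theorem exists_crossing {p : List W} {Z : Set W} {a b : W} (ha : a ∈ p) (haZ : a ∈ Z) (hb : b ∈ p)
    (hbZ : b ∉ Z) : ∃ c d, (c, d) ∈ pathArcs p ∧ (c ∈ Z ∧ d ∉ Z ∨ c ∉ Z ∧ d ∈ Z) := by
  induction p generalizing a b with
  | nil => simp at ha
  | cons x t ih =>
    cases t with
    | nil =>
      simp only [List.mem_singleton] at ha hb
      exact absurd (hb ▸ ha ▸ haZ) hbZ
    | cons y t =>
      by_cases hxy : x ∈ Z ↔ y ∈ Z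
      · have lift : ∀ z, z ∈ x :: y :: t → ∃ z' ∈ y :: t, z' ∈ Z ↔ z ∈ Z := by
          intro z hz
          rcases List.mem_cons.1 hz with rfl | hz
          · exact ⟨y, List.mem_cons_self, hxy.symm⟩
          · exact ⟨z, hz, Iff.rfl⟩
        obtain ⟨a', ha', haa⟩ := lift a ha
        obtain ⟨b', hb', hbb⟩ := lift b hb
        obtain ⟨c, d, hcd, h⟩ := ih ha' (haa.2 haZ) hb' (mt hbb.1 hbZ)
        exact ⟨c, d, List.mem_cons_of_mem _ hcd, h⟩
      · exact ⟨x, y, List.mem_cons_self, by tauto⟩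

theorem mem_pathArcs_iff {p : List W} {a b : W} :
    (a, b) ∈ pathArcs p ↔ ∃ i, p[i]? = some a ∧ p[i + 1]? = some b := by
  simp only [pathArcs, Set.mem_ofPred_eq, List.mem_iff_getElem?, List.getElem?_zip_eq_some,
    List.getElem?_tail]

theorem pathArcs_left {p : List W} {a b : W} (h : (a, b) ∈ pathArcs p) : a ∈ p :=
  (List.of_mem_zip h).1

theorem pathArcs_right {p : List W} {a b : W} (h : (a, b) ∈ pathArcs p) : b ∈ p :=
  List.mem_of_mem_tail (List.of_mem_zip h).2

theorem pathArcs_adj {T : Digraph W} {p : List W} (hp : IsDirectedPath T p) {a b : W}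
    (h : (a, b) ∈ pathArcs p) : T.Adj a b := by
  obtain ⟨i, hi, hi'⟩ := mem_pathArcs_iff.1 h
  obtain ⟨h1, rfl⟩ := List.getElem?_eq_some_iff.1 hi
  obtain ⟨h2, rfl⟩ := List.getElem?_eq_some_iff.1 hi'
  exact List.isChain_iff_getElem.1 hp.2.2 i h2

theorem pathArcs_right_unique {p : List W} (hp : p.Nodup) {a b b' : W} (h : (a, b) ∈ pathArcs p)
    (h' : (a, b') ∈ pathArcs p) : b = b' := by
  obtain ⟨i, hi, hi'⟩ := mem_pathArcs_iff.1 h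
  obtain ⟨j, hj, hj'⟩ := mem_pathArcs_iff.1 h'
  obtain rfl := (List.getElem?_inj (List.getElem?_eq_some_iff.1 hi).1 hp).1 (hi.trans hj.symm)
  exact Option.some.inj (hi'.symm.trans hj')

theorem pathArcs_left_unique {p : List W} (hp : p.Nodup) {a a' b : W} (h : (a, b) ∈ pathArcs p)
    (h' : (a', b) ∈ pathArcs p) : a = a' := by
  obtain ⟨i, hi, hi'⟩ := mem_pathArcs_iff.1 h
  obtain ⟨j, hj, hj'⟩ := mem_pathArcs_iff.1 h'
  have := (List.getElem?_inj (List.getElem?_eq_some_iff.1 hi').1 hp).1 (hi'.trans hj'.symm)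
  obtain rfl : i = j := by omega
  exact Option.some.inj (hi.symm.trans hj)

end Paths

/-! ### Branches of a tree -/

section Branches

variable {W : Type*} {E : SimpleGraph W}

theorem eq_univ_of_no_exit (hE : E.Preconnected) {Z : Set W} (hne : Z.Nonempty)
    (hZ : ∀ a ∈ Z, ∀ b, E.Adj a b → b ∈ Z) : Z = Set.univ := by
  obtain ⟨a, ha⟩ := hne
  refine Set.eq_univ_of_forall fun b => ?_
  obtain ⟨w⟩ := hE a b
  induction w with
  | nil => exact ha
  | cons h _ ih => exact ih (hZ _ ha _ h)

/-- Every edge that leaves `Z` leads from `w` to `v`. -/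
def Exits (E : SimpleGraph W) (Z : Set W) (w v : W) : Prop :=
  ∀ a ∈ Z, ∀ b ∉ Z, E.Adj a b → a = w ∧ b = v

/-- The side of an edge of a tree. -/
theorem exists_side (hE : E.IsAcyclic) {u w : W} (h : E.Adj u w) :
    ∃ Z : Set W, u ∈ Z ∧ w ∉ Z ∧ Exits E Z u w := by
  have hb := SimpleGraph.isBridge_iff.1 (SimpleGraph.isAcyclic_iff_forall_adj_isBridge.1 hE h)
  refine ⟨{x | (E \ SimpleGraph.fromEdgeSet {s(u, w)}).Reachable u x}, .refl _, hb, ?_⟩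
  intro a ha b hb' hab
  by_cases he : s(a, b) = s(u, w)
  · rcases Sym2.eq_iff.1 he with h' | ⟨-, rfl⟩
    · exact h'
    · exact absurd (SimpleGraph.Reachable.refl _) hb'
  · refine absurd (SimpleGraph.Reachable.trans ha (SimpleGraph.Adj.reachable ?_)) hb'
    simp [hab, he]

/-- The vertices that are `w` or lie in some side at `w` are closed under adjacency, hence are all
vertices. -/
theorem exists_side_mem (hE : E.IsTree) {w x : W} (hx : x ≠ w) :
    ∃ u, E.Adj u w ∧ ∃ Z : Set W, x ∈ Z ∧ u ∈ Z ∧ w ∉ Z ∧ Exits E Z u w := by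
  have := eq_univ_of_no_exit hE.1.preconnected (Z := {x | x = w ∨ ∃ u, E.Adj u w ∧
    ∃ Z : Set W, x ∈ Z ∧ u ∈ Z ∧ w ∉ Z ∧ Exits E Z u w}) ⟨w, .inl rfl⟩ ?_
  · exact (this.symm.subset (Set.mem_univ x)).resolve_left hx
  · rintro a (rfl | ⟨u, hu, Z, haZ, huZ, hwZ, hZ⟩) b hab
    · obtain ⟨Z, h1, h2, h3⟩ := exists_side hE.2 hab.symm
      exact .inr ⟨b, hab.symm, Z, h1, h1, h2, h3⟩
    · by_cases hb : b ∈ Z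
      · exact .inr ⟨u, hu, Z, hb, huZ, hwZ, hZ⟩
      · exact .inl (hZ a haZ b hb hab).2

/-- For a nonempty family of directed paths of a directed tree there is a branch that contains a
path of the family, and whose root lies on all of these. -/
theorem exists_branch [Finite W] {T : Digraph W} (hT : IsDirectedTree T) {F : Set (List W)}
    (hF : F.Nonempty) (hP : ∀ p ∈ F, IsDirectedPath T p) :
    ∃ (U : Set W) (w v : W), Exits T.toSimpleGraphInclusive U w v ∧ (∃ p ∈ F, ∀ a ∈ p, a ∈ U) ∧
      ∀ p ∈ F, (∀ a ∈ p, a ∈ U) → w ∈ p := by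
  obtain ⟨-, hE⟩ := id hT
  have main : ∀ k, ∀ (U : Set W) (w v : W), U.ncard ≤ k → w ∈ U →
      Exits T.toSimpleGraphInclusive U w v → (∃ p ∈ F, ∀ a ∈ p, a ∈ U) →
      ∃ (U : Set W) (w v : W), Exits T.toSimpleGraphInclusive U w v ∧ (∃ p ∈ F, ∀ a ∈ p, a ∈ U) ∧
        ∀ p ∈ F, (∀ a ∈ p, a ∈ U) → w ∈ p := by
    intro k
    induction k with
    | zero =>
      intro U w v hk hw
      have : 0 < U.ncard := (Set.ncard_pos).2 ⟨w, hw⟩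
      omega
    | succ k ih =>
      intro U w v hk hw hU hex
      -- A path inside `U` that misses the root lies on one side `Z` of it; `Z ∩ U` is a smaller
      -- branch whose root is the neighbor `u` of `w` in `Z`.
      by_cases hall : ∀ p ∈ F, (∀ a ∈ p, a ∈ U) → w ∈ p
      · exact ⟨U, w, v, hU, hex, hall⟩
      push Not at hall
      obtain ⟨p, hpF, hpU, hwp⟩ := hall
      obtain ⟨a, ha⟩ := List.exists_mem_of_ne_nil p (hP p hpF).1
      obtain ⟨u, huw, Z, haZ, huZ, hwZ, hZ⟩ := exists_side_mem hE (x := a) (w := w)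
        (fun h => hwp (h ▸ ha))
      have hpZ : ∀ b ∈ p, b ∈ Z := by
        intro b hb
        by_contra hbZ
        obtain ⟨c, d, hcd, h⟩ := exists_crossing ha haZ hb hbZ
        have hadj := pathArcs_adj (hP p hpF) hcd
        have hne : c ≠ d := by rintro rfl; tauto
        rcases h with ⟨hc, hd⟩ | ⟨hc, hd⟩
        · exact hwp ((hZ c hc d hd ⟨hne, .inl hadj⟩).2 ▸ pathArcs_right hcd)
        · exact hwp ((hZ d hd c hc ⟨hne.symm, .inr hadj⟩).2 ▸ pathArcs_left hcd)
      have hZU : Exits T.toSimpleGraphInclusive (Z ∩ U) u w := by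
        rintro a ⟨haZ, haU⟩ b hb hab
        by_cases hbZ : b ∈ Z
        · exact absurd ((hU a haU b (fun h => hb ⟨hbZ, h⟩) hab).1 ▸ haZ) hwZ
        · exact hZ a haZ b hbZ hab
      have huU : u ∈ U := by
        by_contra huU
        have := eq_univ_of_no_exit hE.1.preconnected (Z := Z ∩ U) ⟨a, haZ, hpU a ha⟩
          fun a ha b hab => by
            by_contra hb
            exact huU ((hZU a ha b hb hab).1 ▸ ha.2)
        exact hwZ (this.symm.subset (Set.mem_univ w)).1
      refine ih (Z ∩ U) u w ?_ ⟨huZ, huU⟩ hZU ⟨p, hpF, fun a ha => ⟨hpZ a ha, hpU a ha⟩⟩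
      have : (Z ∩ U).ncard < U.ncard :=
        Set.ncard_lt_ncard ⟨Set.inter_subset_right, fun h => hwZ (h hw).1⟩
      omega
  obtain ⟨p, hp⟩ := hF
  obtain ⟨w, hw⟩ := List.exists_mem_of_ne_nil p (hP p hp).1
  exact main _ Set.univ w w le_rfl (Set.mem_univ w) (fun _ _ b hb => absurd (Set.mem_univ b) hb)
    ⟨p, hp, fun _ _ => Set.mem_univ _⟩

end Branches

/-! ### Stars in directed edge graphs -/

section Stars

open Classical in
/-- The value at `p` of a functional relation; `p` itself where it has no value. -/
noncomputable def label {V W : Type*} (f : V → W → Prop) (p : V) : W ⊕ V :=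
  if h : ∃ z, f p z then .inl h.choose else .inr p

theorem label_of {V W : Type*} {f : V → W → Prop} {p : V} (hf : ∀ z z', f p z → f p z' → z = z')
    {z : W} (h : f p z) : label f p = .inl z := by
  have hex : ∃ z, f p z := ⟨z, h⟩
  rw [label, dif_pos hex, hf _ _ hex.choose_spec h]

theorem label_eq_inl {V W : Type*} {f : V → W → Prop} {p : V} {z : W} (h : label f p = .inl z) :
    f p z := by
  unfold label at h
  split_ifs at h with hex
  exact Sum.inl.inj h ▸ hex.choose_spec

theorem eq_or_of_label_eq {V W : Type*} {f : V → W → Prop} {p q : V} (h : label f p = label f q) :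
    p = q ∨ ∃ z, f p z ∧ f q z := by
  cases hq : label f q with
  | inl z => exact .inr ⟨z, label_eq_inl (h.trans hq), label_eq_inl hq⟩
  | inr q' =>
    have hp := h.trans hq
    unfold label at hp hq
    split_ifs at hp hq
    exact .inl (Sum.inr.inj (hp.trans hq.symm))

/-- The labels are the tail of the arc entering the root and the head of the arc leaving it. A path
that starts or ends at the root gets a private value for the missing label. -/
theorem exists_star {V : Type} {D : Digraph V} {G : SimpleGraph V} (hG : IsDEGraph G)
    (hD : IsSuperOrientation D G) (S : V → Prop) (hS : ∃ v, S v) :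
    ∃ (L : Type) (A C : V → Prop) (x y : V → L), Star D.Adj S A C x y := by
  obtain ⟨W, _, T, P, hT, hP, hadj⟩ := hG
  have hnear : ∀ p q, Near D.Adj p q ↔ p = q ∨ (pathArcs (P p) ∩ pathArcs (P q)).Nonempty := by
    intro p q
    rw [near_iff hD, hadj]
    tauto
  obtain ⟨s, hs⟩ := hS
  obtain ⟨U, w, v, hU, hex, hroot⟩ := exists_branch hT (F := P '' {p | S p}) ⟨_, s, hs, rfl⟩
    (by rintro _ ⟨p, -, rfl⟩; exact hP p)
  set A : V → Prop := fun p => S p ∧ ∀ a ∈ P p, a ∈ U with hA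
  set C : V → Prop := fun p => S p ∧ (∃ a ∈ P p, a ∈ U) ∧ ∃ b ∈ P p, b ∉ U with hC
  set x : V → W ⊕ V := label fun p z => (z, w) ∈ pathArcs (P p) with hx
  set y : V → W ⊕ V := label fun p z => (w, z) ∈ pathArcs (P p) with hy
  have hxof : ∀ p z, (z, w) ∈ pathArcs (P p) → x p = .inl z := fun p z h =>
    label_of (f := fun p z => (z, w) ∈ pathArcs (P p))
      (fun _ _ => pathArcs_left_unique (hP p).2.1) h
  have hyof : ∀ p z, (w, z) ∈ pathArcs (P p) → y p = .inl z := fun p z h =>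
    label_of (f := fun p z => (w, z) ∈ pathArcs (P p))
      (fun _ _ => pathArcs_right_unique (hP p).2.1) h
  have cross : ∀ (Z : Set W) (u t : W), Exits T.toSimpleGraphInclusive Z u t → ∀ p,
      (∃ a ∈ P p, a ∈ Z) → (∃ b ∈ P p, b ∉ Z) → u ∈ Z ∧ t ∉ Z ∧
      ((u, t) ∈ pathArcs (P p) ∨ (t, u) ∈ pathArcs (P p)) := by
    rintro Z u t hZ p ⟨a, ha, haZ⟩ ⟨b, hb, hbZ⟩
    obtain ⟨c, d, hcd, h⟩ := exists_crossing ha haZ hb hbZ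
    have hTcd := pathArcs_adj (hP p) hcd
    have hne : c ≠ d := by rintro rfl; tauto
    rcases h with ⟨hc, hd⟩ | ⟨hc, hd⟩
    · obtain ⟨rfl, rfl⟩ := hZ c hc d hd ⟨hne, .inl hTcd⟩
      exact ⟨hc, hd, .inl hcd⟩
    · obtain ⟨rfl, rfl⟩ := hZ d hd c hc ⟨hne.symm, .inr hTcd⟩
      exact ⟨hd, hc, .inr hcd⟩
  have through : ∀ p, A p ∨ C p → w ∈ P p := by
    rintro p (⟨hp, hpU⟩ | ⟨-, h1, h2⟩)
    · exact hroot _ ⟨p, hp, rfl⟩ hpU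
    · rcases (cross U w v hU p h1 h2).2.2 with h | h
      · exact pathArcs_left h
      · exact pathArcs_right h
  have labeled : Labeled D.Adj (fun p => A p ∨ C p) x y := by
    intro p q hp hq
    rw [hnear]
    constructor
    · rintro (rfl | ⟨⟨a, b⟩, h1, h2⟩)
      · exact .inl rfl
      by_cases haw : a = w
      · subst haw
        exact .inr ((hyof p b h1).trans (hyof q b h2).symm)
      -- Both paths contain `w` and a vertex on the same side of it, so both use the edge between
      -- `u` and `w`; it has one orientation only, so they use the same arc.
      obtain ⟨u, -, Z, haZ, -, hwZ, hZ⟩ := exists_side_mem hT.2 haw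
      have c1 := (cross Z u w hZ p ⟨a, pathArcs_left h1, haZ⟩ ⟨w, through p hp, hwZ⟩).2.2
      have c2 := (cross Z u w hZ q ⟨a, pathArcs_left h2, haZ⟩ ⟨w, through q hq, hwZ⟩).2.2
      rcases c1 with c1 | c1 <;> rcases c2 with c2 | c2
      · exact .inl ((hxof p u c1).trans (hxof q u c2).symm)
      · exact absurd (pathArcs_adj (hP q) c2) (hT.1 _ _ (pathArcs_adj (hP p) c1))
      · exact absurd (pathArcs_adj (hP q) c2) (hT.1 _ _ (pathArcs_adj (hP p) c1))
      · exact .inr ((hyof p u c1).trans (hyof q u c2).symm)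
    · rintro (h | h)
      · exact (eq_or_of_label_eq h).imp_right fun ⟨z, h1, h2⟩ => ⟨(z, w), h1, h2⟩
      · exact (eq_or_of_label_eq h).imp_right fun ⟨z, h1, h2⟩ => ⟨(w, z), h1, h2⟩
  have nonempty : ∃ p, A p := by
    obtain ⟨_, ⟨p, hp, rfl⟩, hpU⟩ := hex
    exact ⟨p, hp, hpU⟩
  have closed : ∀ p q, A p → S q → Near D.Adj p q → A q ∨ C q := by
    intro p q hp hq hpq
    rcases (hnear p q).1 hpq with rfl | ⟨⟨a, b⟩, h1, h2⟩
    · exact .inl hp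
    · by_cases hqU : ∀ a ∈ P q, a ∈ U
      · exact .inl ⟨hq, hqU⟩
      · push Not at hqU
        exact .inr ⟨hq, ⟨a, pathArcs_left h2, hp.2 a (pathArcs_left h1)⟩, hqU⟩
  -- The orientation of the edge leaving the branch decides which of the two labels is constant on
  -- the boundary; inside the branch this value does not occur since `v ∉ U`.
  by_cases hvw : T.Adj v w
  · have hCx : ∀ p, C p → x p = .inl v ∧ v ∉ U := by
      rintro p ⟨-, h1, h2⟩
      obtain ⟨-, hv, h | h⟩ := cross U w v hU p h1 h2
      · exact absurd hvw (hT.1 _ _ (pathArcs_adj (hP p) h))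
      · exact ⟨hxof p v h, hv⟩
    refine ⟨_, A, C, x, y, fun p hp => hp.1, nonempty, closed, labeled,
      fun p q hp hq => (hCx p hp).1.trans (hCx q hq).1.symm, fun p q hp hq hpq => ?_⟩
    have := label_eq_inl (hpq.trans (hCx q hq).1)
    exact (hCx q hq).2 (hp.2 v (pathArcs_left this))
  · have hCy : ∀ p, C p → y p = .inl v ∧ v ∉ U := by
      rintro p ⟨-, h1, h2⟩
      obtain ⟨-, hv, h | h⟩ := cross U w v hU p h1 h2
      · exact ⟨hyof p v h, hv⟩
      · exact absurd (pathArcs_adj (hP p) h) hvw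
    refine ⟨_, A, C, y, x, fun p hp => hp.1, nonempty, closed, labeled.swap,
      fun p q hp hq => (hCy p hp).1.trans (hCy q hq).1.symm, fun p q hp hq hpq => ?_⟩
    have := label_eq_inl (hpq.trans (hCy q hq).1)
    exact (hCy q hq).2 (hp.2 v (pathArcs_right this))

end Stars

theorem KernelOn.isKernel {V : Type*} {D : Digraph V} (hD : ∀ u, ¬ D.Adj u u) {K : V → Prop}
    (h : KernelOn D.Adj (fun _ => True) K) : IsKernel D {v | K v} := by
  refine ⟨fun u hu v hv huv => ?_, fun u hu => h.2.2 u trivial hu⟩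
  obtain rfl := h.2.1 u v hu hv (.inr (.inl huv))
  exact hD u huv

end KernelDE

theorem mainTheorem3 :
    KernelDE.PolyTimeKernel (fun n (D : Digraph (Fin n)) =>
      ∃ G : SimpleGraph (Fin n),
        KernelDE.IsDEGraph G ∧ KernelDE.IsSuperOrientation D G ∧ KernelDE.CliqueAcyclic D G) := by
  obtain ⟨f, hf⟩ := KernelDE.St.program_correct (KernelDE.kernelProgram 0) 7
    KernelDE.kernelProgram_wf (by decide) (by decide)
  refine ⟨(KernelDE.kernelProgram 0).program 7, f, ?_⟩
  rintro n D ⟨G, hG, hD, hac⟩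
  have irrefl : ∀ u, ¬ D.Adj u u := fun u hu => G.loopless.irrefl u ((hD u u).2 (.inl hu))
  obtain ⟨m, t, hrun, ht, hout⟩ := hf n D irrefl
  refine ⟨m, t, hrun, ht, ?_⟩
  rcases Nat.eq_zero_or_pos n with rfl | hn
  · exact ⟨fun u => u.elim0, fun u => u.elim0⟩
  rw [hout hn]
  refine KernelDE.KernelOn.isKernel irrefl ?_
  exact KernelDE.run_kernelProgram (σ := KernelDE.initState D) (hac.cliqueExtremes hD)
    (KernelDE.exists_star hG hD)
    (funext fun _ => funext fun _ => propext ⟨And.right, fun h => ⟨rfl, h⟩⟩)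
    fun k hk u v h => hk h.1
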